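/- Let $(W,S)$ be an irreducible Coxeter system (its Dynkin diagram, with an edge between $s\neq t$ whenever $m_{s,t}\neq 2$, is connected). Let $\{b_w\}_{w\in W}$ be the Kazhdan--Lusztig basis of the equal-parameter Hecke algebra of $W$ over $\mathbb{Z}[v^{\pm1}]$, with $b_xb_y=\sum_z h_{x,y,z}b_z$. Let $a(z)\in\mathbb{N}\cup\{\infty\}$ be the smallest $n$ with $v^{n}h_{x,y,z}\in\mathbb{Z}[v]$ for all $x,y\in W$, and put $W_1=\{w\in W\mid a(w)=1\}$. An $H$-cell is a non-empty intersection of a left and a right Kazhdan--Lusztig cell. Assume that $W$ is $a(1)$-finite, i.e. that $W_1$ is finite. Then for any $r,s\in S$ there is a unique $H$-cell $h_{r,s}\subseteq W_1$ all of whose elements have reduced expressions starting in $r$ and ending in $s$; it consists of all elements of $W_1$ whose reduced expressions start in $r$ and end in $s$. If $|S|\geq 2$, then the Dynkin diagram has a largest edge label $m$, and $m<\infty$; an edge with label $m$ is called an $m$-edge. In this case $$|h_{r,s}|=\begin{cases}\left\lfloor\frac{m-1}{2}\right\rfloor & \text{if the shortest path from } r \text{ to } s \text{ in the Dynkin diagram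 uses an } m\text{-edge},\\[2pt] \left\lfloor\frac{m}{2}\right\rfloor & \text{otherwise.}\end{cases}$$ -/

import Mathlib

open LaurentPolynomial

noncomputable section

/-- The Dynkin diagram of a Coxeter matrix, as a graph on the generators: two distinct generators
are joined exactly when they do not commute, i.e. when `m_{i,j} ≠ 2`. -/
def CoxeterMatrix.dynkinDiagram {B : Type*} (M : CoxeterMatrix B) : SimpleGraph B where
  Adj i j := i ≠ j ∧ M i j ≠ 2
  symm := ⟨fun i j h => ⟨h.1.symm, by rw [M.symmetric]; exact h.2⟩⟩
  loopless := ⟨fun _ h => h.1 rfl⟩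

/-- The label `m_{i,j} ∈ ℕ ∪ {∞}`. Mathlib encodes `m_{i,j} = ∞` by the entry `0`. -/
def CoxeterMatrix.label {B : Type*} (M : CoxeterMatrix B) (i j : B) : ℕ∞ :=
  if M i j = 0 then ⊤ else (M i j : ℕ∞)

/-- The set of the labels of the edges of the Dynkin diagram. -/
def CoxeterMatrix.edgeLabels {B : Type*} (M : CoxeterMatrix B) : Set ℕ∞ :=
  {l | ∃ i j, M.dynkinDiagram.Adj i j ∧ M.label i j = l}

namespace CoxeterSystem

variable {B W : Type*} [Group W] {M : CoxeterMatrix B} (cs : CoxeterSystem M W)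

/-- Defining relations of the equal parameter Hecke algebra over `ℤ[v, v⁻¹]` (with `v = T 1`), on
the generators `δ_w`, `w ∈ W`: `δ_1 = 1`, the braid relations `δ_x δ_y = δ_{xy}` for
`ℓ(xy) = ℓ(x) + ℓ(y)`, and the quadratic relations `(δ_s - v⁻¹) (δ_s + v) = 0`. -/
inductive HeckeRel : FreeAlgebra ℤ[T;T⁻¹] W → FreeAlgebra ℤ[T;T⁻¹] W → Prop
  | one : HeckeRel (FreeAlgebra.ι _ 1) 1
  | mul (x y : W) (h : cs.length (x * y) = cs.length x + cs.length y) :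
      HeckeRel (FreeAlgebra.ι _ x * FreeAlgebra.ι _ y) (FreeAlgebra.ι _ (x * y))
  | quad (i : B) :
      HeckeRel ((FreeAlgebra.ι _ (cs.simple i) - algebraMap ℤ[T;T⁻¹] _ (T (-1))) *
        (FreeAlgebra.ι _ (cs.simple i) + algebraMap ℤ[T;T⁻¹] _ (T 1))) 0

/-- The equal parameter Hecke algebra `H_W` over `ℤ[v, v⁻¹]`. -/
def Hecke : Type _ := RingQuot cs.HeckeRel

instance : Ring cs.Hecke := inferInstanceAs (Ring (RingQuot cs.HeckeRel))

instance : Algebra ℤ[T;T⁻¹] cs.Hecke :=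
  inferInstanceAs (Algebra ℤ[T;T⁻¹] (RingQuot cs.HeckeRel))

/-- The quotient map from the free algebra. -/
def heckeMk : FreeAlgebra ℤ[T;T⁻¹] W →ₐ[ℤ[T;T⁻¹]] cs.Hecke :=
  RingQuot.mkAlgHom ℤ[T;T⁻¹] cs.HeckeRel

/-- The standard generators `δ_w` of the Hecke algebra. -/
def delta (w : W) : cs.Hecke := cs.heckeMk (FreeAlgebra.ι _ w)

theorem heckeMk_rel {x y : FreeAlgebra ℤ[T;T⁻¹] W} (h : cs.HeckeRel x y) :
    cs.heckeMk x = cs.heckeMk y :=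
  RingQuot.mkAlgHom_rel ℤ[T;T⁻¹] h

theorem delta_one : cs.delta 1 = 1 := by
  have h := cs.heckeMk_rel HeckeRel.one
  rwa [map_one] at h

theorem delta_mul {x y : W} (h : cs.length (x * y) = cs.length x + cs.length y) :
    cs.delta x * cs.delta y = cs.delta (x * y) := by
  have h := cs.heckeMk_rel (HeckeRel.mul x y h)
  rwa [map_mul] at h

theorem delta_quad (i : B) :
    (cs.delta (cs.simple i) - algebraMap ℤ[T;T⁻¹] _ (T (-1))) *
      (cs.delta (cs.simple i) + algebraMap ℤ[T;T⁻¹] _ (T 1)) = 0 := by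
  have h := cs.heckeMk_rel (HeckeRel.quad i)
  rw [map_mul, map_sub, map_add, AlgHom.commutes, AlgHom.commutes, map_zero] at h
  exact h

theorem algebraMap_T_mul (a b : ℤ) (h : a + b = 0) :
    algebraMap ℤ[T;T⁻¹] cs.Hecke (T a) * algebraMap ℤ[T;T⁻¹] cs.Hecke (T b) = 1 := by
  rw [← map_mul, ← T_add, h, T_zero, map_one]

theorem isUnit_delta_simple (i : B) : IsUnit (cs.delta (cs.simple i)) := by
  have h := cs.delta_quad i
  have hv := cs.algebraMap_T_mul (-1) 1 (by norm_num)
  have hc := Algebra.commutes (T (-1) : ℤ[T;T⁻¹]) (cs.delta (cs.simple i))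
  have hc' := Algebra.commutes (T 1 : ℤ[T;T⁻¹]) (cs.delta (cs.simple i))
  set d := cs.delta (cs.simple i)
  set u := algebraMap ℤ[T;T⁻¹] cs.Hecke (T (-1))
  set v := algebraMap ℤ[T;T⁻¹] cs.Hecke (T 1)
  have h1 : d * (d + v - u) = 1 := by
    have h3 : d * (d + v - u) = (d - u) * (d + v) + u * v + (u * d - d * u) := by noncomm_ring
    rw [h3, h, hv, hc]; simp
  have h2 : (d + v - u) * d = 1 := by
    have h3 : (d + v - u) * d = d * (d + v - u) + (v * d - d * v) - (u * d - d * u) := by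
      noncomm_ring
    rw [h3, h1, hc, hc']; simp
  exact ⟨⟨d, d + v - u, h1, h2⟩, rfl⟩

theorem isUnit_delta (w : W) : IsUnit (cs.delta w) := by
  induction hn : cs.length w generalizing w with
  | zero =>
    rw [cs.length_eq_zero_iff] at hn
    rw [hn, cs.delta_one]
    exact isUnit_one
  | succ n ih =>
    have hw : w ≠ 1 := by
      rintro rfl
      rw [cs.length_one] at hn
      omega
    obtain ⟨i, hi⟩ := cs.exists_leftDescent_of_ne_one hw
    have hl := cs.isLeftDescent_iff.mp hi
    have hm := cs.delta_mul (x := cs.simple i) (y := cs.simple i * w)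
      (by rw [cs.simple_mul_simple_cancel_left, cs.length_simple]; omega)
    rw [cs.simple_mul_simple_cancel_left] at hm
    rw [← hm]
    exact (cs.isUnit_delta_simple i).mul (ih _ (by omega))

/-- The ring homomorphism from the free algebra with `v ↦ v⁻¹` and `δ_w ↦ (δ_{w⁻¹})⁻¹`. -/
def barAux : FreeAlgebra ℤ[T;T⁻¹] W →+* cs.Hecke :=
  letI : Algebra ℤ[T;T⁻¹] cs.Hecke := RingHom.toAlgebra'
    ((algebraMap ℤ[T;T⁻¹] cs.Hecke).comp (invert (R := ℤ) : ℤ[T;T⁻¹] →+* ℤ[T;T⁻¹]))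
    (fun c x => Algebra.commutes (invert c) x)
  (FreeAlgebra.lift ℤ[T;T⁻¹] (fun w : W => Ring.inverse (cs.delta w⁻¹))).toRingHom

theorem barAux_ι (w : W) :
    cs.barAux (FreeAlgebra.ι _ w) = Ring.inverse (cs.delta w⁻¹) := by
  let : Algebra ℤ[T;T⁻¹] cs.Hecke := RingHom.toAlgebra'
    ((algebraMap ℤ[T;T⁻¹] cs.Hecke).comp (invert (R := ℤ) : ℤ[T;T⁻¹] →+* ℤ[T;T⁻¹]))
    (fun c x => Algebra.commutes (invert c) x)
  exact FreeAlgebra.lift_ι_apply (fun w : W => Ring.inverse (cs.delta w⁻¹)) w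

theorem barAux_algebraMap (a : ℤ[T;T⁻¹]) :
    cs.barAux (algebraMap _ _ a) = algebraMap ℤ[T;T⁻¹] cs.Hecke (invert a) := by
  let : Algebra ℤ[T;T⁻¹] cs.Hecke := RingHom.toAlgebra'
    ((algebraMap ℤ[T;T⁻¹] cs.Hecke).comp (invert (R := ℤ) : ℤ[T;T⁻¹] →+* ℤ[T;T⁻¹]))
    (fun c x => Algebra.commutes (invert c) x)
  exact AlgHom.commutes
    (FreeAlgebra.lift ℤ[T;T⁻¹] (fun w : W => Ring.inverse (cs.delta w⁻¹))) a

theorem barAux_rel ⦃x y : FreeAlgebra ℤ[T;T⁻¹] W⦄ (h : cs.HeckeRel x y) :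
    cs.barAux x = cs.barAux y := by
  induction h with
  | one => rw [barAux_ι, inv_one, delta_one, Ring.inverse_one, map_one]
  | mul x y h =>
    have h' : cs.length (y⁻¹ * x⁻¹) = cs.length y⁻¹ + cs.length x⁻¹ := by
      rw [← mul_inv_rev, cs.length_inv, cs.length_inv, cs.length_inv, h, add_comm]
    rw [map_mul, barAux_ι, barAux_ι, barAux_ι, mul_inv_rev, ← cs.delta_mul h']
    obtain ⟨u, hu⟩ := cs.isUnit_delta x⁻¹
    obtain ⟨u', hu'⟩ := cs.isUnit_delta y⁻¹
    rw [← hu, ← hu', ← Units.val_mul, Ring.inverse_unit, Ring.inverse_unit, Ring.inverse_unit,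
      mul_inv_rev, Units.val_mul]
  | quad i =>
    rw [map_mul, map_sub, map_add, barAux_ι, barAux_algebraMap, barAux_algebraMap, map_zero,
      cs.inv_simple, invert_T, invert_T, neg_neg]
    have h := cs.delta_quad i
    have hv := cs.algebraMap_T_mul (-1) 1 (by norm_num)
    have hv' := cs.algebraMap_T_mul 1 (-1) (by norm_num)
    have hc := Algebra.commutes (T (-1) : ℤ[T;T⁻¹]) (cs.delta (cs.simple i))
    have hc' := Algebra.commutes (T 1 : ℤ[T;T⁻¹]) (cs.delta (cs.simple i))
    obtain ⟨d, hd⟩ := cs.isUnit_delta_simple i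
    rw [← hd] at h hc hc' ⊢
    rw [Ring.inverse_unit]
    set u := algebraMap ℤ[T;T⁻¹] cs.Hecke (T (-1))
    set v := algebraMap ℤ[T;T⁻¹] cs.Hecke (T 1)
    have key : (d : cs.Hecke) * (((↑d⁻¹ : cs.Hecke) - v) * ((↑d⁻¹ : cs.Hecke) + u)) * d
        = 0 := by
      have e1 : (d : cs.Hecke) * ((↑d⁻¹ : cs.Hecke) - v) = v * (u - d) := by
        rw [mul_sub, mul_sub, Units.mul_inv, hv', hc']
      have e2 : ((↑d⁻¹ : cs.Hecke) + u) * d = u * (v + d) := by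
        rw [add_mul, mul_add, Units.inv_mul, hv]
      have e3 : (u - (d : cs.Hecke)) * u = u * (u - d) := by
        rw [sub_mul, mul_sub, hc]
      calc (d : cs.Hecke) * (((↑d⁻¹ : cs.Hecke) - v) * ((↑d⁻¹ : cs.Hecke) + u)) * d
          = ((d : cs.Hecke) * ((↑d⁻¹ : cs.Hecke) - v)) * (((↑d⁻¹ : cs.Hecke) + u) * d) := by
            noncomm_ring
        _ = v * ((u - d) * u) * (v + d) := by rw [e1, e2]; noncomm_ring
        _ = - (v * u * (((d : cs.Hecke) - u) * (d + v))) := by rw [e3]; noncomm_ring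
        _ = 0 := by rw [h, mul_zero, neg_zero]
    rwa [Units.mul_left_eq_zero, Units.mul_right_eq_zero] at key

/-- The bar involution of the Hecke algebra: the ring endomorphism with `v ↦ v⁻¹` and
`δ_w ↦ (δ_{w⁻¹})⁻¹`. -/
def bar : cs.Hecke →+* cs.Hecke := RingQuot.lift ⟨cs.barAux, cs.barAux_rel⟩

theorem bar_heckeMk (x : FreeAlgebra ℤ[T;T⁻¹] W) : cs.bar (cs.heckeMk x) = cs.barAux x := by
  have h : RingQuot.mkAlgHom ℤ[T;T⁻¹] cs.HeckeRel x = RingQuot.mkRingHom cs.HeckeRel x := by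
    rw [← RingQuot.mkAlgHom_coe ℤ[T;T⁻¹]]
    rfl
  exact (congrArg (RingQuot.lift ⟨cs.barAux, cs.barAux_rel⟩) h).trans
    (RingQuot.lift_mkRingHom_apply _ _ _)

theorem bar_delta (w : W) : cs.bar (cs.delta w) = Ring.inverse (cs.delta w⁻¹) := by
  rw [delta, bar_heckeMk, barAux_ι]

theorem bar_algebraMap (a : ℤ[T;T⁻¹]) :
    cs.bar (algebraMap _ _ a) = algebraMap _ _ (invert a) := by
  rw [← AlgHom.commutes cs.heckeMk a, bar_heckeMk, barAux_algebraMap]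

/-- `b` is the Kazhdan-Lusztig basis element of `w`: it is invariant under the bar involution and
`b = δ_w + ∑_{y < w} h_{y,w} δ_y` with `h_{y,w} ∈ v ℤ[v]`.
There is exactly one such element. The support condition is imposed through `ℓ(y) < ℓ(w)`; that
the `y` that occur lie below `w` in the Bruhat order is then automatic. -/
def IsKLElement (w : W) (b : cs.Hecke) : Prop :=
  cs.bar b = b ∧ ∃ p : W →₀ ℤ[T;T⁻¹],
    (∀ y ∈ p.support, cs.length y < cs.length w ∧
      ∃ q : Polynomial ℤ, p y = T 1 * Polynomial.toLaurent q) ∧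
    b = cs.delta w + p.sum fun y f => f • cs.delta y

/-- The Kazhdan-Lusztig basis `b_w`: the element singled out by `IsKLElement`. -/
def klBasis (w : W) : cs.Hecke := Classical.epsilon (cs.IsKLElement w)

/-- The structure constants `h_{x,y,z} ∈ ℤ[v, v⁻¹]` of the Kazhdan-Lusztig basis: the coefficients
in the (unique, finite) expansion `b_x b_y = ∑_z h_{x,y,z} b_z`. -/
def klCoeff (x y : W) : W →₀ ℤ[T;T⁻¹] :=
  Classical.epsilon fun h : W →₀ ℤ[T;T⁻¹] =>
    cs.klBasis x * cs.klBasis y = h.sum fun z f => f • cs.klBasis z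

/-- `x ≤_L y`: the preorder generated by `z ←_L y` iff `h_{x,y,z} ≠ 0` for some `x`. -/
def leL (x y : W) : Prop :=
  Relation.ReflTransGen (fun z y => ∃ x, cs.klCoeff x y z ≠ 0) x y

/-- `x ≤_R y`: the preorder generated by `z ←_R y` iff `h_{y,x,z} ≠ 0` for some `x`. -/
def leR (x y : W) : Prop :=
  Relation.ReflTransGen (fun z y => ∃ x, cs.klCoeff y x z ≠ 0) x y

/-- Left cells are the equivalence classes of the preorder `≤_L`. -/
def IsLeftCell (c : Set W) : Prop := ∃ w, c = {x | cs.leL x w ∧ cs.leL w x}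

/-- Right cells are the equivalence classes of the preorder `≤_R`. -/
def IsRightCell (c : Set W) : Prop := ∃ w, c = {x | cs.leR x w ∧ cs.leR w x}

/-- An `H`-cell is a non-empty intersection of a left cell and a right cell. -/
def IsHCell (h : Set W) : Prop :=
  h.Nonempty ∧ ∃ c d, cs.IsLeftCell c ∧ cs.IsRightCell d ∧ h = c ∩ d

/-- Lusztig's `a`-function `W → ℕ ∪ {∞}`: `a(z)` is the smallest `n ∈ ℕ` such that
`v ^ n h_{x,y,z} ∈ ℤ[v]` for all `x, y`, and `∞` if there is no such `n`. -/
def aFunction (z : W) : ℕ∞ :=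
  sInf {k : ℕ∞ | ∃ n : ℕ, k = n ∧ ∀ x y, ∃ q : Polynomial ℤ,
    T (n : ℤ) * cs.klCoeff x y z = Polynomial.toLaurent q}

/-- `W_i`, the set of the elements of `a`-value `i`. -/
def aLevel (i : ℕ) : Set W := {w | cs.aFunction w = i}

/-- Some reduced expression of `w` starts in `r` and ends in `s`. -/
def StartsEnds (r s : B) (w : W) : Prop :=
  ∃ ω : List B, cs.IsReduced ω ∧ cs.wordProd ω = w ∧ ω.head? = some r ∧ ω.getLast? = some s

/-- `h_{r,s}`: the set of the elements of `W_1` that start in `r` and end in `s`. -/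
def hSet (r s : B) : Set W := {w | w ∈ cs.aLevel 1 ∧ cs.StartsEnds r s w}

end CoxeterSystem

end

/-! Call an element rigid if it has exactly one reduced expression. An algebraic half identifies W_1
and its cells in terms of rigid elements; a combinatorial half counts the corresponding words. The
basic facts on Coxeter groups and on the Kazhdan-Lusztig basis are derived from the definitions.

Algebra. The b_w with w not rigid span a two-sided ideal (`klSimple_mul_mem_nonRigid`,
`mul_mem_nonRigid`, `mem_nonRigid_mul`). Modulo it, if z is rigid with first letter t ≠ s, then b_s
b_z is b_{sz}, plus b_{tz} when tz starts in s (`klSimple_mul_klBasis_of_isRigid`). No power of v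
enters, so for rigid z each h_{x,y,z} is an integer or an integer times v + v⁻¹; hence a(z) = 1 for
rigid z ≠ 1. If z is not rigid, then z = xu is a reduced product where u has two left descents s ≠
t, and δ_x b_s b_t b_u = (v + v⁻¹)² δ_x b_u produces a pole of order two at b_z, so a(z) ≠ 1
(`aFunction_ne_one`). Thus W_1 consists of the rigid elements other than 1. Removing first letters
does not leave the left cell (`IsRigid.leL_simple`), so a left cell in W_1 is given by the last
letter and, by inversion, a right cell by the first letter.

Counting. Unique reduced expressions are the words without repeated neighbours and without a full
braid word as a factor (`rigid_of_isRigid`, `isReduced_isRigid_of_rigid`). If there are finitely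
many of them, no label is infinite and at most one edge has a label above 3: otherwise a word could
wander forever (`false_of_branching`, `sym2_eq_of_four_le`). Moving an end of the words across an
edge with label 3 does not change their number (`encard_rigidWords_eq_of_eq_three`). For m ≥ 4 both
ends can thus be moved to the m-edge {a, b}, where the rigid words are the alternating ones with
fewer than m letters: ⌊m/2⌋ of odd length, from a to a, and ⌊(m-1)/2⌋ of even length, from a to b.
For m = 3 the ends can be made equal, and the only closed rigid word at i is the single letter. -/

/-! ### The geometric representation and the order of a product of two simple reflections. -/

open Polynomial.Chebyshev in
/-- The product of two reflections with `f y * g x = 4 cos² (π / m)` has order dividing `m`. -/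
theorem Module.reflection_mul_reflection_pow_eq_one {V : Type*} [AddCommGroup V] [Module ℝ V]
    {x y : V} {f g : Module.Dual ℝ V} (hf : f x = 2) (hg : g y = 2) {m : ℕ} (hm : 2 ≤ m)
    (hfy : f y = -2 * Real.cos (Real.pi / m)) (hgx : g x = -2 * Real.cos (Real.pi / m)) :
    (Module.reflection hf * Module.reflection hg) ^ m = 1 := by
  -- For m = 2 the angle 2π/m is π and its sine vanishes, so the quotient formula for the Chebyshev
  -- polynomials below is not available.
  obtain rfl | hm := hm.eq_or_lt
  · ext z
    rw [Module.reflection_mul_reflection_pow_apply hf hg 2 z]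
    have h1 : f y = 0 := by rw [hfy]; norm_num
    have h2 : g x = 0 := by rw [hgx]; norm_num
    norm_num [h1, h2]
    module
  have hm0 : (m : ℝ) ≠ 0 := by positivity
  have hm3 : (3 : ℝ) ≤ m := by exact_mod_cast hm
  set θ : ℝ := 2 * Real.pi / m with hθ
  have hmθ : (m : ℝ) * θ = 2 * Real.pi := by rw [hθ]; field_simp
  have ht : 2 * Real.cos θ = f y * g x - 2 := by
    rw [hfy, hgx, hθ, mul_div_assoc, Real.cos_two_mul]; ring
  have hs : Real.sin θ ≠ 0 := by
    refine (Real.sin_pos_of_pos_of_lt_pi (by positivity) ?_).ne'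
    rw [hθ, div_lt_iff₀ (by positivity)]
    nlinarith [Real.pi_pos]
  have key : ∀ k : ℤ, (S ℝ k).eval (2 * Real.cos θ) = Real.sin ((k + 1) * θ) / Real.sin θ :=
    fun k => by rw [eq_div_iff hs, S_two_mul_real_cos]
  ext z
  rw [Module.reflection_mul_reflection_pow_apply hf hg m z (2 * Real.cos θ) ht]
  obtain ⟨k, rfl⟩ | ⟨k, rfl⟩ := m.even_or_odd
  · have e1 : ((k + k : ℕ) - 2 : ℤ) / 2 = k - 1 := by omega
    have e2 : ((k + k : ℕ) - 1 : ℤ) / 2 = k - 1 := by omega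
    have h0 : (S ℝ ((k : ℤ) - 1)).eval (2 * Real.cos θ) = 0 := by
      rw [key, show (((k : ℤ) - 1 : ℤ) + 1 : ℝ) * θ = Real.pi by
        push_cast at hmθ ⊢; linarith, Real.sin_pi, zero_div]
    rw [e1, e2, h0]
    simp
  · have e2 : ((2 * k + 1 : ℕ) - 1 : ℤ) / 2 = k := by omega
    have e3 : ((2 * k + 1 : ℕ) - 3 : ℤ) / 2 = k - 1 := by omega
    have e4 : ((2 * k + 1 : ℕ) : ℤ) / 2 = k := by omega
    have e1 : ((2 * k + 1 : ℕ) - 2 : ℤ) / 2 = k - 1 := by omega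
    have h0 : (S ℝ (k : ℤ)).eval (2 * Real.cos θ) + (S ℝ ((k : ℤ) - 1)).eval (2 * Real.cos θ)
        = 0 := by
      rw [key, key, ← add_div, show (((k : ℤ) : ℝ) + 1) * θ = 2 * Real.pi - k * θ by
        push_cast at hmθ ⊢; linarith, show ((((k : ℤ) - 1 : ℤ) : ℝ) + 1) * θ = k * θ by
        push_cast; ring, Real.sin_two_pi_sub]
      simp
    rw [e1, e2, e3, e4, h0]
    simp

open Polynomial.Chebyshev in
/-- The product of two reflections with `f y * g x = 4 cos² (π / m)` has order at least `m`. -/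
theorem Module.dvd_of_reflection_mul_reflection_pow_eq_one {V : Type*} [AddCommGroup V]
    [Module ℝ V] {x y : V} {f g : Module.Dual ℝ V} (hf : f x = 2) (hg : g y = 2)
    (hxy : LinearIndependent ℝ ![x, y]) {m : ℕ} (hm : m ≠ 1)
    (hfy : f y = -2 * Real.cos (Real.pi / m)) (hgx : g x = -2 * Real.cos (Real.pi / m)) {n : ℕ}
    (hn : (Module.reflection hf * Module.reflection hg) ^ n = 1) : m ∣ n := by
  have h := Module.reflection_mul_reflection_pow_apply_self hf hg n
  rw [hn] at h
  rw [LinearIndependent.pair_iff] at hxy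
  obtain ⟨h1, h2⟩ := hxy (((S ℝ n).eval (f y * g x - 2) + (S ℝ (n - 1)).eval (f y * g x - 2)) - 1)
    ((S ℝ (n - 1)).eval (f y * g x - 2) * -g x) (by
      rw [sub_smul, one_smul, sub_add_eq_add_sub, ← h]; simp)
  -- Here m = 0 encodes the label ∞: since π/0 = 0, the cosine is 1 and f y * g x - 2 = 2. The
  -- polynomial S_{n-1} takes the value n at 2, so n = 0.
  obtain rfl | hm0 := Nat.eq_zero_or_pos m
  · rw [hfy, hgx] at h2
    norm_num [S_eval_two] at h2
    simp [h2]
  obtain rfl | hm2 := (show 2 ≤ m by omega).eq_or_lt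
  · rw [hfy, hgx] at h1
    rw [show (-2 : ℝ) * Real.cos (Real.pi / (2 : ℕ)) * (-2 * Real.cos (Real.pi / (2 : ℕ))) - 2 = -2
      by norm_num, S_eval_neg_two, S_eval_neg_two] at h1
    by_contra hodd
    have hodd' : Odd (n : ℤ) := by
      rw [Int.odd_coe_nat]; exact Nat.not_even_iff_odd.mp fun he => hodd he.two_dvd
    have he : Even ((n : ℤ) - 1) := hodd'.sub_odd odd_one
    rw [Int.negOnePow_odd _ hodd', Int.negOnePow_even _ he] at h1
    norm_num at h1
  have hm3 : (3 : ℝ) ≤ m := by exact_mod_cast hm2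
  have hm0' : (m : ℝ) ≠ 0 := by positivity
  set θ : ℝ := 2 * Real.pi / m with hθ
  have ht : f y * g x - 2 = 2 * Real.cos θ := by
    rw [hfy, hgx, hθ, mul_div_assoc, Real.cos_two_mul]; ring
  have hs : Real.sin θ ≠ 0 := by
    refine (Real.sin_pos_of_pos_of_lt_pi (by positivity) ?_).ne'
    rw [hθ, div_lt_iff₀ (by positivity)]
    nlinarith [Real.pi_pos]
  have hc : Real.cos (Real.pi / m) ≠ 0 := by
    refine (Real.cos_pos_of_mem_Ioo ⟨?_, ?_⟩).ne'
    · have : 0 < Real.pi / m := by positivity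
      linarith [Real.pi_pos]
    · rw [div_lt_div_iff₀ (by positivity) (by positivity)]
      nlinarith [Real.pi_pos]
  rw [ht] at h1 h2
  have h2' : (S ℝ (n - 1)).eval (2 * Real.cos θ) = 0 := by
    rw [hgx] at h2
    simpa [hc] using h2
  have hsn := S_two_mul_real_cos θ (n - 1)
  rw [h2', zero_mul] at hsn
  push_cast at hsn
  rw [sub_add_cancel] at hsn
  have hsn1 := S_two_mul_real_cos θ n
  rw [h2', add_zero, sub_eq_zero] at h1
  rw [h1, one_mul] at hsn1
  push_cast at hsn1
  rw [add_mul, one_mul, Real.sin_add, ← hsn, zero_mul, zero_add] at hsn1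
  -- S_{n-1} = 0 and S_n = 1 at 2 cos θ mean sin(nθ) = 0 and sin((n+1)θ) = sin θ. Therefore nθ is a
  -- multiple of 2π, where θ = 2π/m.
  have hcos : Real.cos (n * θ) = 1 := by
    have : Real.sin θ * (Real.cos (n * θ) - 1) = 0 := by linarith
    rcases mul_eq_zero.mp this with h | h
    · exact absurd h hs
    · linarith
  obtain ⟨k, hk⟩ := (Real.cos_eq_one_iff _).mp hcos
  have hk' : (k : ℝ) * m = n := by
    rw [hθ] at hk
    field_simp at hk
    linarith
  have hk'' : (n : ℤ) = m * k := by rw [mul_comm]; exact_mod_cast hk'.symm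
  exact Int.natCast_dvd_natCast.mp ⟨k, hk''⟩

namespace CoxeterMatrix

variable {B : Type*} (M : CoxeterMatrix B)

/-- The simple coroots of the geometric representation. -/
noncomputable def simpleCoroot (i : B) : Module.Dual ℝ (B →₀ ℝ) :=
  Finsupp.lift ℝ ℝ B fun j => -2 * Real.cos (Real.pi / M i j)

theorem simpleCoroot_single (i j : B) :
    M.simpleCoroot i (Finsupp.single j 1) = -2 * Real.cos (Real.pi / M i j) := by
  simp [simpleCoroot]

theorem simpleCoroot_self (i : B) : M.simpleCoroot i (Finsupp.single i 1) = 2 := by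
  simp [simpleCoroot_single]

theorem two_le_of_ne {i j : B} (h : i ≠ j) (h0 : M i j ≠ 0) : 2 ≤ M i j := by
  have := M.off_diagonal i j h
  omega

theorem isLiftable_reflection :
    M.IsLiftable fun i => Module.reflection (M.simpleCoroot_self i) := by
  intro i j
  obtain rfl | hij := eq_or_ne i j
  · rw [M.diagonal, pow_one]
    exact LinearEquiv.ext (Module.involutive_reflection (M.simpleCoroot_self i))
  obtain h0 | h0 := eq_or_ne (M i j) 0
  · rw [h0, pow_zero]
  · exact Module.reflection_mul_reflection_pow_eq_one _ _ (M.two_le_of_ne hij h0)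
      (M.simpleCoroot_single i j) (by rw [M.simpleCoroot_single, M.symmetric])

end CoxeterMatrix

namespace CoxeterSystem

variable {B W : Type*} [Group W] {M : CoxeterMatrix B} (cs : CoxeterSystem M W)

/-- The order of a product of two simple reflections does not drop in W, because it does not drop in
the geometric representation, where the two simple roots are linearly independent. -/
theorem dvd_of_simple_mul_simple_pow_eq_one {i j : B} (hij : i ≠ j) {n : ℕ}
    (h : (cs.simple i * cs.simple j) ^ n = 1) : M i j ∣ n := by
  have h' := congrArg (cs.lift ⟨_, M.isLiftable_reflection⟩) h
  rw [map_pow, map_mul, lift_apply_simple, lift_apply_simple, map_one] at h'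
  refine Module.dvd_of_reflection_mul_reflection_pow_eq_one _ _ ?_ (M.off_diagonal i j hij)
    (M.simpleCoroot_single i j) (by rw [M.simpleCoroot_single, M.symmetric]) h'
  rw [LinearIndependent.pair_iff]
  intro a b hab
  have ha := DFunLike.congr_fun hab i
  have hb := DFunLike.congr_fun hab j
  simp [hij, hij.symm] at ha hb
  exact ⟨ha, hb⟩

/-! ### Parity of inversions and the exchange property. -/

open Classical in
/-- The action of a simple reflection on `W × ℤ/2`, which conjugates the first component and flips
the second one at the simple reflection itself. -/
noncomputable def flip (i : B) : Function.End (W × ZMod 2) := fun x =>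
  (cs.simple i * x.1 * cs.simple i, x.2 + if x.1 = cs.simple i then 1 else 0)

open Classical in
-- Each of the 2n flips compares the current conjugate of x.1 with a simple reflection. Conjugated
-- back to x.1 itself, these are comparisons with the elements s_j (s_i s_j)^k, k < 2n.
theorem flip_mul_flip_pow_apply (i j : B) (n : ℕ) (x : W × ZMod 2) :
    ((cs.flip i * cs.flip j) ^ n) x =
      ((cs.simple i * cs.simple j) ^ n * x.1 * ((cs.simple i * cs.simple j) ^ n)⁻¹,
        x.2 + ∑ k ∈ Finset.range (2 * n),
          if x.1 = cs.simple j * (cs.simple i * cs.simple j) ^ k then 1 else 0) := by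
  set c := cs.simple i * cs.simple j with hc
  have hcj : ∀ k : ℕ, (c ^ k)⁻¹ * cs.simple j = cs.simple j * c ^ k := by
    intro k
    induction k with
    | zero => simp
    | succ k ih =>
      rw [pow_succ, mul_inv_rev, mul_assoc, ih, ← mul_assoc, ← pow_succ, pow_succ', ← mul_assoc]
      congr 1
      simp [hc, mul_assoc]
  induction n with
  | zero => simp; rfl
  | succ n ih =>
    rw [pow_succ']
    change (cs.flip i * cs.flip j) (((cs.flip i * cs.flip j) ^ n) x) = _
    rw [ih]
    change cs.flip i (cs.flip j _) = _
    rw [mul_add, mul_one, Finset.sum_range_succ, Finset.sum_range_succ]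
    simp only [flip]
    ext
    · rw [pow_succ', mul_inv_rev]
      simp only [hc, mul_inv_rev, inv_simple, mul_assoc]
    · have e1 : (c ^ n * x.1 * (c ^ n)⁻¹ = cs.simple j) ↔ x.1 = cs.simple j * c ^ (2 * n) := by
        rw [mul_inv_eq_iff_eq_mul, ← eq_inv_mul_iff_mul_eq, ← mul_assoc, hcj, mul_assoc, two_mul,
          pow_add]
      have e2 : (cs.simple j * (c ^ n * x.1 * (c ^ n)⁻¹) * cs.simple j = cs.simple i) ↔
          x.1 = cs.simple j * c ^ (2 * n + 1) := by
        have e3 : cs.simple j * (c ^ n * x.1 * (c ^ n)⁻¹) * cs.simple j = cs.simple i ↔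
            c ^ n * x.1 * (c ^ n)⁻¹ = cs.simple j * c := by
          rw [← eq_mul_inv_iff_mul_eq, inv_simple, ← eq_inv_mul_iff_mul_eq, inv_simple, hc]
        rw [e3, mul_inv_eq_iff_eq_mul, ← eq_inv_mul_iff_mul_eq, mul_assoc, ← mul_assoc, hcj,
          ← pow_succ', mul_assoc, ← pow_add]
        congr! 3
        omega
      simp only [e1, e2, add_assoc]

/-- With n = m_{i,j} the list of the 2n comparisons is periodic of period n, so every hit is counted
twice and disappears modulo 2. -/
theorem isLiftable_flip : M.IsLiftable cs.flip := by
  classical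
  intro i j
  funext x
  have hzero : (2 : ZMod 2) = 0 := rfl
  rw [flip_mul_flip_pow_apply, two_mul, Finset.sum_range_add]
  simp only [pow_add, simple_mul_simple_pow, one_mul]
  rw [← two_mul, hzero]
  simp
  rfl

open Classical in
theorem lift_flip_wordProd_apply (ω : List B) (x : W × ZMod 2) :
    cs.lift ⟨_, cs.isLiftable_flip⟩ (cs.wordProd ω) x =
      (cs.wordProd ω * x.1 * (cs.wordProd ω)⁻¹, x.2 + (cs.rightInvSeq ω).count x.1) := by
  induction ω with
  | nil => simp; rfl
  | cons i ω ih =>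
    rw [wordProd_cons, map_mul]
    change cs.lift ⟨_, cs.isLiftable_flip⟩ (cs.simple i)
      (cs.lift ⟨_, cs.isLiftable_flip⟩ (cs.wordProd ω) x) = _
    rw [ih, lift_apply_simple, rightInvSeq, List.count_cons]
    ext
    · simp [flip, mul_assoc]
    · have e : cs.wordProd ω * x.1 * (cs.wordProd ω)⁻¹ = cs.simple i ↔
          (cs.wordProd ω)⁻¹ * cs.simple i * cs.wordProd ω = x.1 := by
        rw [mul_inv_eq_iff_eq_mul, ← eq_inv_mul_iff_mul_eq, eq_comm, mul_assoc]
      simp only [flip, e, beq_iff_eq, Nat.cast_add, add_assoc]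
      congr 2
      split_ifs <;> simp

open Classical in
-- The parity is read off from the action of the group element on (t, 0), which does not see the
-- chosen word.
theorem count_rightInvSeq_eq {ω ω' : List B} (h : cs.wordProd ω = cs.wordProd ω') (t : W) :
    ((cs.rightInvSeq ω).count t : ZMod 2) = (cs.rightInvSeq ω').count t := by
  have h1 := cs.lift_flip_wordProd_apply ω (t, 0)
  rw [h, cs.lift_flip_wordProd_apply ω'] at h1
  simpa using (congrArg Prod.snd h1).symm

/-- A word whose right inversions are distinct is reduced. -/
theorem isReduced_of_nodup_rightInvSeq {ω : List B} (h : (cs.rightInvSeq ω).Nodup) :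
    cs.IsReduced ω := by
  classical
  obtain ⟨ω', hω', he⟩ := cs.exists_isReduced (cs.wordProd ω)
  -- In both sequences all multiplicities are 0 or 1, and they agree modulo 2.
  have hp : (cs.rightInvSeq ω).Perm (cs.rightInvSeq ω') := by
    rw [List.perm_ext_iff_of_nodup h hω'.nodup_rightInvSeq]
    intro t
    have hc := cs.count_rightInvSeq_eq he t
    by_cases h1 : t ∈ cs.rightInvSeq ω <;> by_cases h2 : t ∈ cs.rightInvSeq ω' <;>
      simp_all [List.count_eq_one_of_mem, List.count_eq_zero_of_not_mem, hω'.nodup_rightInvSeq]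
  rw [IsReduced, he, hω'.eq, ← cs.length_rightInvSeq ω, ← cs.length_rightInvSeq ω', hp.length_eq]

/-- The exchange property. -/
theorem exists_mul_simple_eq_eraseIdx {ω : List B} {i : B}
    (h : cs.IsRightDescent (cs.wordProd ω) i) :
    ∃ j < ω.length, cs.wordProd ω * cs.simple i = cs.wordProd (ω.eraseIdx j) := by
  classical
  obtain ⟨ω', hω', he⟩ := cs.exists_isReduced (cs.wordProd ω * cs.simple i)
  -- A reduced word of w s_i followed by i is a reduced word of w in which s_i occurs exactly once
  -- as a right inversion. By parity s_i is also a right inversion of ω, and it marks the letter to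
  -- delete.
  have hr : cs.IsReduced (ω' ++ [i]) := by
    rw [IsReduced, wordProd_append, ← he, wordProd_singleton, simple_mul_simple_cancel_right,
      List.length_append, ← hω'.eq, ← he]
    exact (cs.isRightDescent_iff.mp h).symm
  have hmem : cs.simple i ∈ cs.rightInvSeq (ω' ++ [i]) := by
    rw [← List.concat_eq_append, rightInvSeq_concat]
    simp
  have hc := cs.count_rightInvSeq_eq (ω := ω) (ω' := ω' ++ [i]) (by
    rw [wordProd_append, ← he, wordProd_singleton, simple_mul_simple_cancel_right]) (cs.simple i)
  rw [List.count_eq_one_of_mem hr.nodup_rightInvSeq hmem] at hc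
  have hmem' : cs.simple i ∈ cs.rightInvSeq ω := by
    by_contra hn
    rw [List.count_eq_zero_of_not_mem hn] at hc
    simp at hc
  obtain ⟨j, hj, hj'⟩ := List.mem_iff_getElem.mp hmem'
  refine ⟨j, by simpa using hj, ?_⟩
  rw [← cs.wordProd_mul_getD_rightInvSeq, List.getD_eq_getElem _ _ hj, hj']

theorem exists_simple_mul_eq_eraseIdx {ω : List B} {i : B}
    (h : cs.IsLeftDescent (cs.wordProd ω) i) :
    ∃ j < ω.length, cs.simple i * cs.wordProd ω = cs.wordProd (ω.eraseIdx j) := by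
  have h' : cs.IsRightDescent (cs.wordProd ω.reverse) i := by
    rwa [wordProd_reverse, isRightDescent_inv_iff]
  obtain ⟨j, hj, he⟩ := cs.exists_mul_simple_eq_eraseIdx h'
  rw [List.length_reverse] at hj
  refine ⟨ω.length - 1 - j, by omega, ?_⟩
  rw [wordProd_reverse, ← inv_inj, mul_inv_rev, inv_inv, inv_simple, ← wordProd_reverse] at he
  rw [he]
  congr 1
  apply List.ext_getElem?
  intro k
  grind

/-- If `s w` and `w t` are both longer or both shorter than `w` and `s w t` has the length of `w`,
then `s w = w t`. -/
theorem simple_mul_eq_mul_simple {w : W} {i j : B}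
    (h1 : cs.length (cs.simple i * w * cs.simple j) = cs.length w)
    (h2 : cs.length (cs.simple i * w) = cs.length (w * cs.simple j)) :
    cs.simple i * w = w * cs.simple j := by
  have aux : ∀ w : W, cs.length (cs.simple i * w * cs.simple j) = cs.length w →
      cs.length (cs.simple i * w) = cs.length (w * cs.simple j) →
      cs.length w < cs.length (cs.simple i * w) → cs.simple i * w = w * cs.simple j := by
    intro w h1 h2 hlt
    obtain ⟨ω, hω, rfl⟩ := cs.exists_isReduced w
    have hd : cs.IsRightDescent (cs.wordProd (i :: ω)) j := by
      rw [IsRightDescent, wordProd_cons, h1]; exact hlt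
    obtain ⟨k, hk, he⟩ := cs.exists_mul_simple_eq_eraseIdx hd
    rw [wordProd_cons] at he
    cases k with
    | zero =>
      rw [List.eraseIdx_cons_zero] at he
      nth_rewrite 2 [← he]
      rw [simple_mul_simple_cancel_right]
    | succ k =>
      rw [List.eraseIdx_cons_succ, wordProd_cons, mul_assoc, mul_right_inj] at he
      have := cs.length_wordProd_le (ω.eraseIdx k)
      rw [← he, ← h2] at this
      have h3 := List.length_eraseIdx_le ω k
      rw [hω.eq] at hlt
      omega
  rcases cs.length_simple_mul w i with h | h
  · exact aux w h1 h2 (by omega)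
  -- The case where s w and w t are shorter is the other case applied to s w.
  · have e1 := aux (cs.simple i * w)
    rw [simple_mul_simple_cancel_left] at e1
    have e2 := congrArg (· * cs.simple j) (e1 (by rw [h2]) h1.symm (by omega))
    simp only [simple_mul_simple_cancel_right] at e2
    exact e2.symm

end CoxeterSystem

/-! ### Alternating words, and elements with a unique reduced expression. -/

/-- The alternating word `i, j, i, …` with `k` letters. -/
def altWord {B : Type*} : B → B → ℕ → List B
  | _, _, 0 => []
  | i, j, k + 1 => i :: altWord j i k

@[simp] theorem length_altWord {B : Type*} (i j : B) (k : ℕ) : (altWord i j k).length = k := by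
  induction k generalizing i j with
  | zero => rfl
  | succ k ih => simp [altWord, ih]

theorem altWord_eq_reverse {B : Type*} (i j : B) (k : ℕ) :
    altWord i j k = (CoxeterSystem.alternatingWord j i k).reverse := by
  induction k generalizing i j with
  | zero => rfl
  | succ k ih => simp [altWord, CoxeterSystem.alternatingWord, ih]

/-- A word is rigid if it has no repeated consecutive letter and no full braid word as a factor. -/
def CoxeterMatrix.Rigid {B : Type*} (M : CoxeterMatrix B) (ω : List B) : Prop :=
  (∀ i, ¬ [i, i] <:+: ω) ∧ ∀ i j, i ≠ j → M i j ≠ 0 → ¬ altWord i j (M i j) <:+: ω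

theorem CoxeterMatrix.Rigid.of_infix {B : Type*} {M : CoxeterMatrix B} {ω ω' : List B}
    (h : M.Rigid ω) (hi : ω' <:+: ω) : M.Rigid ω' :=
  ⟨fun i hn => h.1 i (hn.trans hi), fun i j hij h0 hn => h.2 i j hij h0 (hn.trans hi)⟩

namespace CoxeterSystem

variable {B W : Type*} [Group W] {M : CoxeterMatrix B} (cs : CoxeterSystem M W)

theorem wordProd_altWord_eq (i j : B) :
    cs.wordProd (altWord i j (M i j)) = cs.wordProd (altWord j i (M i j)) := by
  have h := cs.wordProd_braidWord_eq j i
  rw [braidWord, braidWord] at h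
  rw [altWord_eq_reverse, altWord_eq_reverse, wordProd_reverse, wordProd_reverse, inv_inj,
    M.symmetric i j, h, M.symmetric i j]

theorem leftInvSeq_altWord (i j : B) (k : ℕ) :
    cs.leftInvSeq (altWord i j k) =
      (List.range k).map fun p => (cs.simple i * cs.simple j) ^ p * cs.simple i := by
  induction k generalizing i j with
  | zero => rfl
  | succ k ih =>
    rw [altWord, leftInvSeq, ih, List.range_succ_eq_map, List.map_cons, List.map_map, List.map_map,
      pow_zero, one_mul]
    congr 1
    apply List.map_congr_left
    intro p _
    have h : ∀ p : ℕ, cs.simple i * (cs.simple j * cs.simple i) ^ p =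
        (cs.simple i * cs.simple j) ^ p * cs.simple i := by
      intro p
      induction p with
      | zero => simp
      | succ p ihp => rw [pow_succ, ← mul_assoc, ihp, pow_succ]; simp only [mul_assoc]
    simp only [Function.comp_apply, MulAut.conj_apply, inv_simple, Nat.succ_eq_add_one]
    rw [← mul_assoc, h, pow_succ]
    simp only [mul_assoc]

/-- The inversions (s_i s_j)^p s_i, p < k, are distinct as long as k does not exceed the order of
s_i s_j. -/
theorem isReduced_altWord {i j : B} (hij : i ≠ j) {k : ℕ} (hk : M i j = 0 ∨ k ≤ M i j) :
    cs.IsReduced (altWord i j k) := by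
  rw [← isReduced_reverse_iff]
  apply isReduced_of_nodup_rightInvSeq
  rw [rightInvSeq_reverse, List.nodup_reverse, leftInvSeq_altWord]
  have aux : ∀ p q : ℕ, p < q → q < k →
      (cs.simple i * cs.simple j) ^ p ≠ (cs.simple i * cs.simple j) ^ q := by
    intro p q hpq hq he
    obtain ⟨d, rfl⟩ := Nat.exists_eq_add_of_lt hpq
    rw [add_assoc, pow_add, left_eq_mul] at he
    have hd := cs.dvd_of_simple_mul_simple_pow_eq_one hij he
    rcases hk with hk | hk
    · rw [hk, zero_dvd_iff] at hd
      omega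
    · have := Nat.le_of_dvd (by omega) hd
      omega
  refine List.nodup_range.map_on fun p hp q hq he => ?_
  rw [List.mem_range] at hp hq
  rw [mul_left_inj] at he
  rcases lt_trichotomy p q with h | h | h
  · exact absurd he (aux p q h hq)
  · exact h
  · exact absurd he.symm (aux q p h hp)

/-- Induction on k with the two letters exchanged: starting from w = (j i j …) y, the exchange
property for i deletes a letter. It cannot be one of the alternating prefix, since the alternating
word with k + 1 letters starting in i is reduced; so it comes from y, and i can be put in front. -/
theorem exists_eq_altWord_mul {w : W} {i j : B} (hij : i ≠ j) (hi : cs.IsLeftDescent w i)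
    (hj : cs.IsLeftDescent w j) {k : ℕ} (hk : M i j = 0 ∨ k ≤ M i j) :
    ∃ y, w = cs.wordProd (altWord i j k) * y ∧ cs.length w = k + cs.length y := by
  induction k generalizing i j with
  | zero => exact ⟨w, by simp [altWord]⟩
  | succ k ih =>
    obtain ⟨y, hy, hl⟩ := ih hij.symm hj hi (by rw [M.symmetric]; omega)
    obtain ⟨υ, hυ, rfl⟩ := cs.exists_isReduced y
    have hi' : cs.IsLeftDescent (cs.wordProd (altWord j i k ++ υ)) i := by
      rwa [wordProd_append, ← hy]
    obtain ⟨p, hp, he⟩ := cs.exists_simple_mul_eq_eraseIdx hi'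
    rw [wordProd_append, ← hy] at he
    rcases lt_or_ge p k with hpk | hpk
    · rw [List.eraseIdx_append_of_lt_length (by simpa using hpk), wordProd_append, hy, ← mul_assoc,
        mul_left_inj, ← wordProd_cons] at he
      have h1 := cs.length_wordProd_le ((altWord j i k).eraseIdx p)
      have h2 := (cs.isReduced_altWord hij hk).eq
      have h3 := List.length_eraseIdx_le (altWord j i k) p
      rw [← he] at h1
      rw [altWord] at h2
      simp at h1 h2 h3
      omega
    · rw [List.eraseIdx_append_of_length_le (by simpa using hpk), wordProd_append] at he
      refine ⟨cs.wordProd (υ.eraseIdx (p - k)), ?_, ?_⟩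
      · rw [length_altWord] at he
        rw [altWord, wordProd_cons, mul_assoc, ← he, simple_mul_simple_cancel_left]
      · have h1 := cs.length_wordProd_le (υ.eraseIdx (p - k))
        have hp' : p - k < υ.length := by simp at hp; omega
        have h2 := List.length_eraseIdx_add_one hp'
        have h3 := cs.length_mul_le (cs.wordProd (altWord j i k))
          (cs.wordProd (υ.eraseIdx (p - k)))
        have h4 := cs.length_wordProd_le (altWord j i k)
        rw [length_altWord] at he h4
        rw [← he] at h3
        have h5 := cs.isLeftDescent_iff.mp hi
        rw [hυ.eq] at hl
        omega

/-- For the label ∞, `exists_eq_altWord_mul` would split off more letters than w has. -/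
theorem ne_zero_of_isLeftDescent {w : W} {i j : B} (hij : i ≠ j) (hi : cs.IsLeftDescent w i)
    (hj : cs.IsLeftDescent w j) : M i j ≠ 0 := by
  intro h0
  obtain ⟨y, -, hl⟩ := cs.exists_eq_altWord_mul hij hi hj (k := cs.length w + 1) (Or.inl h0)
  omega

/-- `w` has exactly one reduced expression. -/
def IsRigid (w : W) : Prop :=
  ∀ ω ω' : List B, cs.IsReduced ω → cs.IsReduced ω' → cs.wordProd ω = w → cs.wordProd ω' = w →
    ω = ω'

theorem exists_isReduced_cons {w : W} {i : B} (hi : cs.IsLeftDescent w i) {ω : List B}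
    (hω : cs.IsReduced ω) (h : cs.wordProd ω = cs.simple i * w) :
    cs.IsReduced (i :: ω) ∧ cs.wordProd (i :: ω) = w := by
  have h1 : cs.wordProd (i :: ω) = w := by
    rw [wordProd_cons, h, simple_mul_simple_cancel_left]
  refine ⟨?_, h1⟩
  rw [IsReduced, h1, List.length_cons, ← hω.eq, h]
  exact (cs.isLeftDescent_iff.mp hi).symm

theorem isLeftDescent_of_isReduced_cons {i : B} {ω : List B} (h : cs.IsReduced (i :: ω)) :
    cs.IsLeftDescent (cs.wordProd (i :: ω)) i := by
  have h1 := cs.length_wordProd_le ω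
  rw [IsLeftDescent, wordProd_cons, simple_mul_simple_cancel_left, ← wordProd_cons, h.eq,
    List.length_cons]
  omega

theorem IsReduced.of_cons {cs : CoxeterSystem M W} {i : B} {ω : List B}
    (h : cs.IsReduced (i :: ω)) : cs.IsReduced ω := by
  simpa using h.drop 1

theorem exists_isReduced_head {w : W} {i : B} (hi : cs.IsLeftDescent w i) :
    ∃ ω, cs.IsReduced (i :: ω) ∧ cs.wordProd (i :: ω) = w := by
  obtain ⟨ω, hω, h⟩ := cs.exists_isReduced (cs.simple i * w)
  exact ⟨ω, cs.exists_isReduced_cons hi hω h.symm⟩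

theorem isRigid_one : cs.IsRigid 1 := by
  intro ω ω' h h' e e'
  rw [IsReduced, e, length_one] at h
  rw [IsReduced, e', length_one] at h'
  rw [List.length_eq_zero_iff.mp h.symm, List.length_eq_zero_iff.mp h'.symm]

theorem IsRigid.eq_of_isLeftDescent {cs : CoxeterSystem M W} {w : W} (h : cs.IsRigid w) {i j : B}
    (hi : cs.IsLeftDescent w i) (hj : cs.IsLeftDescent w j) : i = j := by
  obtain ⟨ω, hω, e⟩ := cs.exists_isReduced_head hi
  obtain ⟨ω', hω', e'⟩ := cs.exists_isReduced_head hj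
  exact (List.cons_eq_cons.mp (h _ _ hω hω' e e')).1

theorem IsRigid.simple_mul {cs : CoxeterSystem M W} {w : W} (h : cs.IsRigid w) {i : B}
    (hi : cs.IsLeftDescent w i) : cs.IsRigid (cs.simple i * w) := by
  intro ω ω' hω hω' e e'
  obtain ⟨h1, h2⟩ := cs.exists_isReduced_cons hi hω e
  obtain ⟨h3, h4⟩ := cs.exists_isReduced_cons hi hω' e'
  exact (List.cons_eq_cons.mp (h _ _ h1 h3 h2 h4)).2

theorem isRigid_of_unique_isLeftDescent {w : W} {i : B}
    (hu : ∀ j, cs.IsLeftDescent w j → j = i) (h : cs.IsRigid (cs.simple i * w)) :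
    cs.IsRigid w := by
  by_cases hw : w = 1
  · rw [hw]; exact cs.isRigid_one
  have aux : ∀ ω, cs.IsReduced ω → cs.wordProd ω = w → ∃ τ, ω = i :: τ ∧ cs.IsReduced τ ∧
      cs.wordProd τ = cs.simple i * w := by
    intro ω hω e
    cases ω with
    | nil => exact absurd (by rw [← e, wordProd_nil]) hw
    | cons j τ =>
      obtain rfl := hu j (e ▸ cs.isLeftDescent_of_isReduced_cons hω)
      refine ⟨τ, rfl, hω.of_cons, ?_⟩
      rw [← e, wordProd_cons, simple_mul_simple_cancel_left]
  intro ω ω' hω hω' e e'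
  obtain ⟨τ, rfl, h1, h2⟩ := aux ω hω e
  obtain ⟨τ', rfl, h3, h4⟩ := aux ω' hω' e'
  rw [h τ τ' h1 h3 h2 h4]

theorem IsRigid.inv {cs : CoxeterSystem M W} {w : W} (h : cs.IsRigid w) : cs.IsRigid w⁻¹ := by
  intro ω ω' hω hω' e e'
  have := h ω.reverse ω'.reverse hω.reverse hω'.reverse (by rw [wordProd_reverse, e, inv_inv])
    (by rw [wordProd_reverse, e', inv_inv])
  exact List.reverse_injective this

theorem isRigid_inv_iff {w : W} : cs.IsRigid w⁻¹ ↔ cs.IsRigid w :=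
  ⟨fun h => by simpa using h.inv, fun h => h.inv⟩

/-- An element with several reduced expressions is a reduced product `x u` where `u` has two
left descents. -/
theorem exists_eq_mul_of_not_isRigid {w : W} (h : ¬ cs.IsRigid w) :
    ∃ x u i j, i ≠ j ∧ w = x * u ∧ cs.length w = cs.length x + cs.length u ∧
      cs.IsLeftDescent u i ∧ cs.IsLeftDescent u j ∧
      cs.length (x * cs.simple i * cs.simple j) = cs.length x + 2 := by
  have key : ∀ n w, cs.length w = n → ¬ cs.IsRigid w → ∃ x u i j, i ≠ j ∧ w = x * u ∧
      cs.length w = cs.length x + cs.length u ∧ cs.IsLeftDescent u i ∧ cs.IsLeftDescent u j := by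
    intro n
    induction n with
    | zero =>
      intro w hw h
      rw [length_eq_zero_iff] at hw
      exact absurd (hw ▸ cs.isRigid_one) h
    | succ n ih =>
      intro w hw h
      have hw1 : w ≠ 1 := fun h1 => by rw [h1, length_one] at hw; omega
      obtain ⟨i, hi⟩ := cs.exists_leftDescent_of_ne_one hw1
      by_cases hu : ∃ j, cs.IsLeftDescent w j ∧ j ≠ i
      · obtain ⟨j, hj, hji⟩ := hu
        exact ⟨1, w, i, j, hji.symm, by simp, by simp, hi, hj⟩
      push Not at hu
      have hi' := cs.isLeftDescent_iff.mp hi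
      obtain ⟨x, u, a, b, hab, e, hl, ha, hb⟩ := ih (cs.simple i * w) (by omega)
        fun hr => h (cs.isRigid_of_unique_isLeftDescent hu hr)
      have e' : w = cs.simple i * x * u := by
        rw [mul_assoc, ← e, simple_mul_simple_cancel_left]
      refine ⟨cs.simple i * x, u, a, b, hab, e', ?_, ha, hb⟩
      have h1 := cs.length_mul_le (cs.simple i * x) u
      have h2 := cs.length_mul_le (cs.simple i) x
      rw [← e'] at h1
      rw [length_simple] at h2
      omega
  obtain ⟨x, u, i, j, hij, e, hl, hi, hj⟩ := key _ w rfl h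
  refine ⟨x, u, i, j, hij, e, hl, hi, hj, ?_⟩
  have h0 := cs.ne_zero_of_isLeftDescent hij hi hj
  have h2 : 2 ≤ M i j := M.two_le_of_ne hij h0
  -- Since u has both descents, it starts with s_i s_j, and x s_i s_j is a reduced beginning of w.
  obtain ⟨y, hy, hly⟩ := cs.exists_eq_altWord_mul hij hi hj (Or.inr h2)
  have h3 : w = x * cs.simple i * cs.simple j * y := by
    rw [e, hy]
    simp [altWord, wordProd_cons, mul_assoc]
  have h4 := cs.length_mul_le (x * cs.simple i * cs.simple j) y
  have h5 := cs.length_mul_le (x * cs.simple i) (cs.simple j)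
  have h6 := cs.length_mul_le x (cs.simple i)
  rw [← h3] at h4
  rw [length_simple] at h5 h6
  omega

/-- Replacing a full braid word by its mirror image would give a second reduced expression. -/
theorem rigid_of_isRigid {ω : List B} (hω : cs.IsReduced ω) (h : cs.IsRigid (cs.wordProd ω)) :
    M.Rigid ω := by
  constructor
  · rintro i ⟨α, β, rfl⟩
    have h1 := cs.length_wordProd_le (α ++ β)
    have h2 := hω.eq
    simp only [wordProd_append, wordProd_cons, wordProd_nil, mul_one, simple_mul_simple_self]
      at h1 h2
    rw [h2] at h1
    simp at h1
  · rintro i j hij h0 ⟨α, β, rfl⟩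
    have e : cs.wordProd (α ++ altWord j i (M i j) ++ β) =
        cs.wordProd (α ++ altWord i j (M i j) ++ β) := by
      simp only [wordProd_append, cs.wordProd_altWord_eq i j]
    have hr : cs.IsReduced (α ++ altWord j i (M i j) ++ β) := by
      rw [IsReduced, e, hω.eq]
      simp
    have := h _ _ hω hr rfl e
    obtain ⟨k, hk⟩ := Nat.exists_eq_succ_of_ne_zero h0
    simp only [hk, altWord, List.append_cancel_right_eq, List.append_cancel_left_eq,
      List.cons.injEq] at this
    exact hij this.1

/-- Induction on the word i τ, using that τ is the only reduced expression of its product. If i τ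
were not reduced, τ would have to start in i. If it had a second left descent j, then by
`exists_eq_altWord_mul` and uniqueness for τ it would start with the braid word of i and j. -/
theorem isReduced_isRigid_of_rigid {ω : List B} (h : M.Rigid ω) :
    cs.IsReduced ω ∧ cs.IsRigid (cs.wordProd ω) := by
  induction ω with
  | nil => simpa [IsReduced] using cs.isRigid_one
  | cons i τ ih =>
    obtain ⟨hτ, hr⟩ := ih (h.of_infix (List.suffix_cons i τ).isInfix)
    have hred : cs.IsReduced (i :: τ) := by
      rcases cs.length_simple_mul (cs.wordProd τ) i with hl | hl
      · rw [IsReduced, wordProd_cons, hl, hτ.eq, List.length_cons]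
      · exfalso
        have hd : cs.IsLeftDescent (cs.wordProd τ) i := cs.isLeftDescent_iff.mpr hl
        obtain ⟨υ, hυ, e⟩ := cs.exists_isReduced_head hd
        obtain rfl := hr _ _ hτ hυ rfl e
        exact h.1 i ⟨[], υ, rfl⟩
    refine ⟨hred, cs.isRigid_of_unique_isLeftDescent (i := i) ?_
      (by rwa [wordProd_cons, simple_mul_simple_cancel_left])⟩
    intro j hj
    by_contra hji
    have hi := cs.isLeftDescent_of_isReduced_cons hred
    have hij : i ≠ j := fun e => hji e.symm
    have h0 := cs.ne_zero_of_isLeftDescent hij hi hj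
    obtain ⟨y, hy, hl⟩ := cs.exists_eq_altWord_mul hij hi hj (k := M i j) (Or.inr le_rfl)
    obtain ⟨υ, hυ, rfl⟩ := cs.exists_isReduced y
    refine h.2 i j hij h0 ?_
    obtain ⟨k, hk⟩ := Nat.exists_eq_succ_of_ne_zero h0
    rw [hk] at hy hl ⊢
    rw [altWord, wordProd_cons, wordProd_cons, mul_assoc, mul_right_inj, ← wordProd_append] at hy
    have hr' : cs.IsReduced (altWord j i k ++ υ) := by
      rw [IsReduced, ← hy, hτ.eq, List.length_append, length_altWord]
      rw [hred.eq, hυ.eq, List.length_cons] at hl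
      omega
    have := hr _ _ hτ hr' rfl hy.symm
    exact ⟨[], υ, by simp [altWord, this]⟩

end CoxeterSystem

/-! ### The subsets ℤ[v] and v ℤ[v] of the Laurent polynomials in terms of coefficients. -/

namespace LaurentPolynomial

theorem coeff_T_mul (k : ℤ) (p : ℤ[T;T⁻¹]) (n : ℤ) : (T k * p).coeff n = p.coeff (n - k) := by
  rw [T, AddMonoidAlgebra.coeff_single_mul_eq_mul_coeff (n - k) (by intros; omega), one_mul]

theorem coeff_toLaurent_natCast (q : Polynomial ℤ) (n : ℕ) :
    (Polynomial.toLaurent q).coeff (n : ℤ) = q.coeff n := by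
  rw [coeff_toLaurent]
  exact Finsupp.mapDomain_apply Nat.cast_injective _ _

theorem coeff_toLaurent_of_neg (q : Polynomial ℤ) {n : ℤ} (hn : n < 0) :
    (Polynomial.toLaurent q).coeff n = 0 := by
  rw [coeff_toLaurent]
  refine Finsupp.mapDomain_of_notMem_range _ _ ?_
  rintro ⟨m, rfl⟩
  simp at hn
  omega

theorem exists_eq_toLaurent_iff {p : ℤ[T;T⁻¹]} :
    (∃ q : Polynomial ℤ, p = Polynomial.toLaurent q) ↔ ∀ n < 0, p.coeff n = 0 := by
  constructor
  · rintro ⟨q, rfl⟩ n hn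
    exact coeff_toLaurent_of_neg q hn
  · intro h
    obtain ⟨n, q, hq⟩ := exists_T_pow p
    have hd : Polynomial.X ^ n ∣ q := by
      rw [Polynomial.X_pow_dvd_iff]
      intro d hd
      rw [← coeff_toLaurent_natCast, hq, ← T_mul, coeff_T_mul]
      exact h _ (by omega)
    obtain ⟨r, rfl⟩ := hd
    rw [map_mul, Polynomial.toLaurent_X_pow, T_mul] at hq
    exact ⟨r, ((isUnit_T (n : ℤ)).mul_left_injective hq).symm⟩

/-- The subgroup `v ℤ[v]` of the Laurent polynomials. -/
def positivePart : AddSubgroup ℤ[T;T⁻¹] where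
  carrier := {p | ∀ n ≤ 0, p.coeff n = 0}
  zero_mem' := fun n _ => by simp
  add_mem' := fun ha hb n hn => by simp [ha n hn, hb n hn]
  neg_mem' := fun ha n hn => by simp [ha n hn]

theorem exists_eq_T_mul_toLaurent_iff {p : ℤ[T;T⁻¹]} :
    (∃ q : Polynomial ℤ, p = T 1 * Polynomial.toLaurent q) ↔ p ∈ positivePart := by
  constructor
  · rintro ⟨q, rfl⟩ n hn
    rw [coeff_T_mul]
    exact coeff_toLaurent_of_neg q (by omega)
  · intro h
    obtain ⟨q, hq⟩ := (exists_eq_toLaurent_iff (p := T (-1) * p)).mpr fun n hn => by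
      rw [coeff_T_mul]
      exact h _ (by omega)
    refine ⟨q, ?_⟩
    rw [← hq, ← mul_assoc, ← T_add]
    simp

theorem T_one_mul_mem_positivePart {p : ℤ[T;T⁻¹]} (h : p ∈ positivePart) :
    T 1 * p ∈ positivePart := fun n hn => by
  rw [coeff_T_mul]
  exact h _ (by omega)

theorem eq_zero_of_invert_eq {p : ℤ[T;T⁻¹]} (h : p ∈ positivePart) (hi : invert p = p) :
    p = 0 := by
  ext n
  rcases le_or_gt n 0 with hn | hn
  · simpa using h n hn
  · rw [← hi, invert_apply, h _ (by omega)]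
    simp

end LaurentPolynomial

namespace CoxeterSystem

variable {B W : Type*} [Group W] {M : CoxeterMatrix B} (cs : CoxeterSystem M W)

/-! ### The standard basis -/

open Classical in
/-- Left multiplication by `δ_s` on the free module on `W`. -/
noncomputable def leftOp (i : B) : Module.End ℤ[T;T⁻¹] (W →₀ ℤ[T;T⁻¹]) :=
  Finsupp.linearCombination _ fun w => Finsupp.single (cs.simple i * w) 1 +
    (if cs.IsLeftDescent w i then T (-1) - T 1 else 0 : ℤ[T;T⁻¹]) • Finsupp.single w 1

open Classical in
/-- Right multiplication by `δ_s` on the free module on `W`. -/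
noncomputable def rightOp (i : B) : Module.End ℤ[T;T⁻¹] (W →₀ ℤ[T;T⁻¹]) :=
  Finsupp.linearCombination _ fun w => Finsupp.single (w * cs.simple i) 1 +
    (if cs.IsRightDescent w i then T (-1) - T 1 else 0 : ℤ[T;T⁻¹]) • Finsupp.single w 1

open Classical in
theorem leftOp_single (i : B) (w : W) : cs.leftOp i (Finsupp.single w 1) =
    Finsupp.single (cs.simple i * w) 1 +
      (if cs.IsLeftDescent w i then T (-1) - T 1 else 0 : ℤ[T;T⁻¹]) • Finsupp.single w 1 := by
  rw [leftOp, Finsupp.linearCombination_single, one_smul]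

open Classical in
theorem rightOp_single (i : B) (w : W) : cs.rightOp i (Finsupp.single w 1) =
    Finsupp.single (w * cs.simple i) 1 +
      (if cs.IsRightDescent w i then T (-1) - T 1 else 0 : ℤ[T;T⁻¹]) • Finsupp.single w 1 := by
  rw [rightOp, Finsupp.linearCombination_single, one_smul]

/-- On δ_w, either s w = w t, and then the descent conditions on both sides correspond, or
multiplying by one reflection does not affect the descent at the other side. The dichotomy is
`simple_mul_eq_mul_simple`. -/
theorem commute_leftOp_rightOp (i j : B) : Commute (cs.leftOp i) (cs.rightOp j) := by
  classical
  refine Finsupp.basisSingleOne.ext fun w => ?_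
  simp only [Finsupp.coe_basisSingleOne, Module.End.mul_apply]
  rw [leftOp_single, rightOp_single, map_add, map_add, map_smul, map_smul, leftOp_single,
    rightOp_single, leftOp_single, rightOp_single, ← mul_assoc]
  have h1 := cs.length_simple_mul w i
  have h2 := cs.length_mul_simple w j
  have h3 := cs.length_simple_mul (w * cs.simple j) i
  have h4 := cs.length_mul_simple (cs.simple i * w) j
  rw [← mul_assoc] at h3
  by_cases he : cs.simple i * w = w * cs.simple j
  · have e1 : cs.IsLeftDescent w i ↔ cs.IsRightDescent w j := by
      rw [IsLeftDescent, IsRightDescent, he]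
    have e2 : cs.IsLeftDescent (w * cs.simple j) i ↔ cs.IsRightDescent (cs.simple i * w) j := by
      rw [IsLeftDescent, IsRightDescent, ← mul_assoc, he]
    simp only [e1, e2, he]
  · have hne : cs.length (cs.simple i * w * cs.simple j) = cs.length w →
        cs.length (cs.simple i * w) ≠ cs.length (w * cs.simple j) :=
      fun a b => he (cs.simple_mul_eq_mul_simple a b)
    have e1 : cs.IsLeftDescent (w * cs.simple j) i ↔ cs.IsLeftDescent w i := by
      rw [IsLeftDescent, IsLeftDescent, ← mul_assoc]
      omega
    have e2 : cs.IsRightDescent (cs.simple i * w) j ↔ cs.IsRightDescent w j := by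
      rw [IsRightDescent, IsRightDescent]
      omega
    simp only [e1, e2]
    module

theorem leftOp_quad (i : B) :
    (cs.leftOp i - algebraMap ℤ[T;T⁻¹] _ (T (-1))) * (cs.leftOp i + algebraMap ℤ[T;T⁻¹] _ (T 1))
      = 0 := by
  classical
  refine Finsupp.basisSingleOne.ext fun w => ?_
  have hT : (T (-1) : ℤ[T;T⁻¹]) * T 1 = 1 := by rw [← T_add]; simp
  simp only [Finsupp.coe_basisSingleOne, Module.End.mul_apply, LinearMap.sub_apply,
    LinearMap.add_apply, Module.algebraMap_end_apply, LinearMap.zero_apply, map_add, map_smul,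
    leftOp_single, simple_mul_simple_cancel_left]
  by_cases h : cs.IsLeftDescent w i
  · have h' := cs.isLeftDescent_iff_not_isLeftDescent_mul.mp h
    simp only [h, h', if_true, if_false]
    match_scalars
    · linear_combination -hT
    · ring
  · have h' := not_not.mp fun h'' => h (cs.isLeftDescent_iff_not_isLeftDescent_mul.mpr h'')
    simp only [h, h', if_true, if_false]
    match_scalars
    · linear_combination -hT
    · ring

/-- The right operators reach every basis vector from the one at 1. Identities between left
operators therefore need to be checked at that vector only, which is how independence of the reduced
word and the braid relations are obtained. -/
theorem eq_of_commute_rightOp {f g : Module.End ℤ[T;T⁻¹] (W →₀ ℤ[T;T⁻¹])}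
    (hf : ∀ i, Commute f (cs.rightOp i)) (hg : ∀ i, Commute g (cs.rightOp i))
    (h : f (Finsupp.single 1 1) = g (Finsupp.single 1 1)) : f = g := by
  classical
  refine Finsupp.basisSingleOne.ext fun w => ?_
  simp only [Finsupp.coe_basisSingleOne]
  induction hn : cs.length w generalizing w with
  | zero =>
    rw [length_eq_zero_iff] at hn
    rwa [hn]
  | succ n ih =>
    have hw : w ≠ 1 := fun h1 => by rw [h1, length_one] at hn; omega
    obtain ⟨i, hi⟩ := cs.exists_rightDescent_of_ne_one hw
    have hl := cs.isRightDescent_iff.mp hi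
    have hi' := cs.isRightDescent_iff_not_isRightDescent_mul.mp hi
    have e : (Finsupp.single w 1 : W →₀ ℤ[T;T⁻¹]) =
        cs.rightOp i (Finsupp.single (w * cs.simple i) 1) := by
      rw [rightOp_single, if_neg hi', simple_mul_simple_cancel_right, zero_smul, add_zero]
    rw [e, ← Module.End.mul_apply, ← Module.End.mul_apply, (hf i).eq, (hg i).eq,
      Module.End.mul_apply, Module.End.mul_apply, ih _ (by omega)]

/-- Left multiplication by `δ_w` on the free module on `W`. -/
noncomputable def heckeOp (w : W) : Module.End ℤ[T;T⁻¹] (W →₀ ℤ[T;T⁻¹]) :=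
  ((cs.exists_isReduced w).choose.map cs.leftOp).prod

theorem commute_prod_leftOp_rightOp (ω : List B) (j : B) :
    Commute (ω.map cs.leftOp).prod (cs.rightOp j) := by
  refine Commute.list_prod_left _ _ fun f hf => ?_
  obtain ⟨i, -, rfl⟩ := List.mem_map.mp hf
  exact cs.commute_leftOp_rightOp i j

theorem prod_leftOp_single {ω : List B} {y : W}
    (h : cs.length (cs.wordProd ω * y) = ω.length + cs.length y) :
    (ω.map cs.leftOp).prod (Finsupp.single y 1) = Finsupp.single (cs.wordProd ω * y) 1 := by
  classical
  induction ω with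
  | nil => simp
  | cons i ω ih =>
    have h1 := cs.length_mul_le (cs.wordProd ω) y
    have h2 := cs.length_wordProd_le ω
    have h3 := cs.length_mul_le (cs.simple i) (cs.wordProd ω * y)
    rw [wordProd_cons, mul_assoc, List.length_cons] at h
    rw [length_simple] at h3
    rw [List.map_cons, List.prod_cons, Module.End.mul_apply, ih (by omega), leftOp_single, if_neg,
      zero_smul, add_zero, wordProd_cons, mul_assoc]
    rw [IsLeftDescent]
    omega

theorem heckeOp_single {w y : W} (h : cs.length (w * y) = cs.length w + cs.length y) :
    cs.heckeOp w (Finsupp.single y 1) = Finsupp.single (w * y) 1 := by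
  obtain ⟨h1, h2⟩ := (cs.exists_isReduced w).choose_spec
  have h3 := cs.prod_leftOp_single (ω := (cs.exists_isReduced w).choose) (y := y)
    (by rw [← h2, h]; nth_rewrite 1 [h2]; rw [h1.eq])
  rw [← h2] at h3
  exact h3

theorem commute_heckeOp_rightOp (w : W) (j : B) : Commute (cs.heckeOp w) (cs.rightOp j) :=
  cs.commute_prod_leftOp_rightOp _ j

theorem heckeOp_simple (i : B) : cs.heckeOp (cs.simple i) = cs.leftOp i := by
  classical
  refine cs.eq_of_commute_rightOp (cs.commute_heckeOp_rightOp _) (cs.commute_leftOp_rightOp i) ?_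
  rw [heckeOp_single _ (by simp), leftOp_single, if_neg (cs.not_isLeftDescent_one i)]
  simp

theorem lift_heckeOp_rel ⦃x y : FreeAlgebra ℤ[T;T⁻¹] W⦄ (h : cs.HeckeRel x y) :
    FreeAlgebra.lift ℤ[T;T⁻¹] cs.heckeOp x = FreeAlgebra.lift ℤ[T;T⁻¹] cs.heckeOp y := by
  induction h with
  | one =>
    rw [FreeAlgebra.lift_ι_apply, map_one]
    refine cs.eq_of_commute_rightOp (cs.commute_heckeOp_rightOp _) (fun _ => Commute.one_left _) ?_
    rw [heckeOp_single _ (by simp)]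
    simp
  | mul x y h =>
    rw [map_mul, FreeAlgebra.lift_ι_apply, FreeAlgebra.lift_ι_apply, FreeAlgebra.lift_ι_apply]
    refine cs.eq_of_commute_rightOp
      (fun i => (cs.commute_heckeOp_rightOp _ i).mul_left (cs.commute_heckeOp_rightOp _ i))
      (cs.commute_heckeOp_rightOp _) ?_
    rw [Module.End.mul_apply, heckeOp_single _ (by simp), mul_one, heckeOp_single _ h,
      heckeOp_single _ (by simp), mul_one]
  | quad i =>
    rw [map_mul, map_sub, map_add, FreeAlgebra.lift_ι_apply, AlgHom.commutes, AlgHom.commutes,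
      map_zero, heckeOp_simple, leftOp_quad]

/-- The left regular representation, on the free module on `W`. -/
noncomputable def heckeRep : cs.Hecke →ₐ[ℤ[T;T⁻¹]] Module.End ℤ[T;T⁻¹] (W →₀ ℤ[T;T⁻¹]) :=
  RingQuot.liftAlgHom ℤ[T;T⁻¹] ⟨FreeAlgebra.lift ℤ[T;T⁻¹] cs.heckeOp, cs.lift_heckeOp_rel⟩

theorem heckeRep_delta (w : W) : cs.heckeRep (cs.delta w) = cs.heckeOp w := by
  have h := RingQuot.liftAlgHom_mkAlgHom_apply ℤ[T;T⁻¹] (FreeAlgebra.lift ℤ[T;T⁻¹] cs.heckeOp)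
    cs.lift_heckeOp_rel (FreeAlgebra.ι _ w)
  rw [FreeAlgebra.lift_ι_apply] at h
  exact h

/-- Acting on the basis vector at 1, δ_w gives the basis vector at w. -/
theorem linearIndependent_delta : LinearIndependent ℤ[T;T⁻¹] cs.delta := by
  let f : cs.Hecke →ₗ[ℤ[T;T⁻¹]] (W →₀ ℤ[T;T⁻¹]) :=
    (LinearMap.applyₗ (Finsupp.single 1 1)).comp cs.heckeRep.toLinearMap
  refine LinearIndependent.of_comp f ?_
  have hf : f ∘ cs.delta = Finsupp.basisSingleOne := by
    funext w
    change cs.heckeRep (cs.delta w) (Finsupp.single 1 1) = _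
    rw [heckeRep_delta, heckeOp_single _ (by simp)]
    simp
  rw [hf]
  exact Finsupp.basisSingleOne.linearIndependent

theorem delta_simple_mul_of_not_isLeftDescent {i : B} {w : W} (h : ¬ cs.IsLeftDescent w i) :
    cs.delta (cs.simple i) * cs.delta w = cs.delta (cs.simple i * w) :=
  cs.delta_mul (by rw [cs.not_isLeftDescent_iff.mp h, length_simple, add_comm])

theorem delta_simple_mul_self (i : B) : cs.delta (cs.simple i) * cs.delta (cs.simple i) =
    1 + (T (-1) - T 1 : ℤ[T;T⁻¹]) • cs.delta (cs.simple i) := by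
  have h := cs.delta_quad i
  have hv := cs.algebraMap_T_mul (-1) 1 (by norm_num)
  have hc := Algebra.commutes (T 1 : ℤ[T;T⁻¹]) (cs.delta (cs.simple i))
  rw [sub_mul, mul_add, mul_add, hv, ← hc, sub_eq_zero] at h
  rw [sub_smul, Algebra.smul_def, Algebra.smul_def, ← add_sub_assoc, eq_sub_iff_add_eq, h, add_comm]

theorem delta_simple_mul_of_isLeftDescent {i : B} {w : W} (h : cs.IsLeftDescent w i) :
    cs.delta (cs.simple i) * cs.delta w = cs.delta (cs.simple i * w) +
      (T (-1) - T 1 : ℤ[T;T⁻¹]) • cs.delta w := by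
  have h1 := cs.delta_simple_mul_of_not_isLeftDescent
    (cs.isLeftDescent_iff_not_isLeftDescent_mul.mp h)
  rw [simple_mul_simple_cancel_left] at h1
  rw [← h1, ← mul_assoc, delta_simple_mul_self, add_mul, one_mul, smul_mul_assoc]

theorem span_delta : ⊤ ≤ Submodule.span ℤ[T;T⁻¹] (Set.range cs.delta) := by
  set S := Submodule.span ℤ[T;T⁻¹] (Set.range cs.delta) with hS
  have hd : ∀ w, cs.delta w ∈ S := fun w => Submodule.subset_span ⟨w, rfl⟩
  have hs : ∀ i, ∀ x ∈ S, cs.delta (cs.simple i) * x ∈ S := by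
    intro i x hx
    induction hx using Submodule.span_induction with
    | mem x hx =>
      obtain ⟨w, rfl⟩ := hx
      by_cases h : cs.IsLeftDescent w i
      · rw [cs.delta_simple_mul_of_isLeftDescent h]
        exact S.add_mem (hd _) (S.smul_mem _ (hd _))
      · rw [cs.delta_simple_mul_of_not_isLeftDescent h]
        exact hd _
    | zero => rw [mul_zero]; exact S.zero_mem
    | add x y _ _ hx hy => rw [mul_add]; exact S.add_mem hx hy
    | smul a x _ hx => rw [mul_smul_comm]; exact S.smul_mem _ hx
  have hw : ∀ w, ∀ x ∈ S, cs.delta w * x ∈ S := by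
    intro w x hx
    induction hn : cs.length w generalizing w with
    | zero =>
      rw [length_eq_zero_iff] at hn
      rwa [hn, delta_one, one_mul]
    | succ n ih =>
      have hw : w ≠ 1 := fun h1 => by rw [h1, length_one] at hn; omega
      obtain ⟨i, hi⟩ := cs.exists_leftDescent_of_ne_one hw
      have hl := cs.isLeftDescent_iff.mp hi
      have h1 := cs.delta_simple_mul_of_not_isLeftDescent
        (cs.isLeftDescent_iff_not_isLeftDescent_mul.mp hi)
      rw [simple_mul_simple_cancel_left] at h1
      rw [← h1, mul_assoc]
      exact hs i _ (ih _ (by omega))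
  have hm : ∀ x ∈ S, ∀ y ∈ S, x * y ∈ S := by
    intro x hx y hy
    induction hx using Submodule.span_induction with
    | mem x hx =>
      obtain ⟨w, rfl⟩ := hx
      exact hw w y hy
    | zero => rw [zero_mul]; exact S.zero_mem
    | add a b _ _ ha hb => rw [add_mul]; exact S.add_mem ha hb
    | smul a x _ hx => rw [smul_mul_assoc]; exact S.smul_mem _ hx
  intro x _
  obtain ⟨a, rfl⟩ : ∃ a, cs.heckeMk a = x := RingQuot.mkAlgHom_surjective _ _ x
  induction a using FreeAlgebra.induction with
  | grade0 r =>
    rw [AlgHom.commutes, Algebra.algebraMap_eq_smul_one, ← delta_one]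
    exact S.smul_mem _ (hd 1)
  | grade1 w => exact hd w
  | mul a b ha hb => rw [map_mul]; exact hm _ (ha trivial) _ (hb trivial)
  | add a b ha hb => rw [map_add]; exact S.add_mem (ha trivial) (hb trivial)

/-- The standard basis of the Hecke algebra. -/
noncomputable def deltaBasis : Module.Basis W ℤ[T;T⁻¹] cs.Hecke :=
  Module.Basis.mk cs.linearIndependent_delta cs.span_delta

@[simp] theorem deltaBasis_apply (w : W) : cs.deltaBasis w = cs.delta w :=
  Module.Basis.mk_apply _ _ w

@[simp] theorem deltaBasis_repr_delta (w : W) :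
    cs.deltaBasis.repr (cs.delta w) = Finsupp.single w 1 := by
  rw [← deltaBasis_apply, Module.Basis.repr_self]

/-! ### The bar involution is unitriangular -/

/-- The span of the `δ_y` with `ℓ(y) < n`. -/
noncomputable def lower (n : ℕ) : Submodule ℤ[T;T⁻¹] cs.Hecke :=
  Submodule.span _ (cs.delta '' {y | cs.length y < n})

theorem delta_mem_lower {y : W} {n : ℕ} (h : cs.length y < n) : cs.delta y ∈ cs.lower n :=
  Submodule.subset_span ⟨y, h, rfl⟩

theorem lower_mono {m n : ℕ} (h : m ≤ n) : cs.lower m ≤ cs.lower n :=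
  Submodule.span_mono (Set.image_mono fun _ hy => lt_of_lt_of_le hy h)

theorem mem_lower_iff {n : ℕ} {x : cs.Hecke} :
    x ∈ cs.lower n ↔ ∀ y, n ≤ cs.length y → cs.deltaBasis.repr x y = 0 := by
  have h := cs.deltaBasis.mem_span_image (m := x) (s := {y | cs.length y < n})
  have he : (cs.deltaBasis : W → cs.Hecke) = cs.delta := funext cs.deltaBasis_apply
  rw [he] at h
  rw [lower, h]
  constructor
  · intro h y hy
    by_contra h0
    exact absurd (h (Finsupp.mem_support_iff.mpr h0)) (by simpa using hy)
  · intro h y hy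
    by_contra h0
    exact Finsupp.mem_support_iff.mp hy (h y (by simpa using h0))

theorem delta_simple_mul_mem_lower (i : B) {n : ℕ} {x : cs.Hecke} (hx : x ∈ cs.lower n) :
    cs.delta (cs.simple i) * x ∈ cs.lower (n + 1) := by
  induction hx using Submodule.span_induction with
  | mem x hx =>
    obtain ⟨w, hw, rfl⟩ := hx
    rw [Set.mem_ofPred_eq] at hw
    have h0 := cs.length_simple_mul w i
    by_cases h : cs.IsLeftDescent w i
    · rw [cs.delta_simple_mul_of_isLeftDescent h]
      exact Submodule.add_mem _ (cs.delta_mem_lower (by omega))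
        (Submodule.smul_mem _ _ (cs.delta_mem_lower (by omega)))
    · rw [cs.delta_simple_mul_of_not_isLeftDescent h]
      exact cs.delta_mem_lower (by omega)
  | zero => rw [mul_zero]; exact Submodule.zero_mem _
  | add x y _ _ hx hy => rw [mul_add]; exact Submodule.add_mem _ hx hy
  | smul a x _ hx => rw [mul_smul_comm]; exact Submodule.smul_mem _ _ hx

theorem bar_smul (a : ℤ[T;T⁻¹]) (x : cs.Hecke) : cs.bar (a • x) = invert a • cs.bar x := by
  rw [Algebra.smul_def, map_mul, bar_algebraMap, Algebra.smul_def]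

theorem bar_delta_simple (i : B) : cs.bar (cs.delta (cs.simple i)) =
    cs.delta (cs.simple i) - (T (-1) - T 1 : ℤ[T;T⁻¹]) • (1 : cs.Hecke) := by
  rw [bar_delta, inv_simple]
  have h : (cs.delta (cs.simple i) - (T (-1) - T 1 : ℤ[T;T⁻¹]) • (1 : cs.Hecke)) *
      cs.delta (cs.simple i) = 1 := by
    rw [sub_mul, delta_simple_mul_self, smul_mul_assoc, one_mul, add_sub_cancel_right]
  obtain ⟨u, hu⟩ := cs.isUnit_delta (cs.simple i)
  rw [← hu] at h ⊢
  rw [Ring.inverse_unit, Units.inv_eq_of_mul_eq_one_left h]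

theorem bar_delta_sub_mem_lower (w : W) :
    cs.bar (cs.delta w) - cs.delta w ∈ cs.lower (cs.length w) := by
  induction hn : cs.length w generalizing w with
  | zero =>
    rw [length_eq_zero_iff] at hn
    rw [hn, delta_one, map_one, sub_self]
    exact Submodule.zero_mem _
  | succ n ih =>
    have hw : w ≠ 1 := fun h1 => by rw [h1, length_one] at hn; omega
    obtain ⟨i, hi⟩ := cs.exists_leftDescent_of_ne_one hw
    have hl := cs.isLeftDescent_iff.mp hi
    have h1 := cs.delta_simple_mul_of_not_isLeftDescent
      (cs.isLeftDescent_iff_not_isLeftDescent_mul.mp hi)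
    rw [simple_mul_simple_cancel_left] at h1
    have h2 := ih (cs.simple i * w) (by omega)
    set d := cs.delta (cs.simple i * w) with hd
    rw [← h1, map_mul, bar_delta_simple]
    have h3 : (cs.delta (cs.simple i) - (T (-1) - T 1 : ℤ[T;T⁻¹]) • (1 : cs.Hecke)) * cs.bar d -
        cs.delta (cs.simple i) * d = cs.delta (cs.simple i) * (cs.bar d - d) -
          (T (-1) - T 1 : ℤ[T;T⁻¹]) • (cs.bar d - d) - (T (-1) - T 1 : ℤ[T;T⁻¹]) • d := by
      rw [sub_mul, smul_mul_assoc, one_mul, mul_sub, smul_sub]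
      abel
    rw [h3]
    refine Submodule.sub_mem _ (Submodule.sub_mem _ (cs.delta_simple_mul_mem_lower i h2)
      (Submodule.smul_mem _ _ (cs.lower_mono (by omega) h2)))
      (Submodule.smul_mem _ _ (cs.delta_mem_lower (by omega)))

/-- By unitriangularity of the bar involution, a coefficient at an element of maximal length in the
support is fixed by v ↦ v⁻¹. Lying in v ℤ[v], it vanishes. -/
theorem eq_zero_of_bar_eq {x : cs.Hecke} (hx : cs.bar x = x)
    (hp : ∀ y, cs.deltaBasis.repr x y ∈ positivePart) : x = 0 := by
  classical
  by_contra h0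
  have hne : (cs.deltaBasis.repr x).support.Nonempty := by
    rw [Finsupp.support_nonempty_iff]
    exact fun h => h0 ((map_eq_zero_iff _ cs.deltaBasis.repr.injective).mp h)
  obtain ⟨w, hw, hmax⟩ := Finset.exists_max_image _ cs.length hne
  refine Finsupp.mem_support_iff.mp hw (eq_zero_of_invert_eq (hp w) ?_)
  have e1 : x = ∑ y ∈ (cs.deltaBasis.repr x).support,
      cs.deltaBasis.repr x y • cs.delta y := by
    conv_lhs => rw [← cs.deltaBasis.linearCombination_repr x, Finsupp.linearCombination_apply,
      Finsupp.sum]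
    simp
  have e2 : cs.deltaBasis.repr (cs.bar x) w = invert (cs.deltaBasis.repr x w) := by
    conv_lhs => rw [e1]
    simp only [map_sum, bar_smul, map_smul, Finsupp.coe_finsetSum, Finset.sum_apply,
      Finsupp.smul_apply, smul_eq_mul]
    rw [Finset.sum_eq_single_of_mem w hw]
    · have h := cs.mem_lower_iff.mp (cs.bar_delta_sub_mem_lower w) w le_rfl
      rw [map_sub, Finsupp.sub_apply, sub_eq_zero, deltaBasis_repr_delta,
        Finsupp.single_eq_same] at h
      rw [h, mul_one]
    · intro y hy hyw
      have h := cs.mem_lower_iff.mp (cs.bar_delta_sub_mem_lower y) w (hmax y hy)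
      rw [map_sub, Finsupp.sub_apply, sub_eq_zero, deltaBasis_repr_delta,
        Finsupp.single_eq_of_ne hyw.symm] at h
      rw [h, mul_zero]
  rw [← e2, hx]

end CoxeterSystem

namespace CoxeterSystem

variable {B W : Type*} [Group W] {M : CoxeterMatrix B} (cs : CoxeterSystem M W)

theorem delta_induction {p : cs.Hecke → Prop} (x : cs.Hecke) (delta : ∀ w, p (cs.delta w))
    (zero : p 0) (add : ∀ x y, p x → p y → p (x + y))
    (smul : ∀ (a : ℤ[T;T⁻¹]) x, p x → p (a • x)) : p x := by
  induction cs.span_delta (Submodule.mem_top (x := x)) using Submodule.span_induction with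
  | mem x hx => obtain ⟨w, rfl⟩ := hx; exact delta w
  | zero => exact zero
  | add x y _ _ hx hy => exact add x y hx hy
  | smul a x _ hx => exact smul a x hx

/-! ### Existence and uniqueness of the Kazhdan-Lusztig basis -/

/-- The element `δ_s + v`, the Kazhdan-Lusztig basis element of a simple reflection. -/
noncomputable def klSimple (i : B) : cs.Hecke :=
  cs.delta (cs.simple i) + (T 1 : ℤ[T;T⁻¹]) • 1

theorem bar_klSimple (i : B) : cs.bar (cs.klSimple i) = cs.klSimple i := by
  rw [klSimple, map_add, bar_delta_simple, bar_smul, map_one, invert_T, sub_smul]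
  abel

theorem klSimple_mul_self (i : B) :
    cs.klSimple i * cs.klSimple i = (T 1 + T (-1) : ℤ[T;T⁻¹]) • cs.klSimple i := by
  have hT : (T 1 : ℤ[T;T⁻¹]) * T (-1) = 1 := by rw [← T_add]; simp
  rw [klSimple, mul_add, add_mul, delta_simple_mul_self, smul_mul_assoc, one_mul, mul_smul_comm,
    mul_one]
  match_scalars
  · linear_combination -hT
  · ring

open Classical in
theorem repr_klSimple_mul (i : B) (x : cs.Hecke) (y : W) :
    cs.deltaBasis.repr (cs.klSimple i * x) y = cs.deltaBasis.repr x (cs.simple i * y) +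
      (if cs.IsLeftDescent y i then T (-1) else T 1) * cs.deltaBasis.repr x y := by
  induction x using cs.delta_induction with
  | delta w =>
    rw [klSimple, add_mul, smul_mul_assoc, one_mul, map_add, Finsupp.add_apply, map_smul,
      Finsupp.smul_apply, smul_eq_mul, deltaBasis_repr_delta]
    have e : cs.simple i * y = w ↔ cs.simple i * w = y :=
      ⟨fun h => by rw [← h, simple_mul_simple_cancel_left],
        fun h => by rw [← h, simple_mul_simple_cancel_left]⟩
    by_cases h : cs.IsLeftDescent w i
    · rw [cs.delta_simple_mul_of_isLeftDescent h, map_add, map_smul, Finsupp.add_apply,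
        Finsupp.smul_apply, smul_eq_mul, deltaBasis_repr_delta, deltaBasis_repr_delta]
      by_cases hy : w = y
      · subst hy
        rw [if_pos h]
        simp only [Finsupp.single_apply, eq_comm (a := w) (b := cs.simple i * w)]
        ring
      · rw [Finsupp.single_eq_of_ne (Ne.symm hy)]
        simp only [Finsupp.single_apply, eq_comm (a := w) (b := cs.simple i * y), e]
        ring
    · rw [cs.delta_simple_mul_of_not_isLeftDescent h, deltaBasis_repr_delta]
      by_cases hy : w = y
      · subst hy
        rw [if_neg h]
        simp only [Finsupp.single_apply, eq_comm (a := w) (b := cs.simple i * w)]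
      · rw [Finsupp.single_eq_of_ne (Ne.symm hy)]
        simp only [Finsupp.single_apply, eq_comm (a := w) (b := cs.simple i * y), e]
        ring
  | zero => simp
  | add x y hx hy =>
    rw [mul_add, map_add, Finsupp.add_apply, hx, hy, map_add, Finsupp.add_apply,
      Finsupp.add_apply]
    ring
  | smul a x hx =>
    rw [mul_smul_comm, map_smul, Finsupp.smul_apply, hx, map_smul, Finsupp.smul_apply,
      Finsupp.smul_apply, smul_eq_mul, smul_eq_mul, smul_eq_mul]
    ring

/-- The definition in terms of coordinates in the standard basis, the form in which it is checked
and used below. -/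
theorem isKLElement_iff {w : W} {b : cs.Hecke} : cs.IsKLElement w b ↔ cs.bar b = b ∧
    cs.deltaBasis.repr b w = 1 ∧ ∀ y, y ≠ w → cs.deltaBasis.repr b y ∈ positivePart ∧
      (cs.length w ≤ cs.length y → cs.deltaBasis.repr b y = 0) := by
  classical
  have hsum : ∀ p : W →₀ ℤ[T;T⁻¹], p.sum (fun y f => f • cs.delta y) =
      cs.deltaBasis.repr.symm p := by
    intro p
    rw [Module.Basis.repr_symm_apply, Finsupp.linearCombination_apply]
    simp
  refine and_congr_right fun _ => ?_
  constructor
  · rintro ⟨p, hp, rfl⟩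
    have hr : ∀ y, cs.deltaBasis.repr (cs.delta w + p.sum fun y f => f • cs.delta y) y =
        Finsupp.single w 1 y + p y := by
      intro y
      rw [hsum, map_add, LinearEquiv.apply_symm_apply, deltaBasis_repr_delta, Finsupp.add_apply]
    have h0 : ∀ y, cs.length w ≤ cs.length y → p y = 0 := by
      intro y hy
      by_contra h
      have := (hp y (Finsupp.mem_support_iff.mpr h)).1
      omega
    refine ⟨by rw [hr, Finsupp.single_eq_same, h0 w le_rfl, add_zero], fun y hy => ?_⟩
    rw [hr, Finsupp.single_eq_of_ne hy, zero_add]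
    refine ⟨?_, h0 y⟩
    by_cases h : p y = 0
    · rw [h]; exact zero_mem _
    · exact exists_eq_T_mul_toLaurent_iff.mp (hp y (Finsupp.mem_support_iff.mpr h)).2
  · rintro ⟨h1, h2⟩
    refine ⟨(cs.deltaBasis.repr b).erase w, fun y hy => ?_, ?_⟩
    · rw [Finsupp.support_erase, Finset.mem_erase] at hy
      obtain ⟨h3, h4⟩ := h2 y hy.1
      refine ⟨?_, ?_⟩
      · by_contra hl
        exact Finsupp.mem_support_iff.mp hy.2 (h4 (by omega))
      · rw [Finsupp.erase_ne hy.1]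
        exact exists_eq_T_mul_toLaurent_iff.mpr h3
    · rw [hsum]
      apply cs.deltaBasis.repr.injective
      rw [map_add, LinearEquiv.apply_symm_apply, deltaBasis_repr_delta, ← h1,
        Finsupp.single_add_erase]

theorem IsKLElement.unique {cs : CoxeterSystem M W} {w : W} {b b' : cs.Hecke}
    (h : cs.IsKLElement w b) (h' : cs.IsKLElement w b') : b = b' := by
  rw [isKLElement_iff] at h h'
  rw [← sub_eq_zero]
  refine cs.eq_zero_of_bar_eq (by rw [map_sub, h.1, h'.1]) fun y => ?_
  rw [map_sub, Finsupp.sub_apply]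
  by_cases hy : y = w
  · rw [hy, h.2.1, h'.2.1, sub_self]; exact zero_mem _
  · exact sub_mem (h.2.2 y hy).1 (h'.2.2 y hy).1

/-- The coefficient of `v` in the coordinate of `b_w` at `δ_y`. -/
noncomputable def mu (y w : W) : ℤ := (cs.deltaBasis.repr (cs.klBasis w) y).coeff 1

open Classical in
/-- The `y` in the support of `b_w` with left descent `s`. -/
noncomputable def muSet (i : B) (w : W) : Finset W :=
  (cs.deltaBasis.repr (cs.klBasis w)).support.filter fun y => cs.IsLeftDescent y i

theorem isLeftDescent_of_mem_muSet {i : B} {y w : W} (h : y ∈ cs.muSet i w) :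
    cs.IsLeftDescent y i := by
  classical exact (Finset.mem_filter.mp h).2

/-- In b_s b_w the coefficients away from s w lie in v ℤ[v], except that those at z with s z < z may
have a constant term, namely μ(z, w). Subtracting μ(z, w) b_z removes it and keeps bar invariance.
The hypothesis `H` is the induction hypothesis of the existence proof. -/
theorem isKLElement_step {i : B} {w : W} (hi : ¬ cs.IsLeftDescent w i)
    (H : ∀ y, cs.length y ≤ cs.length w → cs.IsKLElement y (cs.klBasis y)) :
    cs.IsKLElement (cs.simple i * w) (cs.klSimple i * cs.klBasis w -
      ∑ y ∈ cs.muSet i w, (C (cs.mu y w) : ℤ[T;T⁻¹]) • cs.klBasis y) := by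
  classical
  have Hw := cs.isKLElement_iff.mp (H w le_rfl)
  have hl := cs.not_isLeftDescent_iff.mp hi
  have hlt : ∀ y ∈ cs.muSet i w, cs.length y < cs.length w := by
    intro y hy
    by_contra hn
    refine Finsupp.mem_support_iff.mp (Finset.mem_filter.mp hy).1
      ((Hw.2.2 y ?_).2 (by omega))
    rintro rfl
    exact hi (cs.isLeftDescent_of_mem_muSet hy)
  have Hy : ∀ y ∈ cs.muSet i w, _ := fun y hy => cs.isKLElement_iff.mp (H y (hlt y hy).le)
  have hrepr : ∀ z, cs.deltaBasis.repr (cs.klSimple i * cs.klBasis w -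
      ∑ y ∈ cs.muSet i w, (C (cs.mu y w) : ℤ[T;T⁻¹]) • cs.klBasis y) z =
      cs.deltaBasis.repr (cs.klBasis w) (cs.simple i * z) +
      (if cs.IsLeftDescent z i then T (-1) else T 1) * cs.deltaBasis.repr (cs.klBasis w) z -
      ∑ y ∈ cs.muSet i w, C (cs.mu y w) * cs.deltaBasis.repr (cs.klBasis y) z := by
    intro z
    simp only [map_sub, Finsupp.sub_apply, repr_klSimple_mul, map_sum, map_smul,
      Finsupp.coe_finsetSum, Finset.sum_apply, Finsupp.smul_apply, smul_eq_mul]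
  have hCmem : ∀ (n : ℤ) (p : ℤ[T;T⁻¹]), p ∈ positivePart → C n * p ∈ positivePart := by
    intro n p hp
    rw [← smul_eq_C_mul]
    exact zsmul_mem hp n
  rw [isKLElement_iff]
  refine ⟨?_, ?_, fun z hz => ⟨?_, fun hlz => ?_⟩⟩
  · rw [map_sub, map_mul, bar_klSimple, Hw.1, map_sum]
    congr 1
    refine Finset.sum_congr rfl fun y hy => ?_
    rw [bar_smul, invert_C, (Hy y hy).1]
  · rw [hrepr, simple_mul_simple_cancel_left, Hw.2.1,
      (Hw.2.2 (cs.simple i * w) (fun e => by have := congrArg cs.length e; omega)).2 (by omega),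
      mul_zero, add_zero, Finset.sum_eq_zero, sub_zero]
    intro y hy
    have := hlt y hy
    rw [((Hy y hy).2.2 (cs.simple i * w) (fun e => by have := congrArg cs.length e; omega)).2
      (by omega), mul_zero]
  · have hsz : cs.simple i * z ≠ w := fun e => hz (by rw [← e, simple_mul_simple_cancel_left])
    rw [hrepr, add_sub_assoc]
    refine add_mem (Hw.2.2 _ hsz).1 ?_
    by_cases hd : cs.IsLeftDescent z i
    · rw [if_pos hd]
      have hzw : z ≠ w := fun e => hi (e ▸ hd)
      have hpz := (Hw.2.2 z hzw).1
      -- Multiplication by v⁻¹ turns the coefficient of v, which is μ(z, w), into the constant term.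
      have hmain : T (-1) * cs.deltaBasis.repr (cs.klBasis w) z - C (cs.mu z w) ∈ positivePart := by
        intro n hn
        rw [AddMonoidAlgebra.coeff_sub, Finsupp.sub_apply, coeff_T_mul, C_apply]
        rcases hn.eq_or_lt with rfl | hn
        · simp [mu]
        · rw [if_neg hn.ne, hpz _ (by omega), sub_zero]
      by_cases hm : z ∈ cs.muSet i w
      · rw [← Finset.add_sum_erase _ _ hm, (Hy z hm).2.1, mul_one, ← sub_sub]
        refine sub_mem hmain (sum_mem fun y hy => hCmem _ _ ?_)
        rw [Finset.mem_erase] at hy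
        exact ((Hy y hy.2).2.2 z hy.1.symm).1
      · have h0 : cs.deltaBasis.repr (cs.klBasis w) z = 0 := by
          by_contra h0
          exact hm (Finset.mem_filter.mpr ⟨Finsupp.mem_support_iff.mpr h0, hd⟩)
        rw [h0, mul_zero]
        refine sub_mem (zero_mem _) (sum_mem fun y hy => hCmem _ _ ?_)
        exact ((Hy y hy).2.2 z fun e => hm (e ▸ hy)).1
    · rw [if_neg hd]
      refine sub_mem ?_ (sum_mem fun y hy => hCmem _ _ ?_)
      · by_cases hzw : z = w
        · rw [hzw, Hw.2.1, mul_one]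
          intro n hn
          rw [T_apply, if_neg (by omega)]
        · exact T_one_mul_mem_positivePart (Hw.2.2 z hzw).1
      · exact ((Hy y hy).2.2 z fun e => hd (e ▸ cs.isLeftDescent_of_mem_muSet hy)).1
  · have hsz : cs.simple i * z ≠ w := fun e => hz (by rw [← e, simple_mul_simple_cancel_left])
    have h3 := cs.length_simple_mul z i
    rw [hrepr, (Hw.2.2 _ hsz).2 (by omega),
      (Hw.2.2 z (fun e => by have := congrArg cs.length e; omega)).2 (by omega), mul_zero,
      add_zero, Finset.sum_eq_zero, sub_zero]
    intro y hy
    have := hlt y hy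
    rw [((Hy y hy).2.2 z (fun e => by have := congrArg cs.length e; omega)).2 (by omega), mul_zero]

theorem isKLElement_one : cs.IsKLElement 1 1 := by
  classical
  rw [isKLElement_iff, map_one, ← delta_one, deltaBasis_repr_delta]
  refine ⟨rfl, Finsupp.single_eq_same, fun y hy => ?_⟩
  rw [Finsupp.single_eq_of_ne hy]
  exact ⟨zero_mem _, fun _ => rfl⟩

theorem isKLElement_klBasis (w : W) : cs.IsKLElement w (cs.klBasis w) := by
  induction hn : cs.length w using Nat.strong_induction_on generalizing w with
  | _ n ih =>
  by_cases hw : w = 1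
  · rw [hw]
    exact Classical.epsilon_spec ⟨_, cs.isKLElement_one⟩
  obtain ⟨i, hi⟩ := cs.exists_leftDescent_of_ne_one hw
  have hl := cs.isLeftDescent_iff.mp hi
  have h := cs.isKLElement_step (cs.isLeftDescent_iff_not_isLeftDescent_mul.mp hi)
    fun y hy => ih (cs.length y) (by omega) y rfl
  rw [simple_mul_simple_cancel_left] at h
  exact Classical.epsilon_spec ⟨_, h⟩

theorem IsKLElement.eq_klBasis {cs : CoxeterSystem M W} {w : W} {b : cs.Hecke}
    (h : cs.IsKLElement w b) : b = cs.klBasis w :=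
  h.unique (cs.isKLElement_klBasis w)

theorem klBasis_one : cs.klBasis 1 = 1 := cs.isKLElement_one.eq_klBasis.symm

theorem bar_klBasis (w : W) : cs.bar (cs.klBasis w) = cs.klBasis w := (cs.isKLElement_klBasis w).1

theorem repr_klBasis_self (w : W) : cs.deltaBasis.repr (cs.klBasis w) w = 1 :=
  (cs.isKLElement_iff.mp (cs.isKLElement_klBasis w)).2.1

theorem repr_klBasis_mem_positivePart {y w : W} (h : y ≠ w) :
    cs.deltaBasis.repr (cs.klBasis w) y ∈ positivePart :=
  ((cs.isKLElement_iff.mp (cs.isKLElement_klBasis w)).2.2 y h).1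

theorem repr_klBasis_eq_zero {y w : W} (h : y ≠ w) (hl : cs.length w ≤ cs.length y) :
    cs.deltaBasis.repr (cs.klBasis w) y = 0 :=
  ((cs.isKLElement_iff.mp (cs.isKLElement_klBasis w)).2.2 y h).2 hl

theorem klBasis_sub_delta_mem_lower (w : W) :
    cs.klBasis w - cs.delta w ∈ cs.lower (cs.length w) := by
  classical
  rw [mem_lower_iff]
  intro y hy
  rw [map_sub, Finsupp.sub_apply, deltaBasis_repr_delta]
  by_cases h : y = w
  · rw [h, repr_klBasis_self, Finsupp.single_eq_same, sub_self]
  · rw [cs.repr_klBasis_eq_zero h hy, Finsupp.single_eq_of_ne h, sub_zero]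

/-! ### Multiplication by the elements of the simple reflections -/

theorem klSimple_mul_klBasis_of_not_isLeftDescent {i : B} {w : W} (hi : ¬ cs.IsLeftDescent w i) :
    cs.klSimple i * cs.klBasis w = cs.klBasis (cs.simple i * w) +
      ∑ y ∈ cs.muSet i w, (C (cs.mu y w) : ℤ[T;T⁻¹]) • cs.klBasis y := by
  rw [← (cs.isKLElement_step hi fun y _ => cs.isKLElement_klBasis y).eq_klBasis, sub_add_cancel]

theorem klBasis_simple (i : B) : cs.klBasis (cs.simple i) = cs.klSimple i := by
  have h := cs.klSimple_mul_klBasis_of_not_isLeftDescent (cs.not_isLeftDescent_one i)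
  have he : cs.muSet i 1 = ∅ := by
    classical
    rw [muSet, klBasis_one, ← delta_one, deltaBasis_repr_delta, Finset.filter_eq_empty_iff]
    intro y hy
    rw [Finsupp.mem_support_single] at hy
    rw [hy.1]
    exact cs.not_isLeftDescent_one i
  rw [he, klBasis_one, mul_one, mul_one, Finset.sum_empty, add_zero] at h
  exact h.symm

theorem length_lt_of_mem_muSet {i : B} {y w : W} (h : y ∈ cs.muSet i w)
    (hi : ¬ cs.IsLeftDescent w i) : cs.length y < cs.length w := by
  classical
  by_contra hn
  refine Finsupp.mem_support_iff.mp (Finset.mem_filter.mp h).1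
    (cs.repr_klBasis_eq_zero ?_ (by omega))
  rintro rfl
  exact hi (cs.isLeftDescent_of_mem_muSet h)

/-- Write b_w as b_s b_{sw} minus terms b_y with s y < y. The first is an eigenvector because b_s² =
(v + v⁻¹) b_s, the others by induction. -/
theorem klSimple_mul_klBasis_of_isLeftDescent {i : B} {w : W} (hi : cs.IsLeftDescent w i) :
    cs.klSimple i * cs.klBasis w = (T 1 + T (-1) : ℤ[T;T⁻¹]) • cs.klBasis w := by
  induction hn : cs.length w using Nat.strong_induction_on generalizing w with
  | _ n ih =>
  have hi' := cs.isLeftDescent_iff_not_isLeftDescent_mul.mp hi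
  have hl := cs.isLeftDescent_iff.mp hi
  have h := cs.klSimple_mul_klBasis_of_not_isLeftDescent hi'
  rw [simple_mul_simple_cancel_left] at h
  replace h := eq_sub_of_add_eq h.symm
  rw [h, mul_sub, ← mul_assoc, klSimple_mul_self, smul_sub, smul_mul_assoc, Finset.mul_sum,
    Finset.smul_sum]
  congr 1
  refine Finset.sum_congr rfl fun y hy => ?_
  have := cs.length_lt_of_mem_muSet hy hi'
  rw [mul_smul_comm, ih (cs.length y) (by omega) (cs.isLeftDescent_of_mem_muSet hy) rfl,
    smul_comm]

/-- Comparison of the coefficients at δ_y in b_s b_w = (v + v⁻¹) b_w. -/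
theorem repr_klBasis_of_isLeftDescent {i : B} {y w : W} (hw : cs.IsLeftDescent w i)
    (hy : ¬ cs.IsLeftDescent y i) : cs.deltaBasis.repr (cs.klBasis w) y =
      T 1 * cs.deltaBasis.repr (cs.klBasis w) (cs.simple i * y) := by
  classical
  have h := cs.repr_klSimple_mul i (cs.klBasis w) y
  rw [cs.klSimple_mul_klBasis_of_isLeftDescent hw, if_neg hy, map_smul, Finsupp.smul_apply,
    smul_eq_mul, add_mul, add_comm, add_right_cancel_iff] at h
  rw [← h, ← mul_assoc, ← T_add]
  simp

/-- The coefficient at y is v times the one at s y, which lies in v ℤ[v] unless s y = w; so it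
starts with v² at the earliest. -/
theorem mu_eq_zero {i : B} {y w : W} (hw : cs.IsLeftDescent w i) (hy : ¬ cs.IsLeftDescent y i)
    (h : y ≠ cs.simple i * w) : cs.mu y w = 0 := by
  rw [mu, cs.repr_klBasis_of_isLeftDescent hw hy, coeff_T_mul]
  refine cs.repr_klBasis_mem_positivePart (fun e => h ?_) _ (by norm_num)
  rw [← e, simple_mul_simple_cancel_left]

theorem mu_simple_mul {i : B} {w : W} (hw : cs.IsLeftDescent w i) :
    cs.mu (cs.simple i * w) w = 1 := by
  rw [mu, cs.repr_klBasis_of_isLeftDescent hw (cs.isLeftDescent_iff_not_isLeftDescent_mul.mp hw),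
    simple_mul_simple_cancel_left, repr_klBasis_self, mul_one, T_apply, if_pos rfl]

/-! ### The Kazhdan-Lusztig basis as a basis -/

theorem linearIndependent_klBasis : LinearIndependent ℤ[T;T⁻¹] cs.klBasis := by
  classical
  rw [linearIndependent_iff]
  intro f hf
  by_contra h0
  obtain ⟨w, hw, hmax⟩ := Finset.exists_max_image _ cs.length (Finsupp.support_nonempty_iff.mpr h0)
  have h1 := DFunLike.congr_fun (congrArg cs.deltaBasis.repr hf) w
  rw [Finsupp.linearCombination_apply, Finsupp.sum, map_sum, Finsupp.coe_finsetSum,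
    Finset.sum_apply, Finset.sum_eq_single_of_mem w hw] at h1
  · simp only [map_smul, Finsupp.smul_apply, repr_klBasis_self, smul_eq_mul, mul_one, map_zero,
      Finsupp.coe_zero, Pi.zero_apply] at h1
    exact Finsupp.mem_support_iff.mp hw h1
  · intro y hy hyw
    rw [map_smul, Finsupp.smul_apply, cs.repr_klBasis_eq_zero hyw.symm (hmax y hy), smul_zero]

theorem lower_le_span_klBasis (n : ℕ) :
    cs.lower n ≤ Submodule.span ℤ[T;T⁻¹] (cs.klBasis '' {y | cs.length y < n}) := by
  induction n with
  | zero => exact Submodule.span_le.mpr fun x hx => by obtain ⟨y, hy, -⟩ := hx; simp at hy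
  | succ n ih =>
    refine Submodule.span_le.mpr ?_
    rintro _ ⟨y, hy, rfl⟩
    have hy' : cs.length y ≤ n := Nat.lt_succ_iff.mp hy
    rw [← sub_sub_cancel (cs.klBasis y) (cs.delta y)]
    exact Submodule.sub_mem _ (Submodule.subset_span ⟨y, hy, rfl⟩)
      (Submodule.span_mono (Set.image_mono fun w (hw : _ < n) => hw.trans (Nat.lt_succ_self n))
        (ih (cs.lower_mono hy' (cs.klBasis_sub_delta_mem_lower y))))

theorem span_klBasis : ⊤ ≤ Submodule.span ℤ[T;T⁻¹] (Set.range cs.klBasis) := by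
  refine cs.span_delta.trans (Submodule.span_le.mpr ?_)
  rintro _ ⟨w, rfl⟩
  exact Submodule.span_mono (Set.image_subset_range _ _)
    (cs.lower_le_span_klBasis _ (cs.delta_mem_lower (Nat.lt_succ_self _)))

/-- The Kazhdan-Lusztig basis of the Hecke algebra. -/
noncomputable def klBas : Module.Basis W ℤ[T;T⁻¹] cs.Hecke :=
  Module.Basis.mk cs.linearIndependent_klBasis cs.span_klBasis

@[simp] theorem klBas_apply (w : W) : cs.klBas w = cs.klBasis w := Module.Basis.mk_apply _ _ w

@[simp] theorem klBas_repr_klBasis (w : W) :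
    cs.klBas.repr (cs.klBasis w) = Finsupp.single w 1 := by
  rw [← klBas_apply, Module.Basis.repr_self]

theorem klCoeff_eq (x y : W) :
    cs.klCoeff x y = cs.klBas.repr (cs.klBasis x * cs.klBasis y) := by
  have hsum : ∀ p : W →₀ ℤ[T;T⁻¹], p.sum (fun y f => f • cs.klBasis y) =
      cs.klBas.repr.symm p := by
    intro p
    rw [Module.Basis.repr_symm_apply, Finsupp.linearCombination_apply]
    simp
  have h : cs.klBasis x * cs.klBasis y =
      (cs.klCoeff x y).sum fun z f => f • cs.klBasis z :=
    Classical.epsilon_spec (p := fun h : W →₀ ℤ[T;T⁻¹] =>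
      cs.klBasis x * cs.klBasis y = h.sum fun z f => f • cs.klBasis z)
      ⟨cs.klBas.repr (cs.klBasis x * cs.klBasis y), by rw [hsum, LinearEquiv.symm_apply_apply]⟩
  rw [h, hsum, LinearEquiv.apply_symm_apply]

theorem klBasis_induction {p : cs.Hecke → Prop} (x : cs.Hecke) (klBasis : ∀ w, p (cs.klBasis w))
    (zero : p 0) (add : ∀ x y, p x → p y → p (x + y))
    (smul : ∀ (a : ℤ[T;T⁻¹]) x, p x → p (a • x)) : p x := by
  induction cs.span_klBasis (Submodule.mem_top (x := x)) using Submodule.span_induction with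
  | mem x hx => obtain ⟨w, rfl⟩ := hx; exact klBasis w
  | zero => exact zero
  | add x y _ _ hx hy => exact add x y hx hy
  | smul a x _ hx => exact smul a x hx

/-! ### The anti-involution -/

/-- The anti-involution `δ_w ↦ δ_{w⁻¹}`, with values in the opposite algebra. -/
noncomputable def antiHom : cs.Hecke →ₐ[ℤ[T;T⁻¹]] cs.Heckeᵐᵒᵖ :=
  RingQuot.liftAlgHom ℤ[T;T⁻¹]
    ⟨FreeAlgebra.lift ℤ[T;T⁻¹] fun w => MulOpposite.op (cs.delta w⁻¹), fun x y h => by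
      induction h with
      | one => rw [FreeAlgebra.lift_ι_apply, map_one, inv_one, delta_one, MulOpposite.op_one]
      | mul x y h =>
        rw [map_mul, FreeAlgebra.lift_ι_apply, FreeAlgebra.lift_ι_apply, FreeAlgebra.lift_ι_apply,
          ← MulOpposite.op_mul, cs.delta_mul, mul_inv_rev]
        rw [← mul_inv_rev, length_inv, length_inv, length_inv, h, add_comm]
      | quad i =>
        rw [map_mul, map_sub, map_add, FreeAlgebra.lift_ι_apply, AlgHom.commutes,
          AlgHom.commutes, map_zero, inv_simple, MulOpposite.algebraMap_apply,
          MulOpposite.algebraMap_apply, ← MulOpposite.op_sub, ← MulOpposite.op_add,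
          ← MulOpposite.op_mul, MulOpposite.op_eq_zero_iff]
        have h := cs.delta_quad i
        have h1 := Algebra.commutes (T 1 : ℤ[T;T⁻¹]) (cs.delta (cs.simple i))
        have h2 := Algebra.commutes (T (-1) : ℤ[T;T⁻¹]) (cs.delta (cs.simple i))
        have h3 := Algebra.commutes (T 1 : ℤ[T;T⁻¹]) (algebraMap ℤ[T;T⁻¹] cs.Hecke (T (-1)))
        rw [sub_mul, mul_add, mul_add, ← h1, h2, ← h3] at h
        rw [add_mul, mul_sub, mul_sub, ← h]
        abel⟩

/-- The anti-involution `δ_w ↦ δ_{w⁻¹}`. -/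
noncomputable def anti : cs.Hecke →ₗ[ℤ[T;T⁻¹]] cs.Hecke :=
  (MulOpposite.opLinearEquiv ℤ[T;T⁻¹]).symm.toLinearMap.comp cs.antiHom.toLinearMap

theorem anti_mul (x y : cs.Hecke) : cs.anti (x * y) = cs.anti y * cs.anti x := by
  change MulOpposite.unop (cs.antiHom (x * y)) = _
  rw [map_mul]
  rfl

theorem anti_delta (w : W) : cs.anti (cs.delta w) = cs.delta w⁻¹ := by
  have h := RingQuot.liftAlgHom_mkAlgHom_apply ℤ[T;T⁻¹]
    (FreeAlgebra.lift ℤ[T;T⁻¹] fun w => MulOpposite.op (cs.delta w⁻¹)) (s := cs.HeckeRel) (by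
      intro x y h
      have := congrArg cs.antiHom (cs.heckeMk_rel h)
      have e : ∀ z, cs.antiHom (cs.heckeMk z) =
          FreeAlgebra.lift ℤ[T;T⁻¹] (fun w => MulOpposite.op (cs.delta w⁻¹)) z :=
        fun z => RingQuot.liftAlgHom_mkAlgHom_apply ..
      rwa [e, e] at this) (FreeAlgebra.ι _ w)
  rw [FreeAlgebra.lift_ι_apply] at h
  exact congrArg MulOpposite.unop h

theorem anti_anti (x : cs.Hecke) : cs.anti (cs.anti x) = x := by
  induction x using cs.delta_induction with
  | delta w => rw [anti_delta, anti_delta, inv_inv]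
  | zero => rw [map_zero, map_zero]
  | add x y hx hy => rw [map_add, map_add, hx, hy]
  | smul a x hx => rw [map_smul, map_smul, hx]

theorem bar_anti (x : cs.Hecke) : cs.bar (cs.anti x) = cs.anti (cs.bar x) := by
  induction x using cs.delta_induction with
  | delta w =>
    rw [anti_delta, bar_delta, bar_delta, inv_inv]
    have h := Ring.inverse_mul_cancel _ (cs.isUnit_delta w⁻¹)
    have h' := congrArg cs.anti h
    rw [anti_mul, anti_delta, inv_inv, ← delta_one, anti_delta, inv_one, delta_one] at h'
    calc Ring.inverse (cs.delta w) = Ring.inverse (cs.delta w) *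
          (cs.delta w * cs.anti (Ring.inverse (cs.delta w⁻¹))) := by rw [h', mul_one]
      _ = _ := by rw [← mul_assoc, Ring.inverse_mul_cancel _ (cs.isUnit_delta w), one_mul]
  | zero => simp only [map_zero]
  | add x y hx hy => simp only [map_add, hx, hy]
  | smul a x hx => rw [map_smul, bar_smul, bar_smul, map_smul, hx]

theorem deltaBasis_repr_anti (x : cs.Hecke) (y : W) :
    cs.deltaBasis.repr (cs.anti x) y = cs.deltaBasis.repr x y⁻¹ := by
  classical
  induction x using cs.delta_induction with
  | delta w =>
    rw [anti_delta, deltaBasis_repr_delta, deltaBasis_repr_delta, Finsupp.single_apply,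
      Finsupp.single_apply]
    simp only [inv_eq_iff_eq_inv]
  | zero => simp
  | add x y hx hy => simp only [map_add, Finsupp.add_apply, hx, hy]
  | smul a x hx => simp only [map_smul, Finsupp.smul_apply, hx]

theorem anti_klBasis (w : W) : cs.anti (cs.klBasis w) = cs.klBasis w⁻¹ := by
  refine IsKLElement.eq_klBasis ?_
  rw [isKLElement_iff]
  refine ⟨by rw [bar_anti, bar_klBasis], ?_, fun y hy => ?_⟩
  · rw [deltaBasis_repr_anti, inv_inv, repr_klBasis_self]
  · have hy' : y⁻¹ ≠ w := fun e => hy (by rw [← e, inv_inv])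
    rw [deltaBasis_repr_anti, length_inv]
    refine ⟨cs.repr_klBasis_mem_positivePart hy', fun h => cs.repr_klBasis_eq_zero hy' ?_⟩
    rwa [length_inv]

theorem klBas_repr_anti (x : cs.Hecke) (y : W) :
    cs.klBas.repr (cs.anti x) y = cs.klBas.repr x y⁻¹ := by
  classical
  induction x using cs.klBasis_induction with
  | klBasis w =>
    rw [anti_klBasis, klBas_repr_klBasis, klBas_repr_klBasis, Finsupp.single_apply,
      Finsupp.single_apply]
    simp only [inv_eq_iff_eq_inv]
  | zero => simp
  | add x y hx hy => simp only [map_add, Finsupp.add_apply, hx, hy]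
  | smul a x hx => simp only [map_smul, Finsupp.smul_apply, hx]

/-- This transports statements about left descents and left cells to the right. -/
theorem klCoeff_inv (x y z : W) : cs.klCoeff x y z = cs.klCoeff y⁻¹ x⁻¹ z⁻¹ := by
  rw [klCoeff_eq, klCoeff_eq, ← anti_klBasis, ← anti_klBasis, ← anti_mul, klBas_repr_anti, inv_inv]

end CoxeterSystem

namespace CoxeterSystem

variable {B W : Type*} [Group W] {M : CoxeterMatrix B} (cs : CoxeterSystem M W)

/-! ### Descents in products -/

theorem T_one_add_T_neg_one_ne_zero : (T 1 + T (-1) : ℤ[T;T⁻¹]) ≠ 0 := by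
  intro h
  have := congrArg (fun p : ℤ[T;T⁻¹] => p.coeff 1) h
  simp at this

theorem klBas_repr_klSimple_mul_eq_zero {i : B} {z : W} (hz : ¬ cs.IsLeftDescent z i)
    (x : cs.Hecke) : cs.klBas.repr (cs.klSimple i * x) z = 0 := by
  classical
  induction x using cs.klBasis_induction with
  | klBasis w =>
    have hne : ∀ y, cs.IsLeftDescent y i → cs.klBas.repr (cs.klBasis y) z = 0 := by
      intro y hy
      rw [klBas_repr_klBasis, Finsupp.single_eq_of_ne]
      rintro rfl
      exact hz hy
    by_cases h : cs.IsLeftDescent w i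
    · rw [cs.klSimple_mul_klBasis_of_isLeftDescent h, map_smul, Finsupp.smul_apply, hne w h,
        smul_zero]
    · rw [cs.klSimple_mul_klBasis_of_not_isLeftDescent h, map_add, Finsupp.add_apply, hne, zero_add,
        map_sum, Finsupp.coe_finsetSum, Finset.sum_apply]
      · refine Finset.sum_eq_zero fun y hy => ?_
        rw [map_smul, Finsupp.smul_apply, hne y (cs.isLeftDescent_of_mem_muSet hy), smul_zero]
      · rw [isLeftDescent_iff_not_isLeftDescent_mul, simple_mul_simple_cancel_left]
        exact h
  | zero => simp
  | add x y hx hy => rw [mul_add, map_add, Finsupp.add_apply, hx, hy, add_zero]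
  | smul a x hx => rw [mul_smul_comm, map_smul, Finsupp.smul_apply, hx, smul_zero]

/-- Up to the nonzero factor v + v⁻¹, the product b_x b_y lies in b_s H, which only involves b_z
with s z < z. -/
theorem isLeftDescent_of_klCoeff_ne_zero {x y z : W} {i : B} (hx : cs.IsLeftDescent x i)
    (h : cs.klCoeff x y z ≠ 0) : cs.IsLeftDescent z i := by
  by_contra hz
  have h1 := cs.klBas_repr_klSimple_mul_eq_zero hz (cs.klBasis x * cs.klBasis y)
  rw [← mul_assoc, cs.klSimple_mul_klBasis_of_isLeftDescent hx, smul_mul_assoc, map_smul,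
    Finsupp.smul_apply, ← klCoeff_eq, smul_eq_mul] at h1
  exact (mul_ne_zero T_one_add_T_neg_one_ne_zero h) h1

theorem isRightDescent_of_klCoeff_ne_zero {x y z : W} {i : B} (hy : cs.IsRightDescent y i)
    (h : cs.klCoeff x y z ≠ 0) : cs.IsRightDescent z i := by
  rw [klCoeff_inv] at h
  rw [← isLeftDescent_inv_iff] at hy ⊢
  exact cs.isLeftDescent_of_klCoeff_ne_zero hy h

/-! ### The ideal spanned by the elements with several reduced expressions -/

/-- The span of the `b_w` for which `w` has several reduced expressions. -/
noncomputable def nonRigid : Submodule ℤ[T;T⁻¹] cs.Hecke :=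
  Submodule.span _ (cs.klBasis '' {w | ¬ cs.IsRigid w})

theorem klBasis_mem_nonRigid {w : W} (h : ¬ cs.IsRigid w) : cs.klBasis w ∈ cs.nonRigid :=
  Submodule.subset_span ⟨w, h, rfl⟩

theorem mem_nonRigid_iff {x : cs.Hecke} :
    x ∈ cs.nonRigid ↔ ∀ z, cs.IsRigid z → cs.klBas.repr x z = 0 := by
  have h := cs.klBas.mem_span_image (m := x) (s := {w | ¬ cs.IsRigid w})
  have he : (cs.klBas : W → cs.Hecke) = cs.klBasis := funext cs.klBas_apply
  rw [he] at h
  rw [nonRigid, h]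
  constructor
  · intro h z hz
    by_contra h0
    exact h (Finsupp.mem_support_iff.mpr h0) hz
  · intro h z hz hr
    exact Finsupp.mem_support_iff.mp hz (h z hr)

theorem simple_injective : Function.Injective cs.simple := by
  intro i j h
  by_contra hij
  have := cs.dvd_of_simple_mul_simple_pow_eq_one hij (n := 1)
    (by rw [pow_one, h, simple_mul_simple_self])
  exact M.off_diagonal i j hij (Nat.dvd_one.mp this)

/-- Let w be non-rigid with s w > w, and suppose a rigid y with s y < y has μ(y, w) ≠ 0. The only
left descent of y is s, so no left descent t of w is one of y, and `mu_eq_zero` gives y = t w for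
every such t. Hence t is unique and t w is rigid, which makes w rigid, a contradiction. -/
theorem klSimple_mul_mem_nonRigid (i : B) {x : cs.Hecke} (hx : x ∈ cs.nonRigid) :
    cs.klSimple i * x ∈ cs.nonRigid := by
  induction hx using Submodule.span_induction with
  | mem x hx =>
    obtain ⟨w, hw, rfl⟩ := hx
    rw [Set.mem_ofPred_eq] at hw
    by_cases h : cs.IsLeftDescent w i
    · rw [cs.klSimple_mul_klBasis_of_isLeftDescent h]
      exact Submodule.smul_mem _ _ (cs.klBasis_mem_nonRigid hw)
    · rw [cs.klSimple_mul_klBasis_of_not_isLeftDescent h]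
      have hs : cs.IsLeftDescent (cs.simple i * w) i := by
        rw [isLeftDescent_iff_not_isLeftDescent_mul, simple_mul_simple_cancel_left]
        exact h
      refine Submodule.add_mem _ (cs.klBasis_mem_nonRigid fun hr => hw ?_)
        (Submodule.sum_mem _ fun y hy => ?_)
      · have := hr.simple_mul hs
        rwa [simple_mul_simple_cancel_left] at this
      · by_cases hry : cs.IsRigid y
        · suffices hmu : cs.mu y w = 0 by
            rw [hmu, map_zero, zero_smul]
            exact Submodule.zero_mem _
          by_contra hmu
          have hyi := cs.isLeftDescent_of_mem_muSet hy
          have key : ∀ t, cs.IsLeftDescent w t → y = cs.simple t * w := by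
            intro t ht
            by_contra hne
            refine hmu (cs.mu_eq_zero ht (fun hyt => h ?_) hne)
            rwa [hry.eq_of_isLeftDescent hyi hyt]
          obtain ⟨t, ht⟩ := cs.exists_leftDescent_of_ne_one
            (fun h1 : w = 1 => hw (h1 ▸ cs.isRigid_one))
          refine hw (cs.isRigid_of_unique_isLeftDescent (i := t) (fun t' ht' => ?_)
            (key t ht ▸ hry))
          have := (key t' ht').symm.trans (key t ht)
          exact cs.simple_injective (mul_right_cancel this)
        · exact Submodule.smul_mem _ _ (cs.klBasis_mem_nonRigid hry)
  | zero => rw [mul_zero]; exact Submodule.zero_mem _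
  | add x y _ _ hx hy => rw [mul_add]; exact Submodule.add_mem _ hx hy
  | smul a x _ hx => rw [mul_smul_comm]; exact Submodule.smul_mem _ _ hx

theorem mul_mem_nonRigid (x : cs.Hecke) {y : cs.Hecke} (hy : y ∈ cs.nonRigid) :
    x * y ∈ cs.nonRigid := by
  induction x using cs.delta_induction with
  | delta w =>
    induction hn : cs.length w generalizing w with
    | zero =>
      rw [length_eq_zero_iff] at hn
      rwa [hn, delta_one, one_mul]
    | succ n ih =>
      have hw : w ≠ 1 := fun h1 => by rw [h1, length_one] at hn; omega
      obtain ⟨i, hi⟩ := cs.exists_leftDescent_of_ne_one hw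
      have hl := cs.isLeftDescent_iff.mp hi
      have h1 := cs.delta_simple_mul_of_not_isLeftDescent
        (cs.isLeftDescent_iff_not_isLeftDescent_mul.mp hi)
      rw [simple_mul_simple_cancel_left] at h1
      have h2 := ih (cs.simple i * w) (by omega)
      have h3 : cs.delta (cs.simple i) = cs.klSimple i - (T 1 : ℤ[T;T⁻¹]) • 1 := by
        rw [klSimple, add_sub_cancel_right]
      rw [← h1, mul_assoc, h3, sub_mul, smul_mul_assoc, one_mul]
      exact Submodule.sub_mem _ (cs.klSimple_mul_mem_nonRigid i h2) (Submodule.smul_mem _ _ h2)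
  | zero => rw [zero_mul]; exact Submodule.zero_mem _
  | add a b ha hb => rw [add_mul]; exact Submodule.add_mem _ ha hb
  | smul a x hx => rw [smul_mul_assoc]; exact Submodule.smul_mem _ _ hx

theorem anti_mem_nonRigid {x : cs.Hecke} (hx : x ∈ cs.nonRigid) : cs.anti x ∈ cs.nonRigid := by
  rw [mem_nonRigid_iff] at hx ⊢
  intro z hz
  rw [klBas_repr_anti]
  exact hx _ hz.inv

theorem mem_nonRigid_mul {x : cs.Hecke} (hx : x ∈ cs.nonRigid) (y : cs.Hecke) :
    x * y ∈ cs.nonRigid := by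
  rw [← cs.anti_anti (x * y), anti_mul]
  exact cs.anti_mem_nonRigid (cs.mul_mem_nonRigid _ (cs.anti_mem_nonRigid hx))

theorem isRigid_of_klCoeff_ne_zero {x y z : W} (hz : cs.IsRigid z) (h : cs.klCoeff x y z ≠ 0) :
    cs.IsRigid x ∧ cs.IsRigid y := by
  rw [klCoeff_eq] at h
  constructor
  · by_contra hx
    exact h (cs.mem_nonRigid_iff.mp (cs.mem_nonRigid_mul (cs.klBasis_mem_nonRigid hx) _) z hz)
  · by_contra hy
    exact h (cs.mem_nonRigid_iff.mp (cs.mul_mem_nonRigid _ (cs.klBasis_mem_nonRigid hy)) z hz)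

open Classical in
-- A rigid y in the sum has s as its only left descent, so t is not one, and `mu_eq_zero` leaves
-- only y = t z, with μ = 1. The element s z need not be rigid; its term may itself lie in the
-- ideal.
theorem klSimple_mul_klBasis_of_isRigid {i t : B} {z : W} (hz : cs.IsRigid z)
    (ht : cs.IsLeftDescent z t) (hit : i ≠ t) :
    cs.klSimple i * cs.klBasis z - (cs.klBasis (cs.simple i * z) +
      if cs.IsLeftDescent (cs.simple t * z) i then cs.klBasis (cs.simple t * z) else 0)
      ∈ cs.nonRigid := by
  have hi : ¬ cs.IsLeftDescent z i := fun h => hit (hz.eq_of_isLeftDescent h ht)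
  rw [cs.klSimple_mul_klBasis_of_not_isLeftDescent hi, add_sub_add_left_eq_sub]
  have key : ∀ y ∈ cs.muSet i z, y ≠ cs.simple t * z →
      (C (cs.mu y z) : ℤ[T;T⁻¹]) • cs.klBasis y ∈ cs.nonRigid := by
    intro y hy hne
    by_cases hr : cs.IsRigid y
    · rw [cs.mu_eq_zero ht (fun h => hit
        (hr.eq_of_isLeftDescent (cs.isLeftDescent_of_mem_muSet hy) h)) hne, map_zero, zero_smul]
      exact Submodule.zero_mem _
    · exact Submodule.smul_mem _ _ (cs.klBasis_mem_nonRigid hr)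
  have hmu := cs.mu_simple_mul ht
  split_ifs with h
  · have hm : cs.simple t * z ∈ cs.muSet i z := by
      refine Finset.mem_filter.mpr ⟨Finsupp.mem_support_iff.mpr fun h0 => ?_, h⟩
      rw [mu, h0] at hmu
      simp at hmu
    rw [← Finset.add_sum_erase _ _ hm, hmu, map_one, one_smul, add_sub_cancel_left]
    exact Submodule.sum_mem _ fun y hy => key y (Finset.mem_of_mem_erase hy)
      (Finset.ne_of_mem_erase hy)
  · rw [sub_zero]
    refine Submodule.sum_mem _ fun y hy => key y hy ?_
    rintro rfl
    exact h (cs.isLeftDescent_of_mem_muSet hy)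

/-! ### Integrality of the products of the rigid elements -/

/-- The integral combinations of the `b_z` with `z` rigid and with left descent `s`, modulo the
ideal of the non-rigid elements. -/
noncomputable def rigidLattice (i : B) : AddSubgroup cs.Hecke :=
  AddSubgroup.closure (cs.klBasis '' {z | cs.IsRigid z ∧ cs.IsLeftDescent z i}) ⊔
    cs.nonRigid.toAddSubgroup

theorem mem_rigidLattice_of_mem_nonRigid {i : B} {x : cs.Hecke} (hx : x ∈ cs.nonRigid) :
    x ∈ cs.rigidLattice i :=
  (le_sup_right : cs.nonRigid.toAddSubgroup ≤ _) hx

theorem klBasis_mem_rigidLattice {i : B} {z : W} (hz : cs.IsLeftDescent z i) :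
    cs.klBasis z ∈ cs.rigidLattice i := by
  by_cases hr : cs.IsRigid z
  · exact (le_sup_left : _ ≤ cs.rigidLattice i) (AddSubgroup.subset_closure ⟨z, ⟨hr, hz⟩, rfl⟩)
  · exact cs.mem_rigidLattice_of_mem_nonRigid (cs.klBasis_mem_nonRigid hr)

theorem klSimple_mul_mem_rigidLattice {i t : B} (hit : i ≠ t) {x : cs.Hecke}
    (hx : x ∈ cs.rigidLattice t) : cs.klSimple i * x ∈ cs.rigidLattice i := by
  classical
  obtain ⟨a, ha, n, hn, rfl⟩ := AddSubgroup.mem_sup.mp hx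
  rw [mul_add]
  refine add_mem ?_ (cs.mem_rigidLattice_of_mem_nonRigid (cs.klSimple_mul_mem_nonRigid i hn))
  clear hx
  induction ha using AddSubgroup.closure_induction with
  | mem x hx =>
    obtain ⟨z, ⟨hz, ht⟩, rfl⟩ := hx
    have h := cs.mem_rigidLattice_of_mem_nonRigid (i := i)
      (cs.klSimple_mul_klBasis_of_isRigid hz ht hit)
    have hi : ¬ cs.IsLeftDescent z i := fun h => hit (hz.eq_of_isLeftDescent h ht)
    rw [← sub_add_cancel (cs.klSimple i * cs.klBasis z) (cs.klBasis (cs.simple i * z) +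
      if cs.IsLeftDescent (cs.simple t * z) i then cs.klBasis (cs.simple t * z) else 0)]
    refine add_mem h (add_mem (cs.klBasis_mem_rigidLattice ?_) ?_)
    · rw [isLeftDescent_iff_not_isLeftDescent_mul, simple_mul_simple_cancel_left]
      exact hi
    · split_ifs with h'
      · exact cs.klBasis_mem_rigidLattice h'
      · exact zero_mem _
  | zero => rw [mul_zero]; exact zero_mem _
  | add x y _ _ hx hy => rw [mul_add]; exact add_mem hx hy
  | neg x _ hx => rw [mul_neg]; exact neg_mem hx

theorem exists_eq_C_of_mem_rigidLattice {i : B} {x : cs.Hecke} (hx : x ∈ cs.rigidLattice i)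
    {z : W} (hz : cs.IsRigid z) : ∃ n : ℤ, cs.klBas.repr x z = C n := by
  classical
  obtain ⟨a, ha, n, hn, rfl⟩ := AddSubgroup.mem_sup.mp hx
  rw [map_add, Finsupp.add_apply, cs.mem_nonRigid_iff.mp hn z hz, add_zero]
  clear hx
  induction ha using AddSubgroup.closure_induction with
  | mem x hx =>
    obtain ⟨w, -, rfl⟩ := hx
    rw [klBas_repr_klBasis, Finsupp.single_apply]
    split_ifs
    · exact ⟨1, (map_one C).symm⟩
    · exact ⟨0, (map_zero C).symm⟩
  | zero => exact ⟨0, by simp⟩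
  | add x y _ _ hx hy =>
    obtain ⟨m, hm⟩ := hx
    obtain ⟨n, hn⟩ := hy
    exact ⟨m + n, by rw [map_add, Finsupp.add_apply, hm, hn, map_add]⟩
  | neg x _ hx =>
    obtain ⟨m, hm⟩ := hx
    exact ⟨-m, by rw [map_neg, Finsupp.neg_apply, hm, map_neg]⟩

theorem isRightDescent_of_simple_mul {x : W} {i j : B} (hi : cs.IsLeftDescent x i)
    (hj : cs.IsRightDescent (cs.simple i * x) j) : cs.IsRightDescent x j := by
  rw [isLeftDescent_iff] at hi
  rw [isRightDescent_iff] at hj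
  have h1 := cs.length_mul_le (cs.simple i) (cs.simple i * x * cs.simple j)
  rw [mul_assoc, simple_mul_simple_cancel_left, length_simple, ← mul_assoc] at h1
  rw [IsRightDescent]
  omega

theorem IsRigid.eq_of_isRightDescent {cs : CoxeterSystem M W} {w : W} (h : cs.IsRigid w) {i j : B}
    (hi : cs.IsRightDescent w i) (hj : cs.IsRightDescent w j) : i = j := by
  rw [← isLeftDescent_inv_iff] at hi hj
  exact h.inv.eq_of_isLeftDescent hi hj

theorem IsRigid.isRightDescent_simple_mul {cs : CoxeterSystem M W} {x : W} (h : cs.IsRigid x)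
    {i j : B} (hi : cs.IsLeftDescent x i) (hj : cs.IsRightDescent x j)
    (h1 : cs.simple i * x ≠ 1) : cs.IsRightDescent (cs.simple i * x) j := by
  obtain ⟨k, hk⟩ := cs.exists_rightDescent_of_ne_one h1
  rwa [h.eq_of_isRightDescent hj (cs.isRightDescent_of_simple_mul hi hk)]

theorem isRightDescent_simple (i : B) : cs.IsRightDescent (cs.simple i) i := by
  simp [IsRightDescent]

theorem ne_one_of_isLeftDescent {w : W} {i : B} (h : cs.IsLeftDescent w i) : w ≠ 1 := by
  rintro rfl
  exact cs.not_isLeftDescent_one i h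

theorem ne_one_of_isRightDescent {w : W} {i : B} (h : cs.IsRightDescent w i) : w ≠ 1 := by
  rintro rfl
  exact cs.not_isRightDescent_one i h

theorem eq_simple_of_simple_mul_eq_one {w : W} {i : B} (h : cs.simple i * w = 1) :
    w = cs.simple i := by
  rw [← mul_one (cs.simple i), ← h, simple_mul_simple_cancel_left]

/-- If the product of `b_s` with `y` is integral up to a factor `c`, then so is the product of `b_x`
with `y`, for all rigid `x` ending in `s`. -/
theorem exists_klBasis_mul_sub_mem_nonRigid {j : B} {y : cs.Hecke} {c : ℤ[T;T⁻¹]}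
    (hbase : ∃ P ∈ cs.rigidLattice j, cs.klSimple j * y - c • P ∈ cs.nonRigid)
    {x : W} (hx : cs.IsRigid x) {i : B} (hi : cs.IsLeftDescent x i)
    (hj : cs.IsRightDescent x j) :
    ∃ P ∈ cs.rigidLattice i, cs.klBasis x * y - c • P ∈ cs.nonRigid := by
  classical
  induction hn : cs.length x using Nat.strong_induction_on generalizing x i with
  | _ n ih =>
  by_cases h1 : cs.simple i * x = 1
  · obtain rfl := cs.eq_simple_of_simple_mul_eq_one h1
    obtain rfl := hx.eq_of_isRightDescent hj (cs.isRightDescent_simple i)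
    rwa [klBasis_simple]
  have hx1 := hx.simple_mul hi
  have hl1 := cs.isLeftDescent_iff.mp hi
  have hi1 := cs.isLeftDescent_iff_not_isLeftDescent_mul.mp hi
  have hj1 := hx.isRightDescent_simple_mul hi hj h1
  obtain ⟨t, ht⟩ := cs.exists_leftDescent_of_ne_one h1
  have hit : i ≠ t := by rintro rfl; exact hi1 ht
  obtain ⟨P₁, hP₁, h₁⟩ := ih _ (by omega) hx1 ht hj1 rfl
  -- With x = s x₁ and x₁ starting in t, this expresses b_x modulo the ideal as b_s b_{x₁}, minus
  -- b_{t x₁} if t x₁ starts in s; both are shorter.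
  have hf := cs.klSimple_mul_klBasis_of_isRigid hx1 ht hit
  rw [simple_mul_simple_cancel_left] at hf
  set x₁ := cs.simple i * x with hx₁
  have hf' := cs.mem_nonRigid_mul hf y
  have hg := cs.mul_mem_nonRigid (cs.klSimple i) h₁
  split_ifs at hf' with h2
  · have hl2 := cs.isLeftDescent_iff.mp ht
    obtain ⟨P₂, hP₂, h₂⟩ := ih _ (by omega) (hx1.simple_mul ht) h2
      (hx1.isRightDescent_simple_mul ht hj1 (cs.ne_one_of_isLeftDescent h2)) rfl
    refine ⟨cs.klSimple i * P₁ - P₂, sub_mem (cs.klSimple_mul_mem_rigidLattice hit hP₁) hP₂, ?_⟩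
    have e : cs.klBasis x * y - c • (cs.klSimple i * P₁ - P₂) =
        cs.klSimple i * (cs.klBasis x₁ * y - c • P₁) -
        (cs.klSimple i * cs.klBasis x₁ - (cs.klBasis x + cs.klBasis (cs.simple t * x₁))) * y -
        (cs.klBasis (cs.simple t * x₁) * y - c • P₂) := by
      rw [mul_sub, sub_mul, add_mul, mul_assoc, mul_smul_comm, smul_sub]
      abel
    rw [e]
    exact Submodule.sub_mem _ (Submodule.sub_mem _ hg hf') h₂
  · refine ⟨cs.klSimple i * P₁, cs.klSimple_mul_mem_rigidLattice hit hP₁, ?_⟩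
    have e : cs.klBasis x * y - c • (cs.klSimple i * P₁) =
        cs.klSimple i * (cs.klBasis x₁ * y - c • P₁) -
        (cs.klSimple i * cs.klBasis x₁ - (cs.klBasis x + 0)) * y := by
      rw [mul_sub, sub_mul, add_zero, mul_assoc, mul_smul_comm]
      abel
    rw [e]
    exact Submodule.sub_mem _ hg hf'

/-! ### The `a`-function -/

/-- For x, y ≠ 1 rigid, only the meeting of the last letter of x with the first letter of y can
contribute v + v⁻¹, namely when they are equal. All further multiplications are integral modulo the
ideal. -/
theorem exists_T_one_mul_klCoeff_eq {z : W} (hz : cs.IsRigid z) (x y : W) :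
    ∃ q : Polynomial ℤ, T 1 * cs.klCoeff x y z = Polynomial.toLaurent q := by
  classical
  by_cases h0 : cs.klCoeff x y z = 0
  · exact ⟨0, by rw [h0]; simp⟩
  obtain ⟨hx, hy⟩ := cs.isRigid_of_klCoeff_ne_zero hz h0
  have hsingle : ∀ w : W, ∃ q : Polynomial ℤ,
      T 1 * Finsupp.single w (1 : ℤ[T;T⁻¹]) z = Polynomial.toLaurent q := by
    intro w
    rw [Finsupp.single_apply]
    split_ifs
    · exact ⟨Polynomial.X, by simp⟩
    · exact ⟨0, by simp⟩
  by_cases hx1 : x = 1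
  · rw [klCoeff_eq, hx1, klBasis_one, one_mul, klBas_repr_klBasis]
    exact hsingle y
  by_cases hy1 : y = 1
  · rw [klCoeff_eq, hy1, klBasis_one, mul_one, klBas_repr_klBasis]
    exact hsingle x
  obtain ⟨i, hi⟩ := cs.exists_leftDescent_of_ne_one hx1
  obtain ⟨j, hj⟩ := cs.exists_rightDescent_of_ne_one hx1
  obtain ⟨k, hk⟩ := cs.exists_leftDescent_of_ne_one hy1
  by_cases hjk : j = k
  · subst hjk
    obtain ⟨P, hP, h⟩ := cs.exists_klBasis_mul_sub_mem_nonRigid (y := cs.klBasis y)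
      (c := T 1 + T (-1)) ⟨_, cs.klBasis_mem_rigidLattice hk, by
        rw [cs.klSimple_mul_klBasis_of_isLeftDescent hk, sub_self]
        exact Submodule.zero_mem _⟩ hx hi hj
    have h1 := cs.mem_nonRigid_iff.mp h z hz
    obtain ⟨n, hn⟩ := cs.exists_eq_C_of_mem_rigidLattice hP hz
    rw [map_sub, Finsupp.sub_apply, sub_eq_zero, map_smul, Finsupp.smul_apply, ← klCoeff_eq, hn,
      smul_eq_mul] at h1
    refine ⟨(Polynomial.X ^ 2 + 1) * Polynomial.C n, ?_⟩
    rw [h1, ← mul_assoc, mul_add, ← T_add, ← T_add]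
    simp
  · obtain ⟨P, hP, h⟩ := cs.exists_klBasis_mul_sub_mem_nonRigid (y := cs.klBasis y)
      (c := 1) ⟨_, cs.klSimple_mul_mem_rigidLattice hjk (cs.klBasis_mem_rigidLattice hk), by
        rw [one_smul, sub_self]
        exact Submodule.zero_mem _⟩ hx hi hj
    have h1 := cs.mem_nonRigid_iff.mp h z hz
    obtain ⟨n, hn⟩ := cs.exists_eq_C_of_mem_rigidLattice hP hz
    rw [map_sub, Finsupp.sub_apply, sub_eq_zero, map_smul, Finsupp.smul_apply, ← klCoeff_eq, hn,
      one_smul] at h1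
    refine ⟨Polynomial.X * Polynomial.C n, ?_⟩
    rw [h1]
    simp

theorem aFunction_eq_one {z : W} (hz : cs.IsRigid z) (h1 : z ≠ 1) : cs.aFunction z = 1 := by
  refine le_antisymm (sInf_le ⟨1, rfl, fun x y => ?_⟩) (le_sInf ?_)
  · exact_mod_cast cs.exists_T_one_mul_klCoeff_eq hz x y
  · rintro _ ⟨n, rfl, hn⟩
    have hn0 : n ≠ 0 := by
      rintro rfl
      obtain ⟨i, hi⟩ := cs.exists_leftDescent_of_ne_one h1
      have := exists_eq_toLaurent_iff.mp (hn (cs.simple i) z) (-1) (by norm_num)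
      rw [klCoeff_eq, klBasis_simple, cs.klSimple_mul_klBasis_of_isLeftDescent hi, map_smul,
        klBas_repr_klBasis, Finsupp.smul_apply, Finsupp.single_eq_same] at this
      simp at this
    exact_mod_cast Nat.one_le_iff_ne_zero.mpr hn0

/-- A product b_x b_y with x ≠ 1 only involves elements having a descent, so b_1 does not occur in
it. -/
theorem aFunction_one : cs.aFunction 1 = 0 := by
  classical
  refine le_antisymm (sInf_le ⟨0, rfl, fun x y => ?_⟩) zero_le
  have h : cs.klCoeff x y 1 = 0 ∨ cs.klCoeff x y 1 = 1 := by
    by_cases hx1 : x = 1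
    · rw [klCoeff_eq, hx1, klBasis_one, one_mul, klBas_repr_klBasis, Finsupp.single_apply]
      split_ifs <;> simp
    · obtain ⟨i, hi⟩ := cs.exists_leftDescent_of_ne_one hx1
      refine Or.inl ?_
      by_contra h
      exact cs.not_isLeftDescent_one i (cs.isLeftDescent_of_klCoeff_ne_zero hi h)
  rcases h with h | h
  · exact ⟨0, by rw [h]; simp⟩
  · exact ⟨1, by rw [h]; simp⟩

theorem delta_mul_mem_lower (w : W) {n : ℕ} {x : cs.Hecke} (hx : x ∈ cs.lower n) :
    cs.delta w * x ∈ cs.lower (cs.length w + n) := by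
  induction hn : cs.length w generalizing w with
  | zero =>
    rw [length_eq_zero_iff] at hn
    rwa [hn, delta_one, one_mul, zero_add]
  | succ k ih =>
    have hw : w ≠ 1 := fun h1 => by rw [h1, length_one] at hn; omega
    obtain ⟨i, hi⟩ := cs.exists_leftDescent_of_ne_one hw
    have hl := cs.isLeftDescent_iff.mp hi
    have h1 := cs.delta_simple_mul_of_not_isLeftDescent
      (cs.isLeftDescent_iff_not_isLeftDescent_mul.mp hi)
    rw [simple_mul_simple_cancel_left] at h1
    rw [← h1, mul_assoc, add_right_comm]
    exact cs.delta_simple_mul_mem_lower i (ih _ (by omega))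

theorem klBas_repr_of_mem_lower {n : ℕ} {x : cs.Hecke} (hx : x ∈ cs.lower n) {z : W}
    (hz : n ≤ cs.length z) : cs.klBas.repr x z = 0 := by
  have h := cs.klBas.mem_span_image (m := x) (s := {w | cs.length w < n})
  have he : (cs.klBas : W → cs.Hecke) = cs.klBasis := funext cs.klBas_apply
  rw [he] at h
  by_contra h0
  exact absurd (h.mp (cs.lower_le_span_klBasis n hx) (Finsupp.mem_support_iff.mpr h0))
    (by simpa using hz)

theorem klBas_repr_delta_self (w : W) : cs.klBas.repr (cs.delta w) w = 1 := by
  have h := cs.klBas_repr_of_mem_lower (cs.klBasis_sub_delta_mem_lower w) le_rfl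
  rw [map_sub, Finsupp.sub_apply, klBas_repr_klBasis, Finsupp.single_eq_same, sub_eq_zero] at h
  exact h.symm

/-- The coordinates of `δ_w` in the Kazhdan-Lusztig basis lie in `ℤ[v]`. -/
theorem klBas_repr_delta_mem_range (w z : W) :
    cs.klBas.repr (cs.delta w) z ∈ (Polynomial.toLaurent (R := ℤ)).range := by
  classical
  induction hn : cs.length w using Nat.strong_induction_on generalizing w with
  | _ n ih =>
  have e : cs.delta w = cs.klBasis w - ∑ y ∈ (cs.deltaBasis.repr (cs.klBasis w)).support.erase w,
      cs.deltaBasis.repr (cs.klBasis w) y • cs.delta y := by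
    have h1 := cs.deltaBasis.linearCombination_repr (cs.klBasis w)
    rw [Finsupp.linearCombination_apply, Finsupp.sum, ← Finset.add_sum_erase _ _
      (Finsupp.mem_support_iff.mpr (by rw [repr_klBasis_self]; exact one_ne_zero) :
        w ∈ (cs.deltaBasis.repr (cs.klBasis w)).support), repr_klBasis_self, one_smul] at h1
    simp only [deltaBasis_apply] at h1
    exact eq_sub_of_add_eq h1
  rw [e, map_sub, Finsupp.sub_apply, map_sum, Finsupp.coe_finsetSum, Finset.sum_apply,
    klBas_repr_klBasis]
  refine sub_mem ?_ (sum_mem fun y hy => ?_)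
  · rw [Finsupp.single_apply]
    split_ifs
    · exact one_mem _
    · exact zero_mem _
  · rw [map_smul, Finsupp.smul_apply, smul_eq_mul]
    rw [Finset.mem_erase] at hy
    refine mul_mem ?_ (ih (cs.length y) ?_ y rfl)
    · obtain ⟨q, hq⟩ := exists_eq_toLaurent_iff.mpr fun n hn =>
        cs.repr_klBasis_mem_positivePart hy.1 n hn.le
      exact ⟨q, hq.symm⟩
    · by_contra hl
      exact Finsupp.mem_support_iff.mp hy.2 (cs.repr_klBasis_eq_zero hy.1 (by omega))

/-- Write z = x u with two left descents s, t of u. The element h = δ_x b_s b_t has coordinates in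
ℤ[v], so a(z) = 1 would put v times the coefficient of b_z in h b_u into ℤ[v]. But that coefficient
is (v + v⁻¹)². -/
theorem aFunction_ne_one {z : W} (hz : ¬ cs.IsRigid z) : cs.aFunction z ≠ 1 := by
  classical
  intro ha
  obtain ⟨x, u, i, j, hij, hxu, hl, hi, hj, hl2⟩ := cs.exists_eq_mul_of_not_isRigid hz
  set S := {k : ℕ∞ | ∃ n : ℕ, k = n ∧ ∀ x y, ∃ q : Polynomial ℤ,
    T (n : ℤ) * cs.klCoeff x y z = Polynomial.toLaurent q} with hS
  have hSa : sInf S = 1 := ha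
  -- The infimum of the empty set is ∞, so the value 1 is attained by an actual exponent.
  have hne : S.Nonempty := by
    rw [Set.nonempty_iff_ne_empty]
    intro h
    rw [h, sInf_empty] at hSa
    simp at hSa
  obtain ⟨n, hn, hcoeff⟩ := csInf_mem hne
  rw [hSa] at hn
  obtain rfl : n = 1 := by exact_mod_cast hn.symm
  set R := (Polynomial.toLaurent (R := ℤ)).range with hR
  have hTR : (T 1 : ℤ[T;T⁻¹]) ∈ R := ⟨Polynomial.X, by simp⟩
  set h := cs.delta x * (cs.klSimple i * cs.klSimple j) with hh
  have hhR : ∀ w, cs.klBas.repr h w ∈ R := by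
    intro w
    have hui := cs.isLeftDescent_iff.mp hi
    have huj := cs.isLeftDescent_iff.mp hj
    have aux : ∀ k, cs.length (cs.simple k * u) + 1 = cs.length u →
        cs.length (x * cs.simple k) = cs.length x + cs.length (cs.simple k) := by
      intro k hk
      have h1 := cs.length_mul_le (x * cs.simple k) (cs.simple k * u)
      have h2 := cs.length_mul_le x (cs.simple k)
      rw [mul_assoc, simple_mul_simple_cancel_left, ← hxu] at h1
      rw [length_simple] at h2 ⊢
      omega
    -- All products met in the expansion are reduced, so only δ's with coefficients 1, v and v²
    -- appear and no v⁻¹.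
    have e : h = cs.delta (x * cs.simple i * cs.simple j) +
        (T 1 : ℤ[T;T⁻¹]) • cs.delta (x * cs.simple i) +
        (T 1 : ℤ[T;T⁻¹]) • cs.delta (x * cs.simple j) +
        (T 1 * T 1 : ℤ[T;T⁻¹]) • cs.delta x := by
      rw [hh, ← cs.delta_mul (x := x * cs.simple i) (y := cs.simple j)
        (by rw [hl2, aux i hui, length_simple, length_simple]),
        ← cs.delta_mul (aux i hui), ← cs.delta_mul (aux j huj), klSimple, klSimple, mul_smul]
      simp only [mul_add, add_mul, smul_mul_assoc, mul_smul_comm, one_mul, mul_one, mul_assoc,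
        smul_add]
      abel
    rw [e]
    simp only [map_add, map_smul, Finsupp.add_apply, Finsupp.smul_apply, smul_eq_mul]
    have hd := fun y => cs.klBas_repr_delta_mem_range y w
    exact add_mem (add_mem (add_mem (hd _) (mul_mem hTR (hd _))) (mul_mem hTR (hd _)))
      (mul_mem (mul_mem hTR hTR) (hd _))
  have h1 : cs.klBas.repr (h * cs.klBasis u) z =
      (T 1 + T (-1)) * (T 1 + T (-1)) := by
    rw [hh, mul_assoc, mul_assoc, cs.klSimple_mul_klBasis_of_isLeftDescent hj, mul_smul_comm,
      cs.klSimple_mul_klBasis_of_isLeftDescent hi, mul_smul_comm, mul_smul_comm, map_smul,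
      map_smul, Finsupp.smul_apply, Finsupp.smul_apply, smul_eq_mul, smul_eq_mul]
    have h2 := cs.klBas_repr_of_mem_lower (z := z)
      (cs.delta_mul_mem_lower x (cs.klBasis_sub_delta_mem_lower u)) hl.ge
    rw [mul_sub, cs.delta_mul (by rw [← hxu, hl]), ← hxu, map_sub, Finsupp.sub_apply,
      klBas_repr_delta_self, sub_eq_zero] at h2
    rw [h2, mul_one]
  have h2 : T 1 * cs.klBas.repr (h * cs.klBasis u) z ∈ R := by
    have e : h * cs.klBasis u = ∑ w ∈ (cs.klBas.repr h).support,
        cs.klBas.repr h w • (cs.klBasis w * cs.klBasis u) := by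
      conv_lhs => rw [← cs.klBas.linearCombination_repr h, Finsupp.linearCombination_apply,
        Finsupp.sum, Finset.sum_mul]
      simp only [smul_mul_assoc, klBas_apply]
    rw [e, map_sum, Finsupp.coe_finsetSum, Finset.sum_apply, Finset.mul_sum]
    refine sum_mem fun w _ => ?_
    rw [map_smul, Finsupp.smul_apply, smul_eq_mul, ← klCoeff_eq, mul_left_comm]
    refine mul_mem (hhR w) ?_
    obtain ⟨q, hq⟩ := hcoeff w u
    exact ⟨q, by rw [← hq]; norm_cast⟩
  obtain ⟨q, hq⟩ := h2
  have h3 := coeff_toLaurent_of_neg q (n := -1) (by norm_num)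
  rw [hq, h1, coeff_T_mul, add_mul, mul_add, mul_add, ← T_add, ← T_add, ← T_add, ← T_add] at h3
  simp only [AddMonoidAlgebra.coeff_add, Finsupp.add_apply, T_apply] at h3
  norm_num at h3

theorem mem_aLevel_one_iff {w : W} : w ∈ cs.aLevel 1 ↔ cs.IsRigid w ∧ w ≠ 1 := by
  change cs.aFunction w = (1 : ℕ) ↔ _
  rw [Nat.cast_one]
  constructor
  · intro h
    refine ⟨?_, ?_⟩
    · by_contra hr
      exact cs.aFunction_ne_one hr h
    · rintro rfl
      rw [aFunction_one] at h
      exact zero_ne_one h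
  · exact fun h => cs.aFunction_eq_one h.1 h.2

end CoxeterSystem

namespace CoxeterSystem

variable {B W : Type*} [Group W] {M : CoxeterMatrix B} (cs : CoxeterSystem M W)

/-! ### The cells in `W_1` -/

theorem leL_inv {x y : W} (h : cs.leL x y) : cs.leR x⁻¹ y⁻¹ :=
  Relation.ReflTransGen.lift (fun w : W => w⁻¹)
    (fun a b ⟨c, hc⟩ => ⟨c⁻¹, by rwa [← klCoeff_inv]⟩) _ _ h

theorem leR_inv {x y : W} (h : cs.leR x y) : cs.leL x⁻¹ y⁻¹ :=
  Relation.ReflTransGen.lift (fun w : W => w⁻¹)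
    (fun a b ⟨c, hc⟩ => ⟨c⁻¹, by rwa [← klCoeff_inv]⟩) _ _ h

theorem leR_iff_leL_inv {x y : W} : cs.leR x y ↔ cs.leL x⁻¹ y⁻¹ :=
  ⟨cs.leR_inv, fun h => by simpa using cs.leL_inv h⟩

theorem isRightDescent_of_leL {x y : W} (h : cs.leL x y) {i : B} (hy : cs.IsRightDescent y i) :
    cs.IsRightDescent x i := by
  induction h using Relation.ReflTransGen.head_induction_on with
  | refl => exact hy
  | head h _ ih =>
    obtain ⟨c, hc⟩ := h
    exact cs.isRightDescent_of_klCoeff_ne_zero ih hc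

theorem isRigid_of_leL {x y : W} (h : cs.leL x y) (hx : cs.IsRigid x) : cs.IsRigid y := by
  induction h with
  | refl => exact hx
  | tail _ h ih =>
    obtain ⟨c, hc⟩ := h
    exact (cs.isRigid_of_klCoeff_ne_zero ih hc).2

theorem leL_simple_mul {w : W} {i : B} (hi : cs.IsLeftDescent w i) :
    cs.leL w (cs.simple i * w) := by
  classical
  have hi' := cs.isLeftDescent_iff_not_isLeftDescent_mul.mp hi
  have hl := cs.isLeftDescent_iff.mp hi
  refine Relation.ReflTransGen.single ⟨cs.simple i, ?_⟩
  rw [klCoeff_eq, klBasis_simple, cs.klSimple_mul_klBasis_of_not_isLeftDescent hi',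
    simple_mul_simple_cancel_left, map_add, Finsupp.add_apply, klBas_repr_klBasis,
    Finsupp.single_eq_same, map_sum, Finsupp.coe_finsetSum, Finset.sum_apply,
    Finset.sum_eq_zero, add_zero]
  · exact one_ne_zero
  · intro y hy
    have := cs.length_lt_of_mem_muSet hy hi'
    rw [map_smul, Finsupp.smul_apply, klBas_repr_klBasis, Finsupp.single_eq_of_ne, smul_zero]
    rintro rfl
    omega

/-- Here b_{sw} occurs in b_t b_w with coefficient μ(sw, w) = 1. -/
theorem simple_mul_leL {w : W} {i t : B} (hi : cs.IsLeftDescent w i)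
    (ht : cs.IsLeftDescent (cs.simple i * w) t) (hwt : ¬ cs.IsLeftDescent w t) :
    cs.leL (cs.simple i * w) w := by
  classical
  have hl := cs.isLeftDescent_iff.mp hi
  have hlt := cs.not_isLeftDescent_iff.mp hwt
  refine Relation.ReflTransGen.single ⟨cs.simple t, ?_⟩
  have hmu := cs.mu_simple_mul hi
  have hm : cs.simple i * w ∈ cs.muSet t w := by
    refine Finset.mem_filter.mpr ⟨Finsupp.mem_support_iff.mpr fun h0 => ?_, ht⟩
    rw [mu, h0] at hmu
    simp at hmu
  rw [klCoeff_eq, klBasis_simple, cs.klSimple_mul_klBasis_of_not_isLeftDescent hwt,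
    ← Finset.add_sum_erase _ _ hm, hmu, map_one, one_smul, map_add, map_add, Finsupp.add_apply,
    Finsupp.add_apply, klBas_repr_klBasis, klBas_repr_klBasis, Finsupp.single_eq_same,
    Finsupp.single_eq_of_ne (fun e => by have := congrArg cs.length e; omega), zero_add, map_sum,
    Finsupp.coe_finsetSum, Finset.sum_apply, Finset.sum_eq_zero, add_zero]
  · exact one_ne_zero
  · intro y hy
    rw [map_smul, Finsupp.smul_apply, klBas_repr_klBasis,
      Finsupp.single_eq_of_ne (Finset.ne_of_mem_erase hy).symm, smul_zero]

/-- Letters are removed from the left one at a time. Each step stays in the left cell by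
`leL_simple_mul` and `simple_mul_leL`; the latter applies because the next letter differs from the
only left descent of w. -/
theorem IsRigid.leL_simple {cs : CoxeterSystem M W} {w : W} (hw : cs.IsRigid w) {j : B}
    (hj : cs.IsRightDescent w j) : cs.leL w (cs.simple j) ∧ cs.leL (cs.simple j) w := by
  induction hn : cs.length w generalizing w with
  | zero =>
    rw [length_eq_zero_iff] at hn
    exact absurd hn (cs.ne_one_of_isRightDescent hj)
  | succ n ih =>
    obtain ⟨i, hi⟩ := cs.exists_leftDescent_of_ne_one (cs.ne_one_of_isRightDescent hj)
    by_cases h1 : cs.simple i * w = 1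
    · obtain rfl := cs.eq_simple_of_simple_mul_eq_one h1
      obtain rfl := hw.eq_of_isRightDescent hj (cs.isRightDescent_simple i)
      exact ⟨Relation.ReflTransGen.refl, Relation.ReflTransGen.refl⟩
    have hl := cs.isLeftDescent_iff.mp hi
    have hi' := cs.isLeftDescent_iff_not_isLeftDescent_mul.mp hi
    obtain ⟨h2, h3⟩ := ih (hw.simple_mul hi) (hw.isRightDescent_simple_mul hi hj h1) (by omega)
    obtain ⟨t, ht⟩ := cs.exists_leftDescent_of_ne_one h1
    refine ⟨(cs.leL_simple_mul hi).trans h2, h3.trans (cs.simple_mul_leL hi ht fun hwt => hi' ?_)⟩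
    rwa [← hw.eq_of_isLeftDescent hi hwt] at ht

/-- Going down in ≤_L keeps right descents and going up keeps rigidity, so the cell is no larger; by
`IsRigid.leL_simple` all the listed elements are equivalent to s_j. -/
theorem IsRigid.leftCell_eq {cs : CoxeterSystem M W} {w : W} (hw : cs.IsRigid w) {j : B}
    (hj : cs.IsRightDescent w j) :
    {x | cs.leL x w ∧ cs.leL w x} = {x | cs.IsRigid x ∧ cs.IsRightDescent x j} := by
  ext x
  constructor
  · rintro ⟨h1, h2⟩
    exact ⟨cs.isRigid_of_leL h2 hw, cs.isRightDescent_of_leL h1 hj⟩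
  · rintro ⟨hx, hxj⟩
    exact ⟨(hx.leL_simple hxj).1.trans (hw.leL_simple hj).2,
      (hw.leL_simple hj).1.trans (hx.leL_simple hxj).2⟩

theorem IsRigid.rightCell_eq {cs : CoxeterSystem M W} {w : W} (hw : cs.IsRigid w) {i : B}
    (hi : cs.IsLeftDescent w i) :
    {x | cs.leR x w ∧ cs.leR w x} = {x | cs.IsRigid x ∧ cs.IsLeftDescent x i} := by
  have h := hw.inv.leftCell_eq (cs.isRightDescent_inv_iff.mpr hi)
  ext x
  have hx := Set.ext_iff.mp h x⁻¹
  change (_ ∧ _) ↔ (_ ∧ _) at hx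
  change (_ ∧ _) ↔ (_ ∧ _)
  rwa [leR_iff_leL_inv, leR_iff_leL_inv, ← isRigid_inv_iff, ← isRightDescent_inv_iff]

theorem isLeftDescent_of_head? {ω : List B} (hω : cs.IsReduced ω) {i : B} (h : ω.head? = some i) :
    cs.IsLeftDescent (cs.wordProd ω) i := by
  obtain ⟨τ, rfl⟩ := List.head?_eq_some_iff.mp h
  exact cs.isLeftDescent_of_isReduced_cons hω

theorem isRightDescent_of_getLast? {ω : List B} (hω : cs.IsReduced ω) {i : B}
    (h : ω.getLast? = some i) : cs.IsRightDescent (cs.wordProd ω) i := by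
  rw [← inv_inv (cs.wordProd ω), isRightDescent_inv_iff, ← wordProd_reverse]
  exact cs.isLeftDescent_of_head? hω.reverse (by rwa [List.head?_reverse])

theorem IsRigid.head?_eq {cs : CoxeterSystem M W} {ω : List B} (hω : cs.IsReduced ω)
    (hr : cs.IsRigid (cs.wordProd ω)) {i : B} (hi : cs.IsLeftDescent (cs.wordProd ω) i) :
    ω.head? = some i := by
  obtain ⟨τ, h1, h2⟩ := cs.exists_isReduced_head hi
  rw [hr _ _ hω h1 rfl h2]
  rfl

theorem IsRigid.getLast?_eq {cs : CoxeterSystem M W} {ω : List B} (hω : cs.IsReduced ω)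
    (hr : cs.IsRigid (cs.wordProd ω)) {i : B} (hi : cs.IsRightDescent (cs.wordProd ω) i) :
    ω.getLast? = some i := by
  rw [← List.head?_reverse]
  refine IsRigid.head?_eq hω.reverse ?_ ?_
  · rw [wordProd_reverse]; exact hr.inv
  · rwa [wordProd_reverse, isLeftDescent_inv_iff]

theorem IsRigid.startsEnds_iff {cs : CoxeterSystem M W} {w : W} (hw : cs.IsRigid w) {i j : B} :
    cs.StartsEnds i j w ↔ cs.IsLeftDescent w i ∧ cs.IsRightDescent w j := by
  constructor
  · rintro ⟨ω, hω, rfl, h1, h2⟩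
    exact ⟨cs.isLeftDescent_of_head? hω h1, cs.isRightDescent_of_getLast? hω h2⟩
  · rintro ⟨h1, h2⟩
    obtain ⟨ω, hω, rfl⟩ := cs.exists_isReduced w
    exact ⟨ω, hω, rfl, hw.head?_eq hω h1, hw.getLast?_eq hω h2⟩

theorem mem_hSet_iff {i j : B} {w : W} : w ∈ cs.hSet i j ↔
    cs.IsRigid w ∧ cs.IsLeftDescent w i ∧ cs.IsRightDescent w j := by
  rw [hSet, Set.mem_ofPred_eq, mem_aLevel_one_iff]
  constructor
  · rintro ⟨⟨h1, -⟩, h2⟩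
    exact ⟨h1, h1.startsEnds_iff.mp h2⟩
  · rintro ⟨h1, h2⟩
    exact ⟨⟨h1, cs.ne_one_of_isLeftDescent h2.1⟩, h1.startsEnds_iff.mpr h2⟩

theorem inter_cells_eq_hSet {w w' : W} {i j : B} (hw : cs.IsRigid w) (hj : cs.IsRightDescent w j)
    (hw' : cs.IsRigid w') (hi : cs.IsLeftDescent w' i) :
    {x | cs.leL x w ∧ cs.leL w x} ∩ {x | cs.leR x w' ∧ cs.leR w' x} = cs.hSet i j := by
  rw [hw.leftCell_eq hj, hw'.rightCell_eq hi]
  ext x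
  rw [mem_hSet_iff]
  exact ⟨fun ⟨⟨h1, h2⟩, _, h3⟩ => ⟨h1, h3, h2⟩, fun ⟨h1, h2, h3⟩ => ⟨⟨h1, h3⟩, h1, h2⟩⟩

theorem isHCell_hSet {i j : B} (h : (cs.hSet i j).Nonempty) : cs.IsHCell (cs.hSet i j) := by
  obtain ⟨w, hw⟩ := id h
  obtain ⟨h1, h2, h3⟩ := cs.mem_hSet_iff.mp hw
  exact ⟨h, _, _, ⟨w, rfl⟩, ⟨w, rfl⟩, (cs.inter_cells_eq_hSet h1 h3 h1 h2).symm⟩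

theorem IsHCell.eq_hSet {cs : CoxeterSystem M W} {c : Set W} (hc : cs.IsHCell c) {i j : B}
    (h1 : c ⊆ cs.aLevel 1) (h2 : ∀ w ∈ c, cs.StartsEnds i j w) : c = cs.hSet i j := by
  obtain ⟨⟨w, hw⟩, _, _, ⟨u, rfl⟩, ⟨u', rfl⟩, rfl⟩ := hc
  have hr := (cs.mem_aLevel_one_iff.mp (h1 hw)).1
  obtain ⟨hi, hj⟩ := hr.startsEnds_iff.mp (h2 w hw)
  obtain ⟨⟨h3, h4⟩, h5, h6⟩ := hw
  rw [← cs.inter_cells_eq_hSet hr hj hr hi]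
  congr 1 <;> ext x
  · exact ⟨fun ⟨a, b⟩ => ⟨a.trans h4, h3.trans b⟩, fun ⟨a, b⟩ => ⟨a.trans h3, h4.trans b⟩⟩
  · exact ⟨fun ⟨a, b⟩ => ⟨a.trans h6, h5.trans b⟩, fun ⟨a, b⟩ => ⟨a.trans h5, h6.trans b⟩⟩

end CoxeterSystem

/-! ### Rigid words as a model of the sets h_{r,s}. -/

/-- The rigid words from `i` to `j`. -/
def CoxeterMatrix.rigidWords {B : Type*} (M : CoxeterMatrix B) (i j : B) : Set (List B) :=
  {ω | M.Rigid ω ∧ ω.head? = some i ∧ ω.getLast? = some j}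

namespace CoxeterSystem

variable {B W : Type*} [Group W] {M : CoxeterMatrix B} (cs : CoxeterSystem M W)

theorem injOn_wordProd : Set.InjOn cs.wordProd {ω | M.Rigid ω} := by
  intro ω hω ω' hω' h
  obtain ⟨h1, h2⟩ := cs.isReduced_isRigid_of_rigid hω
  obtain ⟨h3, -⟩ := cs.isReduced_isRigid_of_rigid hω'
  exact h2 _ _ h1 h3 rfl h.symm

theorem hSet_eq_image (i j : B) : cs.hSet i j = cs.wordProd '' M.rigidWords i j := by
  ext w
  rw [mem_hSet_iff]
  constructor
  · rintro ⟨h1, h2, h3⟩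
    obtain ⟨ω, hω, rfl⟩ := cs.exists_isReduced w
    exact ⟨ω, ⟨cs.rigid_of_isRigid hω h1, h1.head?_eq hω h2, h1.getLast?_eq hω h3⟩, rfl⟩
  · rintro ⟨ω, ⟨h1, h2, h3⟩, rfl⟩
    obtain ⟨h4, h5⟩ := cs.isReduced_isRigid_of_rigid h1
    exact ⟨h5, cs.isLeftDescent_of_head? h4 h2, cs.isRightDescent_of_getLast? h4 h3⟩

theorem encard_hSet (i j : B) : (cs.hSet i j).encard = (M.rigidWords i j).encard := by
  rw [hSet_eq_image]
  exact (cs.injOn_wordProd.mono fun _ h => h.1).encard_image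

theorem finite_rigid (h : (cs.aLevel 1).Finite) : {ω | M.Rigid ω}.Finite := by
  refine Set.Finite.of_finite_image ((h.insert 1).subset ?_) cs.injOn_wordProd
  rintro _ ⟨ω, hω, rfl⟩
  obtain ⟨h1, h2⟩ := cs.isReduced_isRigid_of_rigid hω
  by_cases h0 : cs.wordProd ω = 1
  · exact Or.inl h0
  · exact Or.inr (cs.mem_aLevel_one_iff.mpr ⟨h2, h0⟩)

end CoxeterSystem

namespace CoxeterMatrix

variable {B : Type*} {M : CoxeterMatrix B}

/-! ### Extending and reversing rigid words -/

theorem rigid_nil : M.Rigid [] := by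
  refine ⟨fun i h => ?_, fun i j hij h0 h => ?_⟩
  · simp at h
  · rw [List.infix_nil] at h
    have := congrArg List.length h
    simp at this
    exact h0 this

theorem Rigid.cons {ω : List B} (h : M.Rigid ω) {i : B} (h1 : ω.head? ≠ some i)
    (h2 : ∀ j, i ≠ j → M i j ≠ 0 → ¬ altWord i j (M i j) <+: i :: ω) : M.Rigid (i :: ω) := by
  constructor
  · intro j hj
    rcases List.infix_cons_iff.mp hj with hj | hj
    · rw [List.cons_prefix_cons] at hj
      obtain ⟨rfl, τ, rfl⟩ := hj
      exact h1 rfl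
    · exact h.1 j hj
  · intro k j hkj h0 hj
    rcases List.infix_cons_iff.mp hj with hj | hj
    · obtain ⟨n, hn⟩ := Nat.exists_eq_succ_of_ne_zero h0
      have hj' := hj
      rw [hn, altWord, List.cons_prefix_cons] at hj'
      obtain ⟨rfl, -⟩ := hj'
      exact h2 j hkj h0 hj
    · exact h.2 k j hkj h0 hj

theorem rigid_singleton (i : B) : M.Rigid [i] := by
  refine rigid_nil.cons (by simp) fun j hij h0 h => ?_
  have h1 := h.length_le
  have h2 := M.two_le_of_ne hij h0
  simp at h1
  omega

/-- A braid word at the front of i p ω alternates between i and p and has at least three letters. If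
the word turns back to i, the label exceeds 3, so the braid word would need a fourth letter p, which
the second condition forbids. -/
theorem Rigid.cons_cons {i p : B} {ω : List B} (h : M.Rigid (p :: ω))
    (hadj : M.dynkinDiagram.Adj i p)
    (hturn : ∀ τ, ω = i :: τ → (4 ≤ M i p ∨ M i p = 0) ∧ τ.head? ≠ some p) :
    M.Rigid (i :: p :: ω) := by
  refine h.cons (by simpa using hadj.1.symm) fun j hij h0 hpre => ?_
  obtain ⟨n, hn⟩ := Nat.exists_eq_add_of_le' (M.two_le_of_ne hij h0)
  have hpre' := hpre
  rw [hn, altWord, altWord, List.cons_prefix_cons, List.cons_prefix_cons] at hpre'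
  obtain ⟨-, rfl, hpre'⟩ := hpre'
  cases n with
  | zero => exact hadj.2 hn
  | succ n =>
    obtain ⟨τ, rfl⟩ : ∃ τ, ω = i :: τ := by
      rw [altWord] at hpre'
      obtain ⟨υ, rfl⟩ := hpre'
      exact ⟨_, rfl⟩
    obtain ⟨h4, hh⟩ := hturn τ rfl
    cases n with
    | zero => omega
    | succ n =>
      rw [altWord, altWord, List.cons_prefix_cons] at hpre'
      obtain ⟨υ, rfl⟩ := hpre'.2
      exact hh rfl

theorem Rigid.adj {i p : B} {ω : List B} (h : M.Rigid (i :: p :: ω)) :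
    M.dynkinDiagram.Adj i p := by
  refine ⟨?_, fun h2 => ?_⟩
  · rintro rfl
    exact h.1 i ⟨[], ω, rfl⟩
  · have hip : i ≠ p := by
      rintro rfl
      exact h.1 i ⟨[], ω, rfl⟩
    exact h.2 i p hip (by omega) ⟨[], ω, by simp [h2, altWord]⟩

theorem Rigid.ne_three {i p : B} {ω : List B} (h : M.Rigid (i :: p :: i :: ω)) : M i p ≠ 3 :=
  fun h3 => h.2 i p h.adj.1 (by omega) ⟨[], ω, by simp [h3, altWord]⟩

theorem reverse_altWord (i j : B) (k : ℕ) :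
    (altWord i j k).reverse = if Even k then altWord j i k else altWord i j k := by
  have hc : ∀ k (i j : B), altWord i j (k + 1) =
      altWord i j k ++ [if Even k then i else j] := by
    intro k
    induction k with
    | zero => intro i j; simp [altWord]
    | succ k ih =>
      intro i j
      rw [altWord, ih, altWord]
      by_cases hk : Even k <;> simp [hk, Nat.even_add_one]
  induction k generalizing i j with
  | zero => simp [altWord]
  | succ k ih =>
    rw [altWord, List.reverse_cons, ih]
    by_cases hk : Even k
    · simpa [hk, Nat.even_add_one, altWord] using (hc k i j).symm
    · simpa [hk, Nat.even_add_one] using (hc k j i).symm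

theorem Rigid.reverse {ω : List B} (h : M.Rigid ω) : M.Rigid ω.reverse := by
  refine ⟨fun i hi => h.1 i ?_, fun i j hij h0 hi => ?_⟩
  · rw [← List.reverse_infix]
    simpa using hi
  · rw [← List.reverse_infix, List.reverse_reverse, reverse_altWord] at hi
    split_ifs at hi
    · exact h.2 j i hij.symm (by rwa [M.symmetric]) (by rwa [M.symmetric j i])
    · exact h.2 i j hij h0 hi

theorem encard_rigidWords_le_swap (i j : B) :
    (M.rigidWords i j).encard ≤ (M.rigidWords j i).encard := by
  refine Set.encard_le_encard_of_injOn (f := List.reverse) ?_ List.reverse_injective.injOn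
  rintro ω ⟨h1, h2, h3⟩
  exact ⟨h1.reverse, by rw [List.head?_reverse, h3], by rw [List.getLast?_reverse, h2]⟩

theorem encard_rigidWords_swap (i j : B) :
    (M.rigidWords i j).encard = (M.rigidWords j i).encard :=
  le_antisymm (encard_rigidWords_le_swap i j) (encard_rigidWords_le_swap j i)

open Classical in
-- A word starting in i j loses its i; any other word gets a j in front. Two words with the same
-- image would make one of them start in i j i, which is a braid word.
theorem encard_rigidWords_le_of_eq_three {i j k : B} (h3 : M i j = 3) :
    (M.rigidWords i k).encard ≤ (M.rigidWords j k).encard := by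
  have hij : i ≠ j := by
    rintro rfl
    rw [M.diagonal] at h3
    omega
  have hadj : M.dynkinDiagram.Adj j i := ⟨hij.symm, by rw [M.symmetric]; omega⟩
  refine Set.encard_le_encard_of_injOn
    (f := fun ω => if ω.tail.head? = some j then ω.tail else j :: ω) ?_ ?_
  · rintro ω ⟨h1, h2, h4⟩
    obtain ⟨τ, rfl⟩ := List.head?_eq_some_iff.mp h2
    by_cases h : (i :: τ).tail.head? = some j
    · simp only [if_pos h]
      refine ⟨h1.of_infix (List.suffix_cons i τ).isInfix, h, ?_⟩
      obtain ⟨υ, rfl⟩ := List.head?_eq_some_iff.mp h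
      rwa [List.getLast?_cons_cons] at h4
    · simp only [if_neg h]
      refine ⟨h1.cons_cons hadj fun υ hυ => absurd (by rw [hυ]; rfl) h, rfl, ?_⟩
      rwa [List.getLast?_cons_cons]
  · rintro ω ⟨h1, h2, -⟩ ω' ⟨h1', h2', -⟩ he
    obtain ⟨τ, rfl⟩ := List.head?_eq_some_iff.mp h2
    obtain ⟨τ', rfl⟩ := List.head?_eq_some_iff.mp h2'
    by_cases h : (i :: τ).tail.head? = some j <;> by_cases h' : (i :: τ').tail.head? = some j
    · simp only [if_pos h, if_pos h'] at he
      exact congrArg (i :: ·) he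
    · simp only [if_pos h, if_neg h'] at he
      obtain rfl : τ = j :: i :: τ' := he
      exact absurd h3 h1.ne_three
    · simp only [if_neg h, if_pos h'] at he
      obtain rfl : j :: i :: τ = τ' := he
      exact absurd h3 h1'.ne_three
    · simp only [if_neg h, if_neg h'] at he
      exact (List.cons_eq_cons.mp he).2

theorem encard_rigidWords_eq_of_eq_three {i j : B} (k : B) (h3 : M i j = 3) :
    (M.rigidWords i k).encard = (M.rigidWords j k).encard :=
  le_antisymm (encard_rigidWords_le_of_eq_three h3)
    (encard_rigidWords_le_of_eq_three (by rwa [M.symmetric]))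

theorem encard_rigidWords_eq_of_walk {i j : B} (k : B) (p : M.dynkinDiagram.Walk i j)
    (h : ∀ x y, s(x, y) ∈ p.edges → M x y = 3) :
    (M.rigidWords i k).encard = (M.rigidWords j k).encard := by
  induction p with
  | nil => rfl
  | @cons i x j hadj q ih =>
    rw [encard_rigidWords_eq_of_eq_three k (h i x (by simp)),
      ih fun x y hxy => h x y (by simp [hxy])]

theorem rigid_of_nodup {ω : List B} (hc : ω.IsChain M.dynkinDiagram.Adj) (hn : ω.Nodup) :
    M.Rigid ω := by
  induction ω with
  | nil => exact rigid_nil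
  | cons i ω ih =>
    cases ω with
    | nil => exact rigid_singleton i
    | cons p ω =>
      rw [List.isChain_cons_cons] at hc
      refine (ih hc.2 hn.of_cons).cons_cons hc.1 ?_
      rintro τ rfl
      simp at hn

theorem rigidWords_nonempty (hconn : M.dynkinDiagram.Connected) (i j : B) :
    (M.rigidWords i j).Nonempty := by
  obtain ⟨p, hp, -⟩ := hconn.exists_path_of_dist i j
  refine ⟨p.support, rigid_of_nodup p.isChain_adj_support hp.support_nodup, ?_, ?_⟩
  · rw [List.head?_eq_some_head p.support_ne_nil, p.head_support]
  · rw [List.getLast?_eq_some_getLast p.support_ne_nil, p.getLast_support]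

theorem rigid_altWord {i j : B} (hij : i ≠ j) {k : ℕ} (hk : M i j = 0 ∨ k < M i j) :
    M.Rigid (altWord i j k) := by
  induction k generalizing i j with
  | zero => exact rigid_nil
  | succ k ih =>
    have hk' : M j i = 0 ∨ k < M j i := by rw [M.symmetric]; omega
    refine (ih hij.symm hk').cons ?_ fun l hil h0 hpre => ?_
    · cases k with
      | zero => simp [altWord]
      | succ k => simpa [altWord] using hij.symm
    · have hlen := hpre.length_le
      obtain ⟨n, hn⟩ := Nat.exists_eq_add_of_le' (M.two_le_of_ne hil h0)
      simp only [length_altWord, List.length_cons] at hlen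
      cases k with
      | zero => omega
      | succ k =>
        rw [hn] at hpre
        simp only [altWord, List.cons_prefix_cons] at hpre
        obtain ⟨-, rfl, -⟩ := hpre
        omega

/-! ### Consequences of finiteness -/

theorem exists_length_lt (hfin : {ω | M.Rigid ω}.Finite) :
    ∃ n, ∀ ω, M.Rigid ω → ω.length < n := by
  obtain ⟨n, hn⟩ := (hfin.image List.length).bddAbove
  exact ⟨n + 1, fun ω hω => Nat.lt_succ_iff.mpr (hn ⟨ω, hω, rfl⟩)⟩

/-- An infinite label would make all alternating words in i and j rigid. -/
theorem ne_zero_of_finite (hfin : {ω | M.Rigid ω}.Finite) {i j : B} (hij : i ≠ j) : M i j ≠ 0 := by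
  intro h0
  obtain ⟨n, hn⟩ := exists_length_lt hfin
  have := hn _ (rigid_altWord hij (k := n) (Or.inl h0))
  simp at this

/-- If every letter in `C` has two neighbours in `C`, or else is joined by an edge with a label at
least `4` to a letter with two neighbours in `C`, then there are infinitely many rigid words. -/
theorem false_of_branching (hfin : {ω | M.Rigid ω}.Finite) {C : Set B} (hne : C.Nonempty)
    (hC : ∀ q ∈ C, (∀ p, ∃ x ∈ C, M.dynkinDiagram.Adj q x ∧ x ≠ p) ∨
      ∃ p ∈ C, M.dynkinDiagram.Adj q p ∧ 4 ≤ M q p ∧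
        ∀ p', ∃ x ∈ C, M.dynkinDiagram.Adj p x ∧ x ≠ p') : False := by
  -- The word grows at the front: at a letter with two neighbours in C it moves on without turning,
  -- elsewhere it turns back along an edge with label at least 4. The last clause records that a
  -- turn just made was at a letter without two neighbours, so that no second turn follows
  -- immediately.
  have key : ∀ n : ℕ, ∃ q p ω, ω.length = n ∧ M.Rigid (q :: p :: ω) ∧ q ∈ C ∧ p ∈ C ∧
      (ω.head? = some q → ¬ ∀ p', ∃ x ∈ C, M.dynkinDiagram.Adj p x ∧ x ≠ p') := by
    intro n
    induction n with
    | zero =>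
      obtain ⟨q, hq⟩ := hne
      obtain ⟨x, hx, hadj⟩ : ∃ x ∈ C, M.dynkinDiagram.Adj q x := by
        rcases hC q hq with h | ⟨x, hx, h, -⟩
        · obtain ⟨x, hx, h, -⟩ := h q
          exact ⟨x, hx, h⟩
        · exact ⟨x, hx, h⟩
      exact ⟨x, q, [], rfl, (rigid_singleton q).cons_cons hadj.symm (by simp), hx, hq, by simp⟩
    | succ n ih =>
      obtain ⟨q, p, ω, rfl, hr, hq, hp, hinv⟩ := ih
      by_cases htwo : ∀ p', ∃ x ∈ C, M.dynkinDiagram.Adj q x ∧ x ≠ p'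
      · obtain ⟨x, hx, hadj, hxp⟩ := htwo p
        refine ⟨x, q, p :: ω, rfl, hr.cons_cons hadj.symm fun τ hτ => ?_, hx, hq, fun hh => ?_⟩
        · exact absurd (List.cons_eq_cons.mp hτ).1.symm hxp
        · exact absurd (by simpa using hh) hxp.symm
      · obtain ⟨x, hx, hadj, h4, htx⟩ := (hC q hq).resolve_left htwo
        refine ⟨x, q, p :: ω, rfl, hr.cons_cons hadj.symm fun τ hτ => ?_, hx, hq, fun _ => htwo⟩
        obtain ⟨rfl, rfl⟩ := List.cons_eq_cons.mp hτ
        exact ⟨Or.inl (by rwa [M.symmetric]), fun hh => hinv hh htx⟩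
  obtain ⟨n, hn⟩ := exists_length_lt hfin
  obtain ⟨q, p, ω, rfl, hr, -⟩ := key n
  have := hn _ hr
  simp only [List.length_cons] at this
  omega

theorem three_le_of_adj (hfin : {ω | M.Rigid ω}.Finite) {i j : B}
    (h : M.dynkinDiagram.Adj i j) : 3 ≤ M i j := by
  have h1 := ne_zero_of_finite hfin h.1
  have h2 := M.off_diagonal i j h.1
  have h3 := h.2
  omega

/-- A letter between two different letters of a chain has two neighbours in it. -/
theorem exists_adj_ne_of_infix {ω : List B} {a q b : B}
    (hc : ω.IsChain M.dynkinDiagram.Adj) (hi : [a, q, b] <:+: ω) (hab : a ≠ b) {C : Set B}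
    (hC : ∀ x ∈ ω, x ∈ C) (p : B) : ∃ x ∈ C, M.dynkinDiagram.Adj q x ∧ x ≠ p := by
  have hc' := hc.infix hi
  simp only [List.isChain_cons_cons, List.isChain_singleton, and_true] at hc'
  by_cases hp : a = p
  · exact ⟨b, hC b (hi.subset (by simp)), hc'.2, fun h => hab (hp.trans h.symm)⟩
  · exact ⟨a, hC a (hi.subset (by simp)), hc'.1.symm, hp⟩

theorem Rigid.isChain {ω : List B} (h : M.Rigid ω) : ω.IsChain M.dynkinDiagram.Adj := by
  induction ω with
  | nil => exact List.IsChain.nil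
  | cons i ω ih =>
    cases ω with
    | nil => exact List.IsChain.singleton i
    | cons p ω => exact List.IsChain.cons_cons h.adj (ih (h.of_infix (List.suffix_cons _ _).isInfix))

theorem exists_infix_of_mem {ω : List B} {v : B} (hv : v ∈ ω) (h1 : ω.head? ≠ some v)
    (h2 : ω.getLast? ≠ some v) : ∃ a b, [a, v, b] <:+: ω := by
  obtain ⟨l₁, l₂, rfl⟩ := List.append_of_mem hv
  rcases List.eq_nil_or_concat l₁ with rfl | ⟨l₁, a, rfl⟩
  · simp at h1
  cases l₂ with
  | nil => simp at h2
  | cons b l₂ => exact ⟨a, b, l₁, l₂, by simp⟩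

/-- Two such edges x'x and yy', joined by a shortest path from x to y, would form a chain along
which words can run back and forth, turning at the two heavy end edges. -/
theorem sym2_eq_of_four_le (hfin : {ω | M.Rigid ω}.Finite) (hconn : M.dynkinDiagram.Connected)
    {a b c d : B} (hab : a ≠ b) (hcd : c ≠ d) (h1 : 4 ≤ M a b) (h2 : 4 ≤ M c d) :
    s(a, b) = s(c, d) := by
  classical
  by_contra hne
  -- The nearest ends x and y of the two edges are chosen; minimality then keeps the far ends x' and
  -- y' off the path and distinct.
  have hex : ∃ n x x' y y', s(x, x') = s(a, b) ∧ s(y, y') = s(c, d) ∧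
      M.dynkinDiagram.dist x y = n := ⟨_, a, b, c, d, rfl, rfl, rfl⟩
  obtain ⟨x, x', y, y', hx, hy, hd⟩ := Nat.find_spec hex
  have hmin : ∀ z z' w w', s(z, z') = s(a, b) → s(w, w') = s(c, d) →
      M.dynkinDiagram.dist x y ≤ M.dynkinDiagram.dist z w := by
    intro z z' w w' hz hw
    rw [hd]
    exact Nat.find_min' hex ⟨z, z', w, w', hz, hw, rfl⟩
  have hbig : ∀ {i j k l : B}, s(i, j) = s(k, l) → 4 ≤ M k l → k ≠ l →
      4 ≤ M i j ∧ M.dynkinDiagram.Adj i j := by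
    intro i j k l he h4 hkl
    rcases Sym2.eq_iff.mp he with ⟨rfl, rfl⟩ | ⟨rfl, rfl⟩
    · exact ⟨h4, hkl, by omega⟩
    · rw [M.symmetric] at h4
      exact ⟨h4, hkl.symm, by omega⟩
  obtain ⟨hx4, hxx⟩ := hbig hx h1 hab
  obtain ⟨hy4, hyy⟩ := hbig hy h2 hcd
  obtain ⟨P, hP, hPd⟩ := hconn.exists_path_of_dist x y
  have hx' : x' ∉ P.support := by
    intro hm
    have hm' : x' ∈ P.reverse.support := by simpa using hm
    have h3 := SimpleGraph.Walk.length_takeUntil_lt_length hm' hxx.1.symm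
    have h4 := SimpleGraph.dist_le (P.reverse.takeUntil x' hm')
    have h5 := hmin x' x y y' (by rw [Sym2.eq_swap, hx]) hy
    rw [SimpleGraph.dist_comm] at h4
    rw [SimpleGraph.Walk.length_reverse] at h3
    omega
  have hy' : y' ∉ P.support := by
    intro hm
    have h3 := SimpleGraph.Walk.length_takeUntil_lt_length hm hyy.1.symm
    have h4 := SimpleGraph.dist_le (P.takeUntil y' hm)
    have h5 := hmin x x' y' y hx (by rw [Sym2.eq_swap, hy])
    omega
  have hxy' : x' ≠ y' := by
    rintro rfl
    have h5 := hmin x' x x' y (by rw [Sym2.eq_swap, hx]) (by rw [Sym2.eq_swap, hy])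
    rw [SimpleGraph.dist_self, Nat.le_zero] at h5
    rw [hconn.dist_eq_zero_iff] at h5
    subst h5
    exact hne (hx.symm.trans hy)
  set L := x' :: (P.support ++ [y']) with hL
  have hchain : L.IsChain M.dynkinDiagram.Adj := by
    refine List.isChain_cons.mpr ⟨?_, List.isChain_append.mpr ⟨P.isChain_adj_support,
      List.isChain_singleton _, ?_⟩⟩
    · intro z hz
      rw [List.head?_append_of_ne_nil _ P.support_ne_nil,
        List.head?_eq_some_head P.support_ne_nil, P.head_support] at hz
      obtain rfl : x = z := by simpa using hz
      exact hxx.symm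
    · intro u hu z hz
      rw [List.getLast?_eq_some_getLast P.support_ne_nil, P.getLast_support] at hu
      obtain rfl : y = u := by simpa using hu
      obtain rfl : y' = z := by simpa using hz
      exact hyy
  have hnodup : L.Nodup := by
    rw [hL, List.nodup_cons, List.nodup_append]
    refine ⟨by simp [hx', hxy'], hP.support_nodup, by simp, ?_⟩
    rintro u hu z hz rfl
    rw [List.mem_singleton] at hz
    exact hy' (hz ▸ hu)
  have htwo : ∀ v ∈ P.support, ∀ p, ∃ z ∈ {z | z ∈ L}, M.dynkinDiagram.Adj v z ∧ z ≠ p := by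
    intro v hv p
    obtain ⟨e, f, hi⟩ := exists_infix_of_mem (ω := L) (v := v) (by simp [hL, hv])
      (by rintro h; rw [hL] at h; simp at h; exact hx' (h ▸ hv))
      (by
        rintro h
        rw [hL, ← List.cons_append, List.getLast?_concat] at h
        simp at h
        exact hy' (h ▸ hv))
    have hef : e ≠ f := by
      rintro rfl
      have := hnodup.sublist hi.sublist
      simp at this
    exact exists_adj_ne_of_infix hchain hi hef (fun _ h => h) p
  refine false_of_branching hfin (C := {z | z ∈ L}) ⟨x', by simp [hL]⟩ fun q hq => ?_
  have hq' : q = x' ∨ q ∈ P.support ∨ q = y' := by simpa [hL] using hq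
  rcases hq' with rfl | hq' | rfl
  · exact Or.inr ⟨x, by simp [hL], hxx.symm, by rwa [M.symmetric], htwo x (by simp)⟩
  · exact Or.inl (htwo q hq')
  · exact Or.inr ⟨y, by simp [hL], hyy.symm, by rwa [M.symmetric], htwo y (by simp)⟩

theorem exists_infix_of_head?_mem {ω : List B} {S : Set B} {i c : B} (hi : ω.head? = some i)
    (hiS : i ∈ S) (hc : c ∈ ω) (hcS : c ∉ S) : ∃ x ∈ S, ∃ y ∉ S, [x, y] <:+: ω := by
  induction ω generalizing i with
  | nil => simp at hc
  | cons j ω ih =>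
    obtain rfl : j = i := by simpa using hi
    rcases List.mem_cons.mp hc with rfl | hc
    · exact absurd hiS hcS
    cases ω with
    | nil => simp at hc
    | cons k ω =>
      by_cases hk : k ∈ S
      · obtain ⟨x, hx, y, hy, h⟩ := ih (i := k) rfl hk hc
        exact ⟨x, hx, y, hy, h.trans (List.suffix_cons j _).isInfix⟩
      · exact ⟨j, hiS, k, hk, [], ω, rfl⟩

/-- If `a`, `b` are joined by an edge with label at least `4`, then a rigid word which starts and
ends in `{a, b}` has all its letters there. -/
theorem mem_pair_of_rigid (hfin : {ω | M.Rigid ω}.Finite) (hconn : M.dynkinDiagram.Connected)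
    {a b : B} (hab : a ≠ b) (h4 : 4 ≤ M a b) {ω : List B} (hω : M.Rigid ω) {i j : B}
    (hi : ω.head? = some i) (hj : ω.getLast? = some j) (hia : i = a ∨ i = b) (hja : j = a ∨ j = b)
    {v : B} (hv : v ∈ ω) : v = a ∨ v = b := by
  by_contra hvab
  -- Branching is applied to this set. A letter of ω outside {a, b} has two neighbours in ω, since
  -- turning there would need a second edge with a label at least 4. The end x of the edge where ω
  -- leaves {a, b} has the other end and the next letter c as neighbours; the other end is then
  -- allowed as a turning point.
  set C : Set B := {z | z ∈ ω ∨ z = a ∨ z = b} with hC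
  have hadj : M.dynkinDiagram.Adj a b := ⟨hab, by omega⟩
  have htwo : ∀ z ∈ ω, ¬ (z = a ∨ z = b) → ∀ p, ∃ x ∈ C, M.dynkinDiagram.Adj z x ∧ x ≠ p := by
    intro z hz hzab
    obtain ⟨e, f, hin⟩ := exists_infix_of_mem hz
      (fun h => hzab (by rw [hi] at h; exact Option.some_injective _ h ▸ hia))
      (fun h => hzab (by rw [hj] at h; exact Option.some_injective _ h ▸ hja))
    refine exists_adj_ne_of_infix hω.isChain hin ?_ (fun _ h => Or.inl h)
    rintro rfl
    have hr := hω.of_infix hin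
    have h5 := three_le_of_adj hfin hr.adj
    have h6 := hr.ne_three
    have h7 := sym2_eq_of_four_le hfin hconn hr.adj.1 hab (by omega) h4
    rcases Sym2.eq_iff.mp h7 with ⟨-, h⟩ | ⟨-, h⟩
    · exact hzab (Or.inr h)
    · exact hzab (Or.inl h)
  obtain ⟨x, hx, c, hc, hin⟩ := exists_infix_of_head?_mem (S := {z | z = a ∨ z = b}) hi hia hv hvab
  have hxc := (hω.of_infix hin).adj
  have hcω : c ∈ ω := hin.subset (by simp)
  have hfinal : ∀ x x' : B, M.dynkinDiagram.Adj x x' → 4 ≤ M x x' → M.dynkinDiagram.Adj x c →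
      c ≠ x' → (∀ z, z = x ∨ z = x' ↔ z = a ∨ z = b) → False := by
    intro x x' hxx h4' hxc hcx hz
    have hx2 : ∀ p, ∃ z ∈ C, M.dynkinDiagram.Adj x z ∧ z ≠ p := by
      intro p
      by_cases hp : c = p
      · exact ⟨x', Or.inr ((hz x').mp (Or.inr rfl)), hxx, fun h => hcx (hp.trans h.symm)⟩
      · exact ⟨c, Or.inl hcω, hxc, hp⟩
    refine false_of_branching hfin (C := C) ⟨c, Or.inl hcω⟩ fun q hq => ?_
    by_cases hqab : q = a ∨ q = b
    · rcases (hz q).mpr hqab with rfl | rfl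
      · exact Or.inl hx2
      · exact Or.inr ⟨x, Or.inr ((hz x).mp (Or.inl rfl)), hxx.symm, by rwa [M.symmetric], hx2⟩
    · exact Or.inl (htwo q (hq.resolve_right hqab) hqab)
  rcases hx with rfl | rfl
  · exact hfinal _ b hadj h4 hxc (fun h => hc (Or.inr h)) fun z => Iff.rfl
  · exact hfinal _ a hadj.symm (by rwa [M.symmetric]) hxc (fun h => hc (Or.inl h))
      fun z => or_comm

/-! ### Counting rigid words with ends on an edge of label at least 4. -/

theorem eq_altWord_of_rigid {ω : List B} (hω : M.Rigid ω) {a b : B} (ha : ω.head? = some a)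
    (h : ∀ v ∈ ω, v = a ∨ v = b) : ω = altWord a b ω.length := by
  induction ω generalizing a b with
  | nil => rfl
  | cons i ω ih =>
    obtain rfl : i = a := by simpa using ha
    rw [List.length_cons, altWord]
    congr 1
    cases ω with
    | nil => rfl
    | cons k ω =>
      have hik := hω.adj.1
      obtain rfl : k = b := (h k (by simp)).resolve_left hik.symm
      exact ih (hω.of_infix (List.suffix_cons _ _).isInfix) rfl
        fun v hv => (h v (List.mem_cons_of_mem _ hv)).symm

theorem getLast?_altWord (a b : B) (k : ℕ) :
    (altWord a b (k + 1)).getLast? = some (if Even k then a else b) := by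
  rw [← List.head?_reverse, reverse_altWord]
  by_cases hk : Even k <;> simp [hk, Nat.even_add_one, altWord]

theorem altWord_prefix (a b : B) {m k : ℕ} (h : m ≤ k) : altWord a b m <+: altWord a b k := by
  induction m generalizing a b k with
  | zero => exact List.nil_prefix
  | succ m ih =>
    obtain ⟨k, rfl⟩ := Nat.exists_eq_add_of_le' (show 1 ≤ k by omega)
    rw [altWord, altWord, List.cons_prefix_cons]
    exact ⟨rfl, ih b a (by omega)⟩

theorem not_rigid_altWord {a b : B} (hab : a ≠ b) (h0 : M a b ≠ 0) {k : ℕ} (hk : M a b ≤ k) :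
    ¬ M.Rigid (altWord a b k) := by
  intro h
  exact h.2 a b hab h0 (altWord_prefix a b hk).isInfix

/-- By `mem_pair_of_rigid` such a word never leaves {a, b}, so it alternates; rigidity bounds its
length k + 1 below the label. The parity of k decides the last letter. -/
theorem mem_rigidWords_iff_of_four_le (hfin : {ω | M.Rigid ω}.Finite)
    (hconn : M.dynkinDiagram.Connected) {a b : B} (hab : a ≠ b) (h4 : 4 ≤ M a b) {j : B}
    (hj : j = a ∨ j = b) {ω : List B} : ω ∈ M.rigidWords a j ↔
      ∃ k, k + 1 < M a b ∧ (if Even k then a else b) = j ∧ ω = altWord a b (k + 1) := by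
  constructor
  · rintro ⟨h1, h2, h3⟩
    have h := eq_altWord_of_rigid h1 h2
      fun v hv => mem_pair_of_rigid hfin hconn hab h4 h1 h2 h3 (Or.inl rfl) hj hv
    have hne : ω.length ≠ 0 := by
      intro h0
      rw [List.length_eq_zero_iff] at h0
      simp [h0] at h2
    obtain ⟨k, hk⟩ := Nat.exists_eq_succ_of_ne_zero hne
    rw [hk, Nat.succ_eq_add_one] at h
    refine ⟨k, ?_, ?_, h⟩
    · by_contra hlt
      exact not_rigid_altWord hab (by omega) (k := k + 1) (by omega) (h ▸ h1)
    · rw [h, getLast?_altWord] at h3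
      exact Option.some_injective _ h3
  · rintro ⟨k, hk, rfl, rfl⟩
    exact ⟨rigid_altWord hab (Or.inr hk), rfl, getLast?_altWord a b k⟩

theorem encard_rigidWords_self (hfin : {ω | M.Rigid ω}.Finite)
    (hconn : M.dynkinDiagram.Connected) {a b : B} (hab : a ≠ b) (h4 : 4 ≤ M a b) :
    (M.rigidWords a a).encard = (M a b / 2 : ℕ) := by
  have he : M.rigidWords a a = (fun k => altWord a b (2 * k + 1)) ''
      (Finset.range (M a b / 2) : Set ℕ) := by
    ext ω
    rw [mem_rigidWords_iff_of_four_le hfin hconn hab h4 (Or.inl rfl)]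
    constructor
    · rintro ⟨k, hk, hj, rfl⟩
      have hev : Even k := by
        by_contra hk
        rw [if_neg hk] at hj
        exact hab hj.symm
      obtain ⟨l, rfl⟩ := hev.two_dvd
      exact ⟨l, by simp; omega, rfl⟩
    · rintro ⟨k, hk, rfl⟩
      rw [Finset.mem_coe, Finset.mem_range] at hk
      exact ⟨2 * k, by omega, by simp, rfl⟩
  rw [he, Set.InjOn.encard_image, Set.encard_coe_eq_coe_finsetCard, Finset.card_range]
  intro k _ l _ hkl
  have := congrArg List.length hkl
  simp at this
  omega

theorem encard_rigidWords_of_four_le (hfin : {ω | M.Rigid ω}.Finite)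
    (hconn : M.dynkinDiagram.Connected) {a b : B} (hab : a ≠ b) (h4 : 4 ≤ M a b) :
    (M.rigidWords a b).encard = ((M a b - 1) / 2 : ℕ) := by
  have he : M.rigidWords a b = (fun k => altWord a b (2 * k + 2)) ''
      (Finset.range ((M a b - 1) / 2) : Set ℕ) := by
    ext ω
    rw [mem_rigidWords_iff_of_four_le hfin hconn hab h4 (Or.inr rfl)]
    constructor
    · rintro ⟨k, hk, hj, rfl⟩
      have hodd : ¬ Even k := by
        intro hk
        rw [if_pos hk] at hj
        exact hab hj
      obtain ⟨l, rfl⟩ := Nat.not_even_iff_odd.mp hodd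
      exact ⟨l, by simp; omega, rfl⟩
    · rintro ⟨k, hk, rfl⟩
      rw [Finset.mem_coe, Finset.mem_range] at hk
      exact ⟨2 * k + 1, by omega, by simp, rfl⟩
  rw [he, Set.InjOn.encard_image, Set.encard_coe_eq_coe_finsetCard, Finset.card_range]
  intro k _ l _ hkl
  have := congrArg List.length hkl
  simp at this
  omega

/-- If all labels are `3`, then there are no closed rigid words. -/
theorem length_le_one_of_closed (hfin : {ω | M.Rigid ω}.Finite)
    (h3 : ∀ i j, M.dynkinDiagram.Adj i j → M i j = 3) {ω : List B} (hω : M.Rigid ω)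
    (he : ω.head? = ω.getLast?) : ω.length ≤ 1 := by
  induction hn : ω.length using Nat.strong_induction_on generalizing ω with
  | _ n ih =>
  by_contra hlen
  obtain ⟨i, τ, rfl⟩ := List.exists_cons_of_length_pos (l := ω) (by omega)
  rw [List.length_cons] at hn
  obtain ⟨σ, j, rfl⟩ := (List.eq_nil_or_concat τ).resolve_left (by rintro rfl; simp at hn; omega)
  rw [List.concat_eq_append] at *
  rw [← List.cons_append, List.getLast?_concat] at he
  obtain rfl : i = j := by simpa using he
  rw [← List.cons_append] at hω
  have hσ : M.Rigid σ := (hω.of_infix (List.prefix_append _ _).isInfix).of_infix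
    (List.suffix_cons _ _).isInfix
  cases hσe : σ with
  | nil =>
    rw [hσe] at hω
    exact hω.1 i ⟨[], [], rfl⟩
  | cons e σ' =>
  obtain ⟨σ'', f, hσf⟩ := (List.eq_nil_or_concat σ).resolve_left (by rw [hσe]; simp)
  rw [List.concat_eq_append] at hσf
  by_cases hef : e = f
  -- The word is i σ i. If σ is closed too, it is a single letter e by induction, and i e i is a
  -- braid word. Otherwise i has the two ends of σ as neighbours, every letter of the word has two
  -- neighbours in it, and `false_of_branching` applies.
  · have hle := ih σ.length (by simp at hn; omega) hσ
      (by rw [hσf, List.getLast?_concat, ← hσf, hσe, hef]; rfl) rfl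
    have hnil : σ' = [] := by
      rw [hσe, List.length_cons] at hle
      exact List.length_eq_zero_iff.mp (by omega)
    rw [hσe, hnil] at hω
    exact hω.ne_three (h3 _ _ hω.adj)
  · have hie : M.dynkinDiagram.Adj i e := by
      rw [hσe] at hω
      exact hω.adj
    have hif : M.dynkinDiagram.Adj i f := by
      have := hω.reverse
      rw [hσf] at this
      simp only [List.reverse_append, List.reverse_cons, List.reverse_nil, List.nil_append,
        List.cons_append] at this
      exact this.adj
    refine false_of_branching hfin (C := {z | z ∈ i :: σ ++ [i]}) ⟨i, by simp⟩
      fun q hq => Or.inl ?_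
    by_cases hqi : q = i
    · intro p
      by_cases hp : e = p
      · exact ⟨f, by simp [hσf], hqi ▸ hif, fun h => hef (hp.trans h.symm)⟩
      · exact ⟨e, by simp [hσe], hqi ▸ hie, hp⟩
    · obtain ⟨c, d, hin⟩ := exists_infix_of_mem hq (by simpa using fun h => hqi h.symm)
        (by rw [List.getLast?_concat]; simpa using fun h => hqi h.symm)
      refine exists_adj_ne_of_infix hω.isChain hin ?_ (fun _ h => h)
      rintro rfl
      have hr := hω.of_infix hin
      exact hr.ne_three (h3 _ _ hr.adj)

theorem encard_rigidWords_self_of_three (hfin : {ω | M.Rigid ω}.Finite)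
    (h3 : ∀ i j, M.dynkinDiagram.Adj i j → M i j = 3) (i : B) :
    (M.rigidWords i i).encard = 1 := by
  rw [Set.encard_eq_one]
  refine ⟨[i], ?_⟩
  ext ω
  rw [Set.mem_singleton_iff]
  constructor
  · rintro ⟨h1, h2, h4⟩
    have := length_le_one_of_closed hfin h3 h1 (h2.trans h4.symm)
    obtain ⟨τ, rfl⟩ := List.head?_eq_some_iff.mp h2
    rw [List.length_cons] at this
    rw [List.length_eq_zero_iff.mp (show τ.length = 0 by omega)]
  · rintro rfl
    exact ⟨rigid_singleton i, rfl, rfl⟩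

/-! ### The largest label -/

theorem label_eq (hfin : {ω | M.Rigid ω}.Finite) {i j : B} (hij : i ≠ j) :
    M.label i j = (M i j : ℕ∞) := if_neg (ne_zero_of_finite hfin hij)

theorem exists_isGreatest_edgeLabels [Nontrivial B] (hfin : {ω | M.Rigid ω}.Finite)
    (hconn : M.dynkinDiagram.Connected) : ∃ m : ℕ, IsGreatest M.edgeLabels (m : ℕ∞) := by
  -- The one-letter words are rigid, so there are only finitely many generators and hence finitely
  -- many labels.
  have hB : Finite B := by
    have := hfin.to_subtype
    refine Finite.of_injective (fun i : B => (⟨[i], rigid_singleton i⟩ : {ω | M.Rigid ω})) ?_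
    intro i j h
    simpa using congrArg Subtype.val h
  have hf : M.edgeLabels.Finite := by
    refine (Set.finite_range fun x : B × B => M.label x.1 x.2).subset ?_
    rintro _ ⟨i, j, -, rfl⟩
    exact ⟨(i, j), rfl⟩
  have hne : M.edgeLabels.Nonempty := by
    obtain ⟨i⟩ := hconn.nonempty
    obtain ⟨j, hj⟩ := hconn.preconnected.exists_adj_of_nontrivial i
    exact ⟨_, i, j, hj, rfl⟩
  obtain ⟨l, hl, hmax⟩ := Set.exists_max_image _ id hf hne
  obtain ⟨i, j, hij, rfl⟩ := id hl
  refine ⟨M i j, ?_⟩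
  rw [← label_eq hfin hij.1]
  exact ⟨hl, fun x hx => hmax x hx⟩

/-- Along a walk to the edge {a, b} the starting letter can be moved until that edge is first used.
The end t of the edge does not depend on k, so both ends of a closed word can be moved to the same
t. -/
theorem exists_encard_rigidWords_eq {a b c i : B}
    (h : ∀ i j, M.dynkinDiagram.Adj i j → s(i, j) = s(a, b) ∨ M i j = 3)
    (hc : c = a) (p : M.dynkinDiagram.Walk i c) : ∃ t, (t = a ∨ t = b) ∧
      ∀ k, (M.rigidWords i k).encard = (M.rigidWords t k).encard := by
  induction p with
  | nil => exact ⟨_, Or.inl hc, fun _ => rfl⟩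
  | cons hadj q ih =>
    rcases h _ _ hadj with he | h3
    · refine ⟨_, ?_, fun k => rfl⟩
      rcases Sym2.eq_iff.mp he with ⟨h, -⟩ | ⟨h, -⟩
      · exact Or.inl h
      · exact Or.inr h
    · obtain ⟨t, ht, hk⟩ := ih hc
      exact ⟨t, ht, fun k => (encard_rigidWords_eq_of_eq_three k h3).trans (hk k)⟩

/-- The edges before the m-edge move the starting letter. Those after it also have label 3, because
the m-edge is unique and is not used twice, and they move the last letter after reversing the words.
-/
theorem encard_rigidWords_eq_of_mem_edges (hfin : {ω | M.Rigid ω}.Finite)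
    (hconn : M.dynkinDiagram.Connected) {m : ℕ} (h4 : 4 ≤ m)
    (h : ∀ i j, M.dynkinDiagram.Adj i j → M i j = m ∨ M i j = 3) {i j : B}
    (p : M.dynkinDiagram.Walk i j) (hp : p.edges.Nodup)
    (hm : ∃ x y, s(x, y) ∈ p.edges ∧ M x y = m) :
    (M.rigidWords i j).encard = ((m - 1) / 2 : ℕ) := by
  induction p with
  | nil => simp at hm
  | @cons i x j hadj q ih =>
    rw [SimpleGraph.Walk.edges_cons, List.nodup_cons] at hp
    rcases h _ _ hadj with he | h3
    · have hq : ∀ y z, s(y, z) ∈ q.edges → M y z = 3 := by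
        intro y z hyz
        have hyz' := q.adj_of_mem_edges hyz
        refine (h y z hyz').resolve_left fun hyzm => hp.1 ?_
        rwa [sym2_eq_of_four_le hfin hconn hadj.1 hyz'.1 (by omega) (by omega)]
      rw [encard_rigidWords_swap, ← encard_rigidWords_eq_of_walk i q hq, encard_rigidWords_swap,
        encard_rigidWords_of_four_le hfin hconn hadj.1 (by omega), he]
    · rw [encard_rigidWords_eq_of_eq_three j h3]
      refine ih hp.2 ?_
      obtain ⟨y, z, hyz, hyzm⟩ := hm
      rw [SimpleGraph.Walk.edges_cons, List.mem_cons] at hyz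
      refine ⟨y, z, hyz.resolve_left fun he => ?_, hyzm⟩
      rcases Sym2.eq_iff.mp he with ⟨rfl, rfl⟩ | ⟨rfl, rfl⟩
      · omega
      · rw [M.symmetric] at h3
        omega

theorem encard_rigidWords (hfin : {ω | M.Rigid ω}.Finite) (hconn : M.dynkinDiagram.Connected)
    {m : ℕ} (hm : IsGreatest M.edgeLabels (m : ℕ∞)) {i j : B} (p : M.dynkinDiagram.Walk i j)
    (hp : p.edges.Nodup) :
    ((∃ x y, s(x, y) ∈ p.edges ∧ M x y = m) →
      (M.rigidWords i j).encard = ((m - 1) / 2 : ℕ)) ∧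
    ((¬ ∃ x y, s(x, y) ∈ p.edges ∧ M x y = m) → (M.rigidWords i j).encard = (m / 2 : ℕ)) := by
  obtain ⟨⟨a, b, hab, hl⟩, hmax⟩ := hm
  rw [label_eq hfin hab.1] at hl
  have hMm : M a b = m := by exact_mod_cast hl
  have hle : ∀ x y, M.dynkinDiagram.Adj x y → M x y ≤ m := by
    intro x y hxy
    have := hmax ⟨x, y, hxy, rfl⟩
    rw [label_eq hfin hxy.1] at this
    exact_mod_cast this
  have hm3 := three_le_of_adj hfin hab
  rw [hMm] at hm3
  -- For m = 3 both ⌊m/2⌋ and ⌊(m-1)/2⌋ are 1, so the path plays no role.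
  rcases hm3.eq_or_lt with rfl | h4
  · have h3 : ∀ x y, M.dynkinDiagram.Adj x y → M x y = 3 :=
      fun x y hxy => le_antisymm (hle x y hxy) (three_le_of_adj hfin hxy)
    have h1 : (M.rigidWords i j).encard = 1 := by
      rw [encard_rigidWords_eq_of_walk j p fun x y hxy => h3 x y (p.adj_of_mem_edges hxy),
        encard_rigidWords_self_of_three hfin h3]
    exact ⟨fun _ => h1, fun _ => h1⟩
  · have huniq : ∀ x y, M.dynkinDiagram.Adj x y → s(x, y) = s(a, b) ∨ M x y = 3 := by
      intro x y hxy
      by_cases hxy3 : M x y = 3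
      · exact Or.inr hxy3
      · have := three_le_of_adj hfin hxy
        exact Or.inl (sym2_eq_of_four_le hfin hconn hxy.1 hab.1 (by omega) (by omega))
    have hsym : ∀ x y, s(x, y) = s(a, b) → M x y = m := by
      intro x y he
      rcases Sym2.eq_iff.mp he with ⟨rfl, rfl⟩ | ⟨rfl, rfl⟩
      · exact hMm
      · rw [M.symmetric, hMm]
    refine ⟨encard_rigidWords_eq_of_mem_edges hfin hconn h4
      (fun x y hxy => (huniq x y hxy).imp_left (hsym x y)) p hp, fun hno => ?_⟩
    rw [encard_rigidWords_eq_of_walk j p fun x y hxy =>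
      (huniq x y (p.adj_of_mem_edges hxy)).resolve_left fun he => hno ⟨x, y, hxy, hsym x y he⟩]
    -- Along the path, i has been moved to j without crossing the m-edge. Now both ends are moved
    -- from j to the same end of the m-edge.
    obtain ⟨q⟩ := hconn.preconnected j a
    obtain ⟨t, ht, hk⟩ := exists_encard_rigidWords_eq huniq rfl q
    rw [hk, encard_rigidWords_swap, hk]
    rcases ht with rfl | rfl
    · rw [encard_rigidWords_self hfin hconn hab.1 (by omega), hMm]
    · rw [encard_rigidWords_self hfin hconn hab.1.symm (by rw [M.symmetric]; omega), M.symmetric,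
        hMm]

end CoxeterMatrix

theorem mainTheorem10 {B W : Type*} [Group W] {M : CoxeterMatrix B} (cs : CoxeterSystem M W)
    (hirr : M.dynkinDiagram.Connected) (hfin : (cs.aLevel 1).Finite) :
    -- outside rank one there is a maximal edge label, and it is finite
    (Nontrivial B → ∃ m : ℕ, IsGreatest M.edgeLabels (m : ℕ∞)) ∧
    ∀ r s : B,
      -- `h_{r,s}` is an `H`-cell in `W_1` whose words all start in `r` and end in `s` ...
      (cs.IsHCell (cs.hSet r s) ∧
        ∀ ω : List B, cs.IsReduced ω → cs.wordProd ω ∈ cs.hSet r s →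
          ω.head? = some r ∧ ω.getLast? = some s) ∧
      -- ... and the only one
      (∀ h : Set W, cs.IsHCell h → h ⊆ cs.aLevel 1 → (∀ w ∈ h, cs.StartsEnds r s w) →
        h = cs.hSet r s) ∧
      -- its size, in terms of the maximal label `m` and the shortest path `p` from `r` to `s`
      ∀ m : ℕ, IsGreatest M.edgeLabels (m : ℕ∞) →
        ∀ p : M.dynkinDiagram.Walk r s, p.length = M.dynkinDiagram.dist r s →
          ((∃ i j, s(i, j) ∈ p.edges ∧ M i j = m) →
            (cs.hSet r s).encard = ((m - 1) / 2 : ℕ)) ∧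
          ((¬ ∃ i j, s(i, j) ∈ p.edges ∧ M i j = m) →
            (cs.hSet r s).encard = (m / 2 : ℕ)) := by
  have hrig := cs.finite_rigid hfin
  refine ⟨fun _ => CoxeterMatrix.exists_isGreatest_edgeLabels hrig hirr, fun r s => ⟨⟨?_, ?_⟩,
    fun c hc h1 h2 => hc.eq_hSet h1 h2, fun m hm p hp => ?_⟩⟩
  · refine cs.isHCell_hSet ?_
    rw [cs.hSet_eq_image]
    exact (CoxeterMatrix.rigidWords_nonempty hirr r s).image _
  · intro ω hω hw
    obtain ⟨h1, h2, h3⟩ := cs.mem_hSet_iff.mp hw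
    exact ⟨h1.head?_eq hω h2, h1.getLast?_eq hω h3⟩
  · rw [cs.encard_hSet]
    exact CoxeterMatrix.encard_rigidWords hrig hirr hm p
      (p.isPath_of_length_eq_dist hp).isTrail.edges_nodup
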